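/- Conventions. Let $G$ be a group with a finite symmetric family of generators $\Sigma$. A knapsack expression over $\Sigma$ is a formal expression $e=u_1^{x_1}v_1u_2^{x_2}v_2\cdots u_k^{x_k}v_k$ with $k\ge 1$, words $u_i,v_i\in\Sigma^*$, all $u_i$ non-empty, and pairwise distinct variables $x_1,\dots,x_k$; its degree is $\deg(e)=k$ and its length is $\|e\|=\sum_{i=1}^k(|u_i|+|v_i|)$. Let $\mathsf{sol}_G(e)\subseteq\mathbb N^k$ be the set of all $(x_1,\dots,x_k)\in\mathbb{N}^k$ for which $e$ evaluates to $1$ in $G$. A semilinear representation of a set $S\subseteq\mathbb N^k$ is a finite family of pairs $(b_j,P_j)$, where $b_j\in\mathbb{N}^k$ and $P_j$ is a matrix over $\mathbb N$ with $k$ rows and finitely many columns, such that $S=\bigcup_j (b_j+P_j\cdot\mathbb N^{l_j})$, where $l_j$ is the number of columns of $P_j$; its magnitude is the largest number that occurs in it. $S$ is semilinear if it has a semilinear representation, and then $\mathsf{mag}(S)$ is the smallest magnitude of a semilinear representation of $S$. $G$ is knapsack-semilinear if $\mathsf{sol}_G(e)$ is semilinear for every knapsack expression $e$ and a semilinear representation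 of it can be computed from $e$ by an algorithm. For $m\le n$ let $\mathsf K_{G,\Sigma}(n,m)$ be the maximum of $\mathsf{mag}(\mathsf{sol}_G(e))$ over all knapsack expressions $e$ over $\Sigma$ with $\mathsf{sol}_G(e)\ne\emptyset$, $\|e\|\le n$ and $\deg(e)\le m$ (and $0$ if there are none). Theorem. There is an absolute constant $C$ such that the following holds. Let $G$ be a group with a finite symmetric family of generators $\Sigma$, let $A,B\le G$ be finite subgroups with $(A\cup B)\setminus\{1\}\subseteq\Sigma$, let $\gamma=|A|$, let $\varphi\colon A\to B$ be an isomorphism, and let $H=\langle G,t\mid t^{-1}at=\varphi(a)\ (a\in A)\rangle$ be the corresponding HNN-extension, with the generators $\Sigma\cup\{t,t^{-1}\}$. (1) If all sets $\mathsf{sol}_G(e)$ with $e$ a knapsack expression over $\Sigma$ are semilinear, then all sets $\mathsf{sol}_H(e)$ with $e$ a knapsack expression over $\Sigma\cup\{t,t^{-1}\}$ are semilinear, and for all $n,m\in\mathbb N$ with $m\le n$, $$\mathsf K_{H,\Sigma\cup\{t,t^{-1}\}}(n,m)\le\max\{\mathsf K_{G,\Sigma}(24mn,m),\ C\gamma^2mn^4\}.$$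 (2) If $G$ is knapsack-semilinear, then $H$ is knapsack-semilinear. -/

import Mathlib

namespace Knapsack

open scoped Pointwise

/-! ### Semilinear representations and the magnitude of a semilinear set -/

/-- A semilinear representation `(b₁, P₁, …, b_k, P_k)` in dimension `d`: a list of pairs of a base
vector and the list of the columns of a matrix of periods. -/
abbrev SemilinearRep (d : ℕ) := List ((Fin d → ℕ) × List (Fin d → ℕ))

/-- The linear set `L(b, P) = b + P · ℕ^k`, that is, the translate by `b` of the set of all
`ℕ`-linear combinations of the columns of `P`. -/
def linearSet {d : ℕ} (b : Fin d → ℕ) (P : List (Fin d → ℕ)) : Set (Fin d → ℕ) :=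
  b +ᵥ (AddSubmonoid.closure {p | p ∈ P} : Set (Fin d → ℕ))

/-- The set given by a semilinear representation: the union of its linear sets. -/
def SemilinearRep.toSet {d : ℕ} (R : SemilinearRep d) : Set (Fin d → ℕ) :=
  ⋃ q ∈ R, linearSet q.1 q.2

/-- The maximum norm of a vector over `ℕ`. -/
def vecNorm {d : ℕ} (v : Fin d → ℕ) : ℕ := Finset.univ.sup v

/-- The norm of a semilinear representation: the largest number occurring in it. -/
def SemilinearRep.norm {d : ℕ} (R : SemilinearRep d) : ℕ :=
  (R.map fun q => max (vecNorm q.1) ((q.2.map vecNorm).foldr max 0)).foldr max 0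

/-- The magnitude of a semilinear set: the least norm of a semilinear representation of it. -/
noncomputable def mag {d : ℕ} (S : Set (Fin d → ℕ)) : ℕ :=
  sInf {s | ∃ R : SemilinearRep d, R.toSet = S ∧ R.norm = s}

/-- Mathlib's semilinear sets are exactly the sets that have a semilinear representation, so that
the infimum in the definition of `mag` is a minimum for every semilinear set. -/
theorem isSemilinearSet_iff_exists_rep {d : ℕ} (S : Set (Fin d → ℕ)) :
    IsSemilinearSet S ↔ ∃ R : SemilinearRep d, R.toSet = S := by
  constructor
  · rintro ⟨T, hT, hlin, rfl⟩
    induction T, hT using Set.Finite.induction_on with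
    | empty => exact ⟨[], by simp [SemilinearRep.toSet]⟩
    | @insert t T _ _ ih =>
      obtain ⟨R, hR⟩ := ih fun t ht => hlin t (Set.mem_insert_of_mem _ ht)
      obtain ⟨b, P, hP, rfl⟩ := hlin t (Set.mem_insert _ _)
      refine ⟨(b, hP.toFinset.toList) :: R, ?_⟩
      simp only [SemilinearRep.toSet] at hR
      simp [SemilinearRep.toSet, linearSet, Set.iUnion_or, Set.iUnion_union_distrib,
        ← hR, Set.sUnion_insert]
  · rintro ⟨R, rfl⟩
    refine IsSemilinearSet.biUnion (s := {q | q ∈ R}) (List.finite_toSet R) fun q _ => ?_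
    exact IsLinearSet.isSemilinearSet ⟨q.1, {p | p ∈ q.2}, List.finite_toSet q.2, rfl⟩

/-! ### Knapsack expressions -/

section Expressions

variable {Λ : Type*} {G : Type*} [Group G]

/-- The element of `G` represented by a word over the alphabet `Λ`, where the letter `a` stands
for the generator `σ a`. -/
def wordVal (σ : Λ → G) (w : List Λ) : G := (w.map σ).prod

/-- The data `(u₁, v₁), …, (u_k, v_k)` of a knapsack expression
`u₁ ^ x₁ v₁ u₂ ^ x₂ v₂ ⋯ u_k ^ x_k v_k` over `Λ`. Since the variables of a knapsack expression are
pairwise distinct, they need not be recorded: the `i`-th variable belongs to the `i`-th pair. -/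
abbrev Expr (Λ : Type*) := List (List Λ × List Λ)

/-- `e` is a knapsack expression: `k ≥ 1` and all periods `u_i` are non-empty words. -/
def Expr.IsKnapsack (e : Expr Λ) : Prop := e ≠ [] ∧ ∀ q ∈ e, q.1 ≠ []

/-- The length `‖e‖ = ∑ i, |u_i| + |v_i|`. -/
def Expr.norm (e : Expr Λ) : ℕ := (e.map fun q => q.1.length + q.2.length).sum

/-- The set of all `x ∈ ℕ^k` with `u₁ ^ x₁ v₁ ⋯ u_k ^ x_k v_k = 1` in `G`; the degree `k` is the
length of the list `e`. -/
def sol (σ : Λ → G) (e : Expr Λ) : Set (Fin e.length → ℕ) :=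
  {x | (List.ofFn fun i : Fin e.length =>
    wordVal σ (e.get i).1 ^ x i * wordVal σ (e.get i).2).prod = 1}

/-- The set `Knap(n, m)` of all knapsack expressions of length at most `n` and degree at most `m`
that have a solution. -/
def Knap (σ : Λ → G) (n m : ℕ) : Set (Expr Λ) :=
  {e | e.IsKnapsack ∧ (sol σ e).Nonempty ∧ e.norm ≤ n ∧ e.length ≤ m}

/-- The function `K_{G,Σ}`: the maximal magnitude of a solution set of an expression from
`Knap(n, m)` (and `0` if there is no such expression). -/
noncomputable def K (σ : Λ → G) (n m : ℕ) : ℕ :=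
  sSup {s | ∃ e ∈ Knap σ n m, mag (sol σ e) = s}

/-- Over a finite alphabet `Knap(n, m)` is finite, so that the supremum in the definition of `K`
is the maximum of a finite set. -/
theorem Knap.finite [Finite Λ] (σ : Λ → G) (n m : ℕ) : (Knap σ n m).Finite := by
  have hW : {w : List Λ | w.length ≤ n}.Finite := List.finite_length_le Λ n
  have hP := hW.prod hW
  have := hP.to_subtype
  have hF := (List.finite_length_le
    (({w : List Λ | w.length ≤ n} ×ˢ {w : List Λ | w.length ≤ n} :
      Set (List Λ × List Λ))) m).image (List.map Subtype.val)
  refine hF.subset ?_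
  rintro e ⟨-, -, hn, hm⟩
  have key : ∀ q ∈ e, q ∈ ({w : List Λ | w.length ≤ n} ×ˢ {w : List Λ | w.length ≤ n} :
      Set (List Λ × List Λ)) := by
    intro q hq
    have h : q.1.length + q.2.length ≤ Expr.norm e :=
      List.single_le_sum (by simp) _ (List.mem_map_of_mem (f := fun q : List Λ × List Λ =>
        q.1.length + q.2.length) hq)
    exact ⟨le_trans (Nat.le_add_right _ _) (h.trans hn), le_trans (Nat.le_add_left _ _) (h.trans hn)⟩
  refine ⟨e.attach.map fun q => ⟨q.1, key q.1 q.2⟩, by simpa using hm, ?_⟩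
  rw [List.map_map]
  exact List.attach_map_subtype_val e

/-- The solution set of every knapsack expression is semilinear. -/
def HasSemilinearSolutions (σ : Λ → G) : Prop :=
  ∀ e : Expr Λ, e.IsKnapsack → IsSemilinearSet (sol σ e)

end Expressions

/-! ### Knapsack-semilinear groups -/

/-- A semilinear representation as a finite piece of data without a fixed dimension, as it is
output by an algorithm: every vector is a list of natural numbers. -/
abbrev RepCode := List (List ℕ × List (List ℕ))

/-- The vector of dimension `d` given by a list of numbers (missing entries are read as `0`, and
additional entries are ignored). -/
def decodeVec (d : ℕ) (l : List ℕ) : Fin d → ℕ := fun i => l.getD i 0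

/-- The semilinear representation in dimension `d` given by a code. -/
def RepCode.decode (d : ℕ) (c : RepCode) : SemilinearRep d :=
  c.map fun q => (decodeVec d q.1, q.2.map (decodeVec d))

/-- `G` is knapsack-semilinear (with respect to the generators `σ`): the solution set of every
knapsack expression `e` is semilinear, and a semilinear representation of it can be effectively
computed from `e`. -/
def KnapsackSemilinear {Λ : Type*} [Primcodable Λ] {G : Type*} [Group G] (σ : Λ → G) : Prop :=
  HasSemilinearSolutions σ ∧
    ∃ f : Expr Λ → RepCode, Computable f ∧
      ∀ e : Expr Λ, e.IsKnapsack → ((f e).decode e.length).toSet = sol σ e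

/-! ### HNN-extensions -/

section HNN

variable {G : Type*} [Group G] {A B : Subgroup G}

/-- The HNN-extension `⟨G, t ∣ t⁻¹ a t = φ a (a ∈ A)⟩`. Mathlib's `HNNExtension G A B φ` has the
relations `t a t⁻¹ = φ a` instead, whence the use of `φ.symm`. -/
abbrev HNN (φ : A ≃* B) := HNNExtension G B A φ.symm

/-- The defining relations, in the present convention. -/
theorem HNN.conj (φ : A ≃* B) (a : A) :
    (HNNExtension.t⁻¹ * HNNExtension.of (a : G) * HNNExtension.t : HNN φ) =
      HNNExtension.of (φ a : G) := by
  have h := HNNExtension.equiv_symm_eq_conj (φ := φ.symm) a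
  simpa using h.symm

/-- The generators of the HNN-extension: the generators `σ` of `G`, the stable letter `t` and its
inverse. -/
def hnnGen {Λ : Type*} (φ : A ≃* B) (σ : Λ → G) : Λ ⊕ Bool → HNN φ
  | Sum.inl a => HNNExtension.of (σ a)
  | Sum.inr true => HNNExtension.t
  | Sum.inr false => HNNExtension.t⁻¹

end HNN

end Knapsack

namespace Knapsack

open scoped Pointwise

/-! ### Linear sets over an arbitrary index type -/

section LinearSets

variable {ι κ : Type*}

/-! It suffices to put every single solution `x` over the HNN-extension into a linear set of
solutions with bounded entries: there are only finitely many bounded bases and sets of bounded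
periods, so `exists_rep_of_local` turns such local data into a representation of the same norm.

For the linear set, every period is conjugated to an element of the base group or to a cyclically
reduced word (`exists_cyclicallyReduced`, `exists_factor`). Under `x` the expression becomes a
product, equal to 1, of constants and powers in the base group and of segments of periodic words,
the lines. It is read from right to left, with a stack of reduced segments that have no pinch
between them. By Britton's lemma (`redFrom_stVal`, `RedFrom.of_mul_ne_one`) the stack is empty in
the end. If the next segment pinches with the top of the stack, a maximal strip of letters cancels
(`exists_max_strip`) and leaves one short element of the base group.

Every strip gives two kinds of freedom. The base-group expression enclosed by the two segments has a
short fixed value, hence is a knapsack instance over `G` and can be deformed with entries bounded by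
`K` (`exists_lset_gval`). Along a long strip the elements of `A ∪ B` linking the two lines repeat at
equal phases; the block between two repetitions can be inserted any number of times, which is one
period vector (`exists_strip_period`). The deformations are added up by `Deform.of_cut`, and
`exists_deform` is the induction. With three segments per variable there are at most `6 * deg e`
strips, and each adds at most `|A ∪ B| * ‖e‖ ^ 2` to the base entries; this gives the second term of
the maximum, with the constant 12.

For effectiveness, the magnitude bound is dominated by a computable function, and the word problem
of the extension is solved by Britton reduction with finite tables for the isomorphism. A
representation is then found by search (`KnapsackSemilinear.of_bound`): all bounded linear sets
consisting of solutions are kept. Testing an infinite linear set is a finite task, because a linear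
set not contained in a semilinear set has a point outside of it of bounded size
(`exists_mem_lt_witnessBound`); this comes from a finite automaton reading binary digits. -/

/-- The linear set `b + P · ℕ^l` over an arbitrary index type. -/
def lset (b : ι → ℕ) (P : List (ι → ℕ)) : Set (ι → ℕ) :=
  b +ᵥ (AddSubmonoid.closure {p | p ∈ P} : Set (ι → ℕ))

theorem mem_lset {b : ι → ℕ} {P : List (ι → ℕ)} {y : ι → ℕ} :
    y ∈ lset b P ↔ ∃ z ∈ AddSubmonoid.closure {p | p ∈ P}, b + z = y := by
  simp [lset, Set.mem_vadd_set]

theorem self_mem_lset (b : ι → ℕ) (P : List (ι → ℕ)) : b ∈ lset b P :=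
  mem_lset.2 ⟨0, zero_mem _, add_zero b⟩

theorem mem_lset_nil {b y : ι → ℕ} : y ∈ lset b [] ↔ y = b := by
  simp [mem_lset, eq_comm]

theorem mem_lset_singleton {b p y : ι → ℕ} : y ∈ lset b [p] ↔ ∃ n : ℕ, y = b + n • p := by
  simp only [mem_lset, List.mem_singleton, Set.ofPred_eq_eq_singleton,
    AddSubmonoid.mem_closure_singleton]
  constructor
  · rintro ⟨_, ⟨n, rfl⟩, rfl⟩; exact ⟨n, rfl⟩
  · rintro ⟨n, rfl⟩; exact ⟨_, ⟨n, rfl⟩, rfl⟩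

theorem mem_lset_append {b b' : ι → ℕ} {P P' : List (ι → ℕ)} {y : ι → ℕ} :
    y ∈ lset (b + b') (P ++ P') ↔ ∃ y₁ ∈ lset b P, ∃ y₂ ∈ lset b' P', y = y₁ + y₂ := by
  have hU : {p | p ∈ P ++ P'} = {p | p ∈ P} ∪ {p | p ∈ P'} := by ext; simp
  simp only [mem_lset, hU, AddSubmonoid.closure_union, AddSubmonoid.mem_sup]
  constructor
  · rintro ⟨_, ⟨z, hz, z', hz', rfl⟩, rfl⟩
    exact ⟨_, ⟨z, hz, rfl⟩, _, ⟨z', hz', rfl⟩, by abel⟩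
  · rintro ⟨_, ⟨z, hz, rfl⟩, _, ⟨z', hz', rfl⟩, rfl⟩
    exact ⟨_, ⟨z, hz, z', hz', rfl⟩, by abel⟩

theorem image_lset (f : (ι → ℕ) →+ (κ → ℕ)) (b : ι → ℕ) (P : List (ι → ℕ)) :
    f '' lset b P = lset (f b) (P.map f) := by
  have hU : {p | p ∈ P.map f} = f '' {p | p ∈ P} := by ext; simp
  ext y
  simp only [mem_lset, hU, ← AddMonoidHom.map_mclosure, Set.mem_image, AddSubmonoid.mem_map]
  constructor
  · rintro ⟨_, ⟨z, hz, rfl⟩, rfl⟩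
    exact ⟨f z, ⟨z, hz, rfl⟩, by simp⟩
  · rintro ⟨_, ⟨z, hz, rfl⟩, rfl⟩
    exact ⟨b + z, ⟨z, hz, rfl⟩, by simp⟩

theorem lset_apply_eq {b : ι → ℕ} {P : List (ι → ℕ)} {y : ι → ℕ} (hy : y ∈ lset b P) {l : ι}
    (hP : ∀ p ∈ P, p l = 0) : y l = b l := by
  obtain ⟨z, hz, rfl⟩ := mem_lset.1 hy
  have : z l = 0 := by
    clear hy
    induction hz using AddSubmonoid.closure_induction with
    | mem p hp => exact hP p hp
    | zero => rfl
    | add _ _ _ _ h h' => simp [h, h']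
  simp [this]

theorem mem_lset_of_subset {b : ι → ℕ} {P Q : List (ι → ℕ)} (h : ∀ p ∈ P, p ∈ Q) {y : ι → ℕ}
    (hy : y ∈ lset b P) : y ∈ lset b Q := by
  obtain ⟨z, hz, rfl⟩ := mem_lset.1 hy
  exact mem_lset.2 ⟨z, AddSubmonoid.closure_mono h hz, rfl⟩

end LinearSets

/-! ### Norms and magnitudes -/

theorem foldr_max_le_iff {l : List ℕ} {B : ℕ} : l.foldr max 0 ≤ B ↔ ∀ a ∈ l, a ≤ B := by
  induction l with
  | nil => simp
  | cons a l ih => simp [ih]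

theorem vecNorm_le_iff {d : ℕ} {v : Fin d → ℕ} {B : ℕ} : vecNorm v ≤ B ↔ ∀ i, v i ≤ B := by
  simp [vecNorm]

theorem SemilinearRep.norm_le_iff {d : ℕ} {R : SemilinearRep d} {B : ℕ} :
    R.norm ≤ B ↔ ∀ q ∈ R, (∀ i, q.1 i ≤ B) ∧ ∀ p ∈ q.2, ∀ i, p i ≤ B := by
  simp only [SemilinearRep.norm, foldr_max_le_iff, List.forall_mem_map, max_le_iff, vecNorm_le_iff]

theorem SemilinearRep.mem_toSet {d : ℕ} {R : SemilinearRep d} {x : Fin d → ℕ} :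
    x ∈ R.toSet ↔ ∃ q ∈ R, x ∈ lset q.1 q.2 := by
  simp only [SemilinearRep.toSet, Set.mem_iUnion, exists_prop]; rfl

/-- A set each of whose points lies in a linear subset of norm at most `B` has a semilinear
representation of norm at most `B`. -/
theorem exists_rep_of_local {d : ℕ} {S : Set (Fin d → ℕ)} {B : ℕ}
    (h : ∀ x ∈ S, ∃ b P, x ∈ lset b P ∧ lset b P ⊆ S ∧ (∀ i, b i ≤ B) ∧
      ∀ p ∈ P, ∀ i, p i ≤ B) :
    ∃ R : SemilinearRep d, R.toSet = S ∧ R.norm ≤ B := by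
  classical
  -- Only finitely many pairs of a base and a set of periods have entries at most `B`. All those
  -- lying inside `S` are taken.
  let box : Finset (Fin d → ℕ) := Fintype.piFinset fun _ => Finset.range (B + 1)
  have hbox : ∀ v, v ∈ box ↔ ∀ i, v i ≤ B := by simp [box]
  let T := (box ×ˢ box.powerset).filter fun q => lset q.1 q.2.toList ⊆ S
  refine ⟨T.toList.map fun q => (q.1, q.2.toList), ?_, ?_⟩
  · ext x
    simp only [SemilinearRep.mem_toSet, List.mem_map, Finset.mem_toList]
    constructor
    · rintro ⟨_, ⟨q, hq, rfl⟩, hx⟩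
      exact (Finset.mem_filter.1 hq).2 hx
    · intro hx
      obtain ⟨b, P, hxP, hS, hb, hP⟩ := h x hx
      have hE : lset b P.toFinset.toList = lset b P := by
        simp [lset]
      refine ⟨_, ⟨(b, P.toFinset), ?_, rfl⟩, by rwa [hE]⟩
      simp only [T, Finset.mem_filter, Finset.mem_product, Finset.mem_powerset, hbox, hE]
      exact ⟨⟨hb, fun p hp => (hbox p).2 (hP p (List.mem_toFinset.1 hp))⟩, hS⟩
  · rw [SemilinearRep.norm_le_iff]
    simp only [List.mem_map, Finset.mem_toList]
    rintro _ ⟨q, hq, rfl⟩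
    simp only [T, Finset.mem_filter, Finset.mem_product, Finset.mem_powerset, hbox] at hq
    exact ⟨hq.1.1, fun p hp => (hbox p).1 (hq.1.2 (Finset.mem_toList.1 hp))⟩

theorem mag_le_of_rep {d : ℕ} {S : Set (Fin d → ℕ)} {R : SemilinearRep d} (hR : R.toSet = S) :
    mag S ≤ R.norm :=
  Nat.sInf_le ⟨R, hR, rfl⟩

theorem exists_rep_norm_eq_mag {d : ℕ} {S : Set (Fin d → ℕ)} (hS : IsSemilinearSet S) :
    ∃ R : SemilinearRep d, R.toSet = S ∧ R.norm = mag S := by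
  obtain ⟨R, hR⟩ := (isSemilinearSet_iff_exists_rep S).1 hS
  exact Nat.sInf_mem (s := {s | ∃ R : SemilinearRep d, R.toSet = S ∧ R.norm = s}) ⟨_, R, hR, rfl⟩

section Magnitude

variable {Λ : Type*} {G : Type*} [Group G] {σ : Λ → G}

theorem mag_le_K [Finite Λ] {e : Expr Λ} {n m : ℕ} (he : e ∈ Knap σ n m) :
    mag (sol σ e) ≤ K σ n m := by
  refine le_csSup ?_ ⟨e, he, rfl⟩
  refine ((Knap.finite σ n m).image fun e => mag (sol σ e)).bddAbove.mono ?_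
  rintro _ ⟨e, he, rfl⟩
  exact ⟨e, he, rfl⟩

theorem K_le {n m B : ℕ} (h : ∀ e ∈ Knap σ n m, mag (sol σ e) ≤ B) : K σ n m ≤ B := by
  rcases Set.eq_empty_or_nonempty {s | ∃ e ∈ Knap σ n m, mag (sol σ e) = s} with h0 | h0
  · simp [K, h0]
  · refine csSup_le h0 ?_
    rintro _ ⟨e, he, rfl⟩
    exact h e he

theorem K_mono [Finite Λ] {n n' m m' : ℕ} (hn : n ≤ n') (hm : m ≤ m') : K σ n m ≤ K σ n' m' :=
  K_le fun _ he => mag_le_K ⟨he.1, he.2.1, he.2.2.1.trans hn, he.2.2.2.trans hm⟩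

end Magnitude

end Knapsack

namespace Knapsack

open scoped Pointwise

/-! ### Word length -/

section WordLength

variable {Λ : Type*} {G : Type*} [Group G] {σ : Λ → G}

theorem wordVal_nil : wordVal σ [] = 1 := rfl

theorem wordVal_cons (a : Λ) (w : List Λ) : wordVal σ (a :: w) = σ a * wordVal σ w := by
  simp [wordVal]

theorem wordVal_append (w w' : List Λ) : wordVal σ (w ++ w') = wordVal σ w * wordVal σ w' := by
  simp [wordVal]

theorem exists_word_inv (hsym : ∀ i, ∃ j, σ j = (σ i)⁻¹) (w : List Λ) :
    ∃ w' : List Λ, w'.length = w.length ∧ wordVal σ w' = (wordVal σ w)⁻¹ := by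
  induction w with
  | nil => exact ⟨[], rfl, by simp [wordVal_nil]⟩
  | cons a w ih =>
    obtain ⟨w', hl, hv⟩ := ih
    obtain ⟨j, hj⟩ := hsym a
    exact ⟨w' ++ [j], by simp [hl], by simp [wordVal_append, wordVal_cons, wordVal_nil, hv, hj]⟩

theorem exists_word (hgen : Subgroup.closure (Set.range σ) = ⊤) (hsym : ∀ i, ∃ j, σ j = (σ i)⁻¹)
    (g : G) : ∃ w : List Λ, wordVal σ w = g := by
  have hg : g ∈ Subgroup.closure (Set.range σ) := hgen ▸ Subgroup.mem_top g
  induction hg using Subgroup.closure_induction with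
  | mem _ h => obtain ⟨i, rfl⟩ := h; exact ⟨[i], by simp [wordVal]⟩
  | one => exact ⟨[], rfl⟩
  | mul _ _ _ _ h h' =>
    obtain ⟨w, rfl⟩ := h
    obtain ⟨w', rfl⟩ := h'
    exact ⟨w ++ w', wordVal_append w w'⟩
  | inv _ _ h =>
    obtain ⟨w, rfl⟩ := h
    obtain ⟨w', -, h⟩ := exists_word_inv hsym w
    exact ⟨w', h⟩

/-- The least length of a word representing `g`. -/
noncomputable def glen (σ : Λ → G) (g : G) : ℕ :=
  sInf {n | ∃ w : List Λ, w.length = n ∧ wordVal σ w = g}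

theorem glen_le (w : List Λ) : glen σ (wordVal σ w) ≤ w.length :=
  Nat.sInf_le ⟨w, rfl, rfl⟩

theorem glen_one : glen σ 1 = 0 := Nat.le_zero.1 (glen_le [])

theorem glen_gen (i : Λ) : glen σ (σ i) ≤ 1 := by
  simpa [wordVal] using glen_le (σ := σ) [i]

theorem exists_word_glen (hgen : Subgroup.closure (Set.range σ) = ⊤)
    (hsym : ∀ i, ∃ j, σ j = (σ i)⁻¹) (g : G) :
    ∃ w : List Λ, w.length = glen σ g ∧ wordVal σ w = g := by
  obtain ⟨w, hw⟩ := exists_word hgen hsym g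
  exact Nat.sInf_mem (s := {n | ∃ w : List Λ, w.length = n ∧ wordVal σ w = g}) ⟨_, w, rfl, hw⟩

/-- A subadditive symmetric length function on a group for which the elements of the subgroups
`A` and `B` have length at most one. -/
structure IsLength (A B : Subgroup G) (ℓ : G → ℕ) : Prop where
  one : ℓ 1 = 0
  mul : ∀ g h, ℓ (g * h) ≤ ℓ g + ℓ h
  inv : ∀ g, ℓ g⁻¹ ≤ ℓ g
  assoc : ∀ g, g ∈ A ∨ g ∈ B → ℓ g ≤ 1

theorem isLength_glen (hgen : Subgroup.closure (Set.range σ) = ⊤)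
    (hsym : ∀ i, ∃ j, σ j = (σ i)⁻¹) {A B : Subgroup G}
    (hAB : ∀ g : G, g ∈ A ∨ g ∈ B → g ≠ 1 → g ∈ Set.range σ) : IsLength A B (glen σ) where
  one := glen_one
  mul g h := by
    obtain ⟨w, hw, rfl⟩ := exists_word_glen hgen hsym g
    obtain ⟨w', hw', rfl⟩ := exists_word_glen hgen hsym h
    rw [← hw, ← hw', ← wordVal_append, ← List.length_append]
    exact glen_le _
  inv g := by
    obtain ⟨w, hw, rfl⟩ := exists_word_glen hgen hsym g
    obtain ⟨w', hw', h⟩ := exists_word_inv hsym w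
    rw [← h, ← hw, ← hw']
    exact glen_le _
  assoc g hg := by
    by_cases h1 : g = 1
    · simp [h1, glen_one]
    · obtain ⟨i, rfl⟩ := hAB g hg h1
      exact glen_gen i

end WordLength

/-! ### Exponent expressions over a group -/

section GExp

variable {G ι : Type*}

/-- The variables of a product of constants and powers. -/
def gvars (γ : List (G × Option ι)) : List ι := γ.filterMap Prod.snd

/-- The total length of the group elements in a product of constants and powers. -/
def gcost (ℓ : G → ℕ) (γ : List (G × Option ι)) : ℕ := (γ.map fun a => ℓ a.1).sum

variable {γ : List (G × Option ι)}

@[simp] theorem gvars_nil : gvars ([] : List (G × Option ι)) = [] := rfl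

@[simp] theorem gvars_cons_none (g : G) : gvars ((g, none) :: γ) = gvars γ := rfl

@[simp] theorem gvars_cons_some (g : G) (i : ι) : gvars ((g, some i) :: γ) = i :: gvars γ := rfl

@[simp] theorem gcost_nil (ℓ : G → ℕ) : gcost ℓ ([] : List (G × Option ι)) = 0 := rfl

@[simp] theorem gcost_cons (ℓ : G → ℕ) (a : G × Option ι) :
    gcost ℓ (a :: γ) = ℓ a.1 + gcost ℓ γ := by
  simp [gcost]

variable [Group G]

/-- The value of a constant `(g, none)` or of a power `(g, some i)` under the valuation `y`. -/
def itemVal (y : ι → ℕ) (a : G × Option ι) : G := a.1 ^ (a.2.elim 1 y)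

/-- The value of a product of constants and powers. -/
def gval (y : ι → ℕ) (γ : List (G × Option ι)) : G := (γ.map (itemVal y)).prod

variable {y y' : ι → ℕ}

@[simp] theorem gval_nil : gval y ([] : List (G × Option ι)) = 1 := rfl

@[simp] theorem gval_cons (a : G × Option ι) : gval y (a :: γ) = itemVal y a * gval y γ := by
  simp [gval]

@[simp] theorem itemVal_none (g : G) : itemVal y (g, none) = g := by simp [itemVal]

@[simp] theorem itemVal_some (g : G) (i : ι) : itemVal y (g, some i) = g ^ y i := by
  simp [itemVal]

theorem gval_congr (h : ∀ i ∈ gvars γ, y i = y' i) : gval y γ = gval y' γ := by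
  induction γ with
  | nil => rfl
  | cons a γ ih =>
    obtain ⟨g, _ | i⟩ := a
    · simp_all
    · simp_all

/-- The value of the powers `g ^ i * h` for the entries `(i, g, h)` of a list. -/
def powProd (y : ι → ℕ) (l : List (ι × G × G)) : G :=
  (l.map fun q => q.2.1 ^ y q.1 * q.2.2).prod

/-- The total length of the group elements in a list of powers. -/
def powCost (ℓ : G → ℕ) (l : List (ι × G × G)) : ℕ := (l.map fun q => ℓ q.2.1 + ℓ q.2.2).sum

/-- Each constant is merged with the constant after the preceding power. This yields the shape of a
knapsack expression, up to a constant in front. -/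
theorem exists_powProd_eq {A B : Subgroup G} {ℓ : G → ℕ} (hℓ : IsLength A B ℓ)
    (γ : List (G × Option ι)) (v : G) (hγ : ∀ a ∈ γ, a.2 ≠ none → a.1 ≠ 1) :
    ∃ (h : G) (l : List (ι × G × G)), l.map Prod.fst = gvars γ ∧ (∀ q ∈ l, q.2.1 ≠ 1) ∧
      (∀ y, gval y γ * v = h * powProd y l) ∧ ℓ h + powCost ℓ l ≤ gcost ℓ γ + ℓ v := by
  induction γ with
  | nil => exact ⟨v, [], rfl, by simp, by simp [powProd], by simp [powCost]⟩
  | cons a γ ih =>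
    obtain ⟨h, l, h1, h2, h3, h4⟩ := ih fun a ha => hγ a (List.mem_cons_of_mem _ ha)
    obtain ⟨g, _ | i⟩ := a
    · refine ⟨g * h, l, by simpa using h1, h2, fun y => by simp [mul_assoc, h3], ?_⟩
      have := hℓ.mul g h
      simp only [gcost_cons]; omega
    · refine ⟨1, (i, g, h) :: l, by simpa using h1, ?_, fun y => ?_, ?_⟩
      · have := hγ (g, some i) (by simp) (by simp)
        simpa [this] using h2
      · simp [mul_assoc, h3, powProd]
      · have := hℓ.one
        simp only [powCost, List.map_cons, List.sum_cons, gcost_cons] at *; omega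

/-- The constant after the last power absorbs `h`, so there must be a last power. -/
theorem exists_powProd_mul {A B : Subgroup G} {ℓ : G → ℕ} (hℓ : IsLength A B ℓ)
    (l : List (ι × G × G)) (hl : l ≠ []) (h : G) (hg : ∀ q ∈ l, q.2.1 ≠ 1) :
    ∃ l' : List (ι × G × G), l'.map Prod.fst = l.map Prod.fst ∧ (∀ q ∈ l', q.2.1 ≠ 1) ∧
      (∀ y, powProd y l' = powProd y l * h) ∧ powCost ℓ l' ≤ powCost ℓ l + ℓ h := by
  induction l with
  | nil => exact absurd rfl hl
  | cons q l ih =>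
    rcases eq_or_ne l [] with rfl | hl'
    · refine ⟨[(q.1, q.2.1, q.2.2 * h)], by simp, by simpa using hg, fun y => ?_, ?_⟩
      · simp [powProd, mul_assoc]
      · have := hℓ.mul q.2.2 h
        simp only [powCost, List.map_cons, List.sum_cons, List.map_nil, List.sum_nil]; omega
    · obtain ⟨l', h1, h2, h3, h4⟩ := ih hl' fun q hq => hg q (List.mem_cons_of_mem _ hq)
      refine ⟨q :: l', by simp [h1], ?_, fun y => ?_, ?_⟩
      · simpa [hg q (by simp)] using h2
      · simp only [powProd, List.map_cons, List.prod_cons] at *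
        rw [h3]; simp [mul_assoc]
      · simp only [powCost, List.map_cons, List.sum_cons] at *; omega

/-- Reindexing of vectors along `f`, by zero outside the range of `f`. -/
def pushVec [DecidableEq ι] {n : ℕ} (f : Fin n → ι) : (Fin n → ℕ) →+ (ι → ℕ) where
  toFun v := ∑ j, Pi.single (f j) (v j)
  map_zero' := by simp
  map_add' v w := by simp [Pi.single_add, Finset.sum_add_distrib]

theorem pushVec_apply [DecidableEq ι] {n : ℕ} {f : Fin n → ι} (hf : f.Injective)
    (v : Fin n → ℕ) (j : Fin n) : pushVec f v (f j) = v j := by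
  simp only [pushVec, AddMonoidHom.coe_mk, ZeroHom.coe_mk, Finset.sum_apply]
  rw [Finset.sum_eq_single j]
  · simp
  · intro k _ hk
    exact Pi.single_eq_of_ne (fun h => hk (hf h.symm)) _
  · simp

theorem pushVec_apply_of_notMem [DecidableEq ι] {n : ℕ} {f : Fin n → ι}
    (v : Fin n → ℕ) {i : ι} (hi : ∀ j, f j ≠ i) : pushVec f v i = 0 := by
  simp only [pushVec, AddMonoidHom.coe_mk, ZeroHom.coe_mk, Finset.sum_apply]
  exact Finset.sum_eq_zero fun j _ => Pi.single_eq_of_ne (fun h => hi j h.symm) _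

theorem pushVec_le [DecidableEq ι] {n : ℕ} {f : Fin n → ι} (hf : f.Injective)
    {v : Fin n → ℕ} {B : ℕ} (hv : ∀ j, v j ≤ B) (i : ι) : pushVec f v i ≤ B := by
  by_cases h : ∃ j, f j = i
  · obtain ⟨j, rfl⟩ := h
    rw [pushVec_apply hf]; exact hv j
  · rw [pushVec_apply_of_notMem v (by simpa using h)]; exact Nat.zero_le _

/-- Around every valuation `x` there is a linear set of valuations of the variables of `γ` with the
same value of `γ` as `x`, whose norm is bounded by the knapsack function. -/
theorem exists_lset_gval [DecidableEq ι] {Λ : Type*} [Finite Λ] {σ : Λ → G}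
    (hgen : Subgroup.closure (Set.range σ) = ⊤) (hsym : ∀ i, ∃ j, σ j = (σ i)⁻¹)
    {A B : Subgroup G} (hAB : ∀ g : G, g ∈ A ∨ g ∈ B → g ≠ 1 → g ∈ Set.range σ)
    (hsl : HasSemilinearSolutions σ) (γ : List (G × Option ι))
    (hγ : ∀ a ∈ γ, a.2 ≠ none → a.1 ≠ 1) (hnd : (gvars γ).Nodup) (x : ι → ℕ) {N m : ℕ}
    (hN : gcost (glen σ) γ + glen σ (gval x γ) ≤ N) (hm : (gvars γ).length ≤ m) :
    ∃ (b : ι → ℕ) (P : List (ι → ℕ)), (fun i => if i ∈ gvars γ then x i else 0) ∈ lset b P ∧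
      (∀ y ∈ lset b P, gval y γ = gval x γ) ∧
      (∀ i, b i ≤ K σ N m) ∧ (∀ p ∈ P, ∀ i, p i ≤ K σ N m) ∧
      (∀ i ∉ gvars γ, b i = 0 ∧ ∀ p ∈ P, p i = 0) := by
  classical
  have hℓ := isLength_glen hgen hsym hAB
  -- A knapsack expression has at least one variable, so products without variables are treated
  -- apart.
  by_cases hnil : gvars γ = []
  · refine ⟨0, [], ?_, ?_, by simp, by simp, by simp⟩
    · simp [hnil, mem_lset_nil]; rfl
    · intro y _
      exact gval_congr (by simp [hnil])
  -- The condition on `y` reads `h * powProd y l₀ = 1`. Conjugation moves `h` to the end without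
  -- raising the total length.
  obtain ⟨h, l₀, h1, h2, h3, h4⟩ := exists_powProd_eq hℓ γ (gval x γ)⁻¹ hγ
  have hl₀ : l₀ ≠ [] := by rintro rfl; exact hnil h1.symm
  obtain ⟨l, k1, k2, k3, k4⟩ := exists_powProd_mul hℓ l₀ hl₀ h h2
  rw [h1] at k1
  have hinv := hℓ.inv (gval x γ)
  have hcost : powCost (glen σ) l ≤ N := by omega
  have hval : ∀ y, gval y γ = gval x γ ↔ powProd y l = 1 := by
    intro y
    rw [k3, ← mul_inv_eq_one, h3]
    exact mul_eq_one_comm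
  choose wd hwl hwv using exists_word_glen hgen hsym
  let e : Expr Λ := l.map fun q => (wd q.2.1, wd q.2.2)
  have hel : e.length = l.length := by simp [e]
  let f : Fin e.length → ι := fun j => (l[j.1]'(lt_of_lt_of_eq j.2 hel)).1
  have hlen : (gvars γ).length = e.length := by rw [hel, ← k1, List.length_map]
  have hlt : ∀ j : Fin e.length, j.1 < (gvars γ).length := fun j => lt_of_lt_of_eq j.2 hlen.symm
  have hfv : ∀ j : Fin e.length, f j = (gvars γ)[j.1]'(hlt j) := by
    intro j; simp [f, ← k1]
  have hf : f.Injective := by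
    intro j j' hjj
    rw [hfv, hfv] at hjj
    exact Fin.ext ((hnd.getElem_inj_iff).1 hjj)
  have hmem : ∀ i, i ∈ gvars γ ↔ ∃ j, f j = i := by
    intro i
    rw [List.mem_iff_getElem]
    constructor
    · rintro ⟨j, hj, rfl⟩
      refine ⟨⟨j, ?_⟩, ?_⟩
      · exact lt_of_lt_of_eq hj hlen
      · rw [hfv]
    · rintro ⟨j, rfl⟩
      exact ⟨j.1, _, (hfv j).symm⟩
  have hsol : ∀ y : ι → ℕ, y ∘ f ∈ sol σ e ↔ powProd y l = 1 := by
    intro y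
    have : (List.ofFn fun i : Fin e.length =>
        wordVal σ (e.get i).1 ^ (y ∘ f) i * wordVal σ (e.get i).2) =
        l.map fun q => q.2.1 ^ y q.1 * q.2.2 := by
      apply List.ext_getElem
      · simp [hel]
      · intro j hj hj'
        simp [e, f, hwv]
    simp only [sol, Set.mem_ofPred_eq, this, powProd]
  have hek : e ∈ Knap σ N m := by
    refine ⟨⟨?_, ?_⟩, ⟨x ∘ f, (hsol x).2 ((hval x).1 rfl)⟩, ?_, ?_⟩
    · intro h0
      apply hnil
      rw [← k1]
      simpa [e] using h0
    · intro q hq h0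
      obtain ⟨q', hq', rfl⟩ := List.mem_map.1 hq
      apply k2 q' hq'
      rw [← hwv q'.2.1]
      simp only at h0
      rw [h0, wordVal_nil]
    · refine le_trans (le_of_eq ?_) hcost
      simp [Expr.norm, e, powCost, hwl, Function.comp_def]
    · rw [hel, ← List.length_map (f := Prod.fst), k1]; exact hm
  -- From a representation of least norm only the linear set containing `x` is kept, extended by
  -- zero to the other indices.
  obtain ⟨R, hR, hRn⟩ := exists_rep_norm_eq_mag (hsl e hek.1)
  have hRK : R.norm ≤ K σ N m := hRn ▸ mag_le_K hek
  have hx : x ∘ f ∈ R.toSet := hR ▸ (hsol x).2 ((hval x).1 rfl)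
  obtain ⟨⟨b, P⟩, hq, hxb⟩ := SemilinearRep.mem_toSet.1 hx
  obtain ⟨hb, hP⟩ := SemilinearRep.norm_le_iff.1 hRK _ hq
  refine ⟨pushVec f b, P.map (pushVec f), ?_, ?_, pushVec_le hf hb, ?_, ?_⟩
  · rw [← image_lset]
    refine ⟨_, hxb, ?_⟩
    ext i
    split_ifs with hi
    · obtain ⟨j, rfl⟩ := (hmem i).1 hi
      rw [pushVec_apply hf]; rfl
    · exact pushVec_apply_of_notMem _ fun j hj => hi ((hmem i).2 ⟨j, hj⟩)
  · intro y hy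
    rw [← image_lset] at hy
    obtain ⟨z, hz, rfl⟩ := hy
    rw [hval, ← hsol, ← hR, SemilinearRep.mem_toSet]
    refine ⟨_, hq, ?_⟩
    convert! hz using 1
    ext j
    exact pushVec_apply hf z j
  · intro p hp i
    obtain ⟨p', hp', rfl⟩ := List.mem_map.1 hp
    exact pushVec_le hf (hP p' hp') i
  · intro i hi
    have : ∀ j, f j ≠ i := fun j hj => hi ((hmem i).2 ⟨j, hj⟩)
    refine ⟨pushVec_apply_of_notMem _ this, fun p hp => ?_⟩
    obtain ⟨p, hp, rfl⟩ := List.mem_map.1 hp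
    exact pushVec_apply_of_notMem _ this

end GExp

end Knapsack

namespace Knapsack

open scoped Pointwise

/-! ### Reduced words and lines in an HNN-extension -/

section Lines

open HNNExtension

variable {G : Type*} [Group G] {A B : Subgroup G} {φ : A ≃* B}

/-- The element `t ^ u * g` of the HNN-extension. -/
def sylVal (φ : A ≃* B) (s : ℤˣ × G) : HNNExtension G A B φ := t ^ (s.1 : ℤ) * of s.2

/-- The syllable `s`, followed by `g` and the letter `t ^ u`, is not a pinch. -/
def Irred (A B : Subgroup G) (s : ℤˣ × G) (g : G) (u : ℤˣ) : Prop :=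
  s.2 * g ∈ toSubgroup A B s.1 → s.1 = u

theorem t_zpow_mul_of (u : ℤˣ) (a : toSubgroup A B u) :
    (t ^ (u : ℤ) * of (a : G) : HNNExtension G A B φ) =
      of (toSubgroupEquiv φ u a : G) * t ^ (u : ℤ) := by
  rcases Int.units_eq_one_or u with rfl | rfl
  · simp only [Units.val_one, zpow_one]; exact t_mul_of (φ := φ) a
  · simp only [Units.val_neg, Units.val_one, zpow_neg, zpow_one]; exact inv_t_mul_of (φ := φ) a

theorem mem_or_mem_of_mem_toSubgroup {u : ℤˣ} {a : G} (h : a ∈ toSubgroup A B u) :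
    a ∈ A ∨ a ∈ B := by
  rcases Int.units_eq_one_or u with rfl | rfl
  · exact Or.inl h
  · exact Or.inr h

/-- A corner that is not irreducible is a pinch `t ^ u * c * t ^ (-u)` with `c` in the associated
subgroup. Of its value only membership in `A` or `B` is recorded: this suffices for length estimates
and for the pigeonhole argument. -/
theorem exists_pinch {s s' : ℤˣ × G} {g : G} (h : ¬ Irred A B s g s'.1) :
    (s.2 * g ∈ A ∨ s.2 * g ∈ B) ∧
      ∃ a, (a ∈ A ∨ a ∈ B) ∧ sylVal φ s * of g * sylVal φ s' = of (a * s'.2) := by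
  obtain ⟨h1, h2⟩ := Classical.not_imp.1 h
  refine ⟨mem_or_mem_of_mem_toSubgroup h1, toSubgroupEquiv φ s.1 ⟨_, h1⟩,
    mem_or_mem_of_mem_toSubgroup (SetLike.coe_mem _), ?_⟩
  have hs : (s'.1 : ℤ) = -(s.1 : ℤ) := by
    rcases Int.units_eq_one_or s.1 with h | h <;> rcases Int.units_eq_one_or s'.1 with h' | h' <;>
      simp_all
  have := t_zpow_mul_of (φ := φ) s.1 ⟨_, h1⟩
  simp only at this
  simp only [sylVal, map_mul, hs] at this ⊢
  rw [← mul_assoc] at this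
  rw [this]
  simp [mul_assoc]

/-- `h` is represented by a non-empty reduced word that starts with `t ^ u`. -/
def RedFrom (φ : A ≃* B) (u : ℤˣ) (h : HNNExtension G A B φ) : Prop :=
  ∃ (g : G) (L : List (ℤˣ × G)),
    ((u, g) :: L).IsChain (fun a b => a.2 ∈ toSubgroup A B a.1 → a.1 = b.1) ∧
      h = (((u, g) :: L).map (sylVal φ)).prod

theorem redFrom_syl (s : ℤˣ × G) (g : G) : RedFrom φ s.1 (sylVal φ s * of g) :=
  ⟨s.2 * g, [], by simp, by simp [sylVal, mul_assoc]⟩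

theorem RedFrom.cons {s : ℤˣ × G} {g : G} {u : ℤˣ} {h : HNNExtension G A B φ}
    (hh : RedFrom φ u h) (hs : Irred A B s g u) : RedFrom φ s.1 (sylVal φ s * of g * h) := by
  obtain ⟨g', L, hc, rfl⟩ := hh
  refine ⟨s.2 * g, (u, g') :: L, List.isChain_cons_cons.2 ⟨hs, hc⟩, ?_⟩
  rw [List.map_cons (a := (s.1, s.2 * g)), List.prod_cons]
  simp [sylVal, mul_assoc]

/-- Britton's lemma. -/
theorem RedFrom.of_mul_ne_one {u : ℤˣ} {h : HNNExtension G A B φ} (hh : RedFrom φ u h) (g : G) :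
    of g * h ≠ 1 := by
  obtain ⟨g', L, hc, rfl⟩ := hh
  intro h1
  have := ReducedWord.toList_eq_nil_of_mem_of_range φ
    ⟨g, (u, g') :: L, hc⟩ ⟨1, by rw [map_one]; exact h1.symm⟩
  simp at this

/-- The product of the first `m` syllables of a line. -/
def lineVal (φ : A ≃* B) (w : ℕ → ℤˣ × G) : ℕ → HNNExtension G A B φ
  | 0 => 1
  | m + 1 => lineVal φ w m * sylVal φ (w m)

theorem lineVal_add_mul {w : ℕ → ℤˣ × G} {τ : ℕ} (hw : ∀ m, w (m + τ) = w m) (m k : ℕ) :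
    lineVal φ w (m + k * τ) = lineVal φ w τ ^ k * lineVal φ w m := by
  have h1 : ∀ m, lineVal φ w (m + τ) = lineVal φ w τ * lineVal φ w m := by
    intro m
    induction m with
    | zero => simp [lineVal]
    | succ m ih =>
      rw [show m + 1 + τ = (m + τ) + 1 by omega, lineVal, ih, hw, lineVal, mul_assoc]
  induction k with
  | zero => simp
  | succ k ih =>
    rw [show m + (k + 1) * τ = (m + k * τ) + τ by ring, h1, ih, pow_succ', mul_assoc]

/-- The segment `[p, q)` of a line is a reduced word. -/
def RedSeg (A B : Subgroup G) (w : ℕ → ℤˣ × G) (p q : ℕ) : Prop :=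
  ∀ m, p ≤ m → m + 1 < q → Irred A B (w m) 1 (w (m + 1)).1

theorem RedSeg.mono {w : ℕ → ℤˣ × G} {p q p' q' : ℕ} (h : RedSeg A B w p q) (hp : p ≤ p')
    (hq : q' ≤ q) : RedSeg A B w p' q' :=
  fun m h1 h2 => h m (hp.trans h1) (h2.trans_le hq)

/-- The element `g` is absorbed by the last syllable of the segment, so the only new corner is the
one between position `q - 1` and `h`. -/
theorem redFrom_seg {w : ℕ → ℤˣ × G} {p q : ℕ} (hpq : p < q) (hw : RedSeg A B w p q) {g : G}
    {h : HNNExtension G A B φ} (hh : h = 1 ∨ ∃ u, RedFrom φ u h ∧ Irred A B (w (q - 1)) g u) :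
    RedFrom φ (w p).1 ((lineVal φ w p)⁻¹ * lineVal φ w q * of g * h) := by
  obtain ⟨n, rfl⟩ : ∃ n, q = p + n + 1 := ⟨q - p - 1, by omega⟩
  induction n generalizing p with
  | zero =>
    have hs : (lineVal φ w p)⁻¹ * lineVal φ w (p + 0 + 1) = sylVal φ (w p) := by
      simp [lineVal]
    rw [hs]
    rcases hh with rfl | ⟨u, hu, hi⟩
    · rw [mul_one]; exact redFrom_syl _ _
    · exact hu.cons hi
  | succ n ih =>
    have := ih (p := p + 1) (by omega) (by
      convert! hw.mono (p' := p + 1) (q' := p + 1 + n + 1) (by omega) (by omega) using 1) (by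
      convert! hh using 7; omega)
    have h2 := this.cons (hw p le_rfl (by omega))
    convert! h2 using 1
    rw [show p + (n + 1) + 1 = p + 1 + n + 1 by omega, show lineVal φ w (p + 1) = _ * _ from rfl]
    simp [mul_assoc]

/-- The product of the last `s` syllables of the line `w₁` before position `q`, the element `g`,
and the first `s` syllables of `w₂` from position `p` on. -/
def strip (φ : A ≃* B) (w₁ w₂ : ℕ → ℤˣ × G) (q p : ℕ) (g : G) (s : ℕ) : HNNExtension G A B φ :=
  (lineVal φ w₁ (q - s))⁻¹ * lineVal φ w₁ q * of g * (lineVal φ w₂ p)⁻¹ * lineVal φ w₂ (p + s)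

theorem strip_succ {w₁ w₂ : ℕ → ℤˣ × G} {q p : ℕ} {g : G} {s : ℕ} (hs : s < q) :
    strip φ w₁ w₂ q p g (s + 1) =
      sylVal φ (w₁ (q - s - 1)) * strip φ w₁ w₂ q p g s * sylVal φ (w₂ (p + s)) := by
  have : lineVal φ w₁ (q - s) = lineVal φ w₁ (q - (s + 1)) * sylVal φ (w₁ (q - s - 1)) := by
    conv_lhs => rw [show q - s = q - (s + 1) + 1 by omega, lineVal]
    rfl
  rw [strip, strip, this, ← add_assoc, lineVal]
  simp [mul_assoc]

/-- The first `s ≥ 1` letters cancel, and no more. -/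
theorem exists_max_strip {w₁ w₂ : ℕ → ℤˣ × G} {q p n₁ n₂ : ℕ} {g : G} (hn₁ : 1 ≤ n₁)
    (hn₂ : 1 ≤ n₂) (hq : n₁ ≤ q) (h : ¬ Irred A B (w₁ (q - 1)) g (w₂ p).1) :
    ∃ s, 1 ≤ s ∧ s ≤ n₁ ∧ s ≤ n₂ ∧
      (∀ s', 1 ≤ s' → s' ≤ s → ∃ a, (a ∈ A ∨ a ∈ B) ∧
        strip φ w₁ w₂ q p g s' = of (a * (w₂ (p + s' - 1)).2)) ∧
      ∀ y, strip φ w₁ w₂ q p g s = of y → s < n₁ → s < n₂ →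
        Irred A B (w₁ (q - s - 1)) y (w₂ (p + s)).1 := by
  let Q : ℕ → Prop := fun s => 1 ≤ s ∧ s ≤ n₁ ∧ s ≤ n₂ ∧
      ∀ s', 1 ≤ s' → s' ≤ s → ∃ a, (a ∈ A ∨ a ∈ B) ∧
        strip φ w₁ w₂ q p g s' = of (a * (w₂ (p + s' - 1)).2)
  have hstep : ∀ s y, s < n₁ → s < n₂ → strip φ w₁ w₂ q p g s = of y →
      ¬ Irred A B (w₁ (q - s - 1)) y (w₂ (p + s)).1 → ∃ a, (a ∈ A ∨ a ∈ B) ∧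
        strip φ w₁ w₂ q p g (s + 1) = of (a * (w₂ (p + (s + 1) - 1)).2) := by
    intro s y h1 h2 hy hi
    obtain ⟨-, a, ha, hv⟩ := exists_pinch (φ := φ) hi
    exact ⟨a, ha, by rw [strip_succ (by omega), hy, hv]; rfl⟩
  have hQ1 : Q 1 := by
    refine ⟨le_rfl, hn₁, hn₂, fun s' h1 h2 => ?_⟩
    obtain rfl : s' = 0 + 1 := by omega
    exact hstep 0 g (by omega) (by omega) (by simp [strip]) h
  -- `Q` holds at 1 and fails beyond `n₁`. At its last value either a segment is used up or the next
  -- two letters do not pinch.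
  obtain ⟨s, hs, hs'⟩ : ∃ s, Q s ∧ ¬ Q (s + 1) := by
    by_contra! hc
    have : ∀ n, Q (n + 1) := fun n => Nat.rec hQ1 (fun n ih => hc _ ih) n
    have := (this n₁).2.1
    omega
  refine ⟨s, hs.1, hs.2.1, hs.2.2.1, hs.2.2.2, fun y hy h1 h2 => ?_⟩
  by_contra hi
  refine hs' ⟨by omega, by omega, by omega, fun s' h1' h2' => ?_⟩
  rcases h2'.lt_or_eq with h2' | rfl
  · exact hs.2.2.2 s' h1' (by omega)
  · exact hstep s y h1 h2 hy hi

/-- A stretch of `s` letters crosses at most `s` boundaries between periods. -/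
theorem add_div_le_div_add (m s : ℕ) {τ : ℕ} (hτ : 0 < τ) : (m + s) / τ ≤ m / τ + s := by
  rw [← Nat.add_mul_div_right m s hτ]
  exact Nat.div_le_div_right (Nat.add_le_add_left (Nat.le_mul_of_pos_right s hτ) m)

/-- A strip has a short linear set of deformations. -/
theorem exists_strip_period {w₁ w₂ : ℕ → ℤˣ × G} {q p s τ₁ τ₂ Γ : ℕ} {g : G} (hτ₁ : 0 < τ₁)
    (hτ₂ : 0 < τ₂) (hw₁ : ∀ m, w₁ (m + τ₁) = w₁ m) (hw₂ : ∀ m, w₂ (m + τ₂) = w₂ m) (hsq : s ≤ q)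
    {F : Finset G} (hF : ∀ a, a ∈ A ∨ a ∈ B → a ∈ F) (hΓ : F.card ≤ Γ)
    (hs : ∀ s', 1 ≤ s' → s' ≤ s → ∃ a, (a ∈ A ∨ a ∈ B) ∧
        strip φ w₁ w₂ q p g s' = of (a * (w₂ (p + s' - 1)).2)) :
    ∃ b₁ b₂ k₁ k₂ N : ℕ, q / τ₁ = (q - s) / τ₁ + (b₁ + N * k₁) ∧
      (p + s) / τ₂ = p / τ₂ + (b₂ + N * k₂) ∧
      lineVal φ w₁ τ₁ ^ k₁ * (lineVal φ w₁ q * of g * (lineVal φ w₂ p)⁻¹) * lineVal φ w₂ τ₂ ^ k₂ =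
        lineVal φ w₁ q * of g * (lineVal φ w₂ p)⁻¹ ∧
      b₁ ≤ Γ * (τ₁ * τ₂) ∧ b₂ ≤ Γ * (τ₁ * τ₂) ∧ k₁ ≤ Γ * (τ₁ * τ₂) ∧ k₂ ≤ Γ * (τ₁ * τ₂) ∧
      (s ≤ τ₁ ∨ s ≤ τ₂ → k₁ = 0 ∧ k₂ = 0) := by
  classical
  have hT : 0 < τ₁ * τ₂ := Nat.mul_pos hτ₁ hτ₂
  have hΓ1 : 1 ≤ Γ := by
    refine le_trans (Finset.card_pos.2 ⟨1, hF 1 (Or.inl A.one_mem)⟩) hΓ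
  have hTΓ : τ₁ * τ₂ ≤ Γ * (τ₁ * τ₂) := Nat.le_mul_of_pos_left _ hΓ1
  -- A short strip contributes only to the base vector.
  by_cases hsmall : s ≤ Γ * (τ₁ * τ₂)
  · have e1 := add_div_le_div_add (q - s) s hτ₁
    have e2 := add_div_le_div_add p s hτ₂
    have e3 : (q - s) / τ₁ ≤ q / τ₁ := Nat.div_le_div_right (by omega)
    have e4 : p / τ₂ ≤ (p + s) / τ₂ := Nat.div_le_div_right (by omega)
    rw [Nat.sub_add_cancel hsq] at e1
    exact ⟨q / τ₁ - (q - s) / τ₁, (p + s) / τ₂ - p / τ₂, 0, 0, 0, by omega, by omega, by simp,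
      by omega, by omega, by omega, by omega, fun _ => ⟨rfl, rfl⟩⟩
  push Not at hsmall
  have hst : ∀ c : Fin (Γ + 1), 1 + c.1 * (τ₁ * τ₂) ≤ s := by
    intro c
    have : c.1 * (τ₁ * τ₂) ≤ Γ * (τ₁ * τ₂) := Nat.mul_le_mul_right _ (by omega)
    omega
  -- The strip lengths `1 + c * (τ₁ * τ₂)` have the same phase on both lines, so the strip is
  -- determined there by its associated element. Among `Γ + 1` such lengths two give the same
  -- element.
  choose a ha ha' using fun c : Fin (Γ + 1) => hs (1 + c.1 * (τ₁ * τ₂)) (by omega) (hst c)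
  obtain ⟨c, -, c', -, hne, heq⟩ := Finset.exists_ne_map_eq_of_card_lt_of_maps_to
    (s := (Finset.univ : Finset (Fin (Γ + 1)))) (t := F) (f := a) (by simp; omega)
    (fun c _ => hF _ (ha c))
  wlog hlt : c < c' generalizing c c'
  · exact this c' c hne.symm heq.symm (lt_of_le_of_ne (not_lt.1 hlt) hne.symm)
  obtain ⟨k, hk⟩ : ∃ k, c'.1 = c.1 + k := ⟨c'.1 - c.1, by have : c.1 < c'.1 := hlt; omega⟩
  have hk0 : 0 < k := by have : c.1 < c'.1 := hlt; omega
  have hkΓ : k ≤ Γ := by have := c'.2; omega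
  have hsyl : ∀ d : ℕ, w₂ (p + (1 + d * (τ₁ * τ₂)) - 1) = w₂ p := by
    intro d
    rw [show p + (1 + d * (τ₁ * τ₂)) - 1 = p + (d * τ₁) * τ₂ by rw [mul_assoc]; omega]
    induction d * τ₁ with
    | zero => simp
    | succ n ih => rw [Nat.succ_mul, ← add_assoc, hw₂, ih]
  have hstrip : strip φ w₁ w₂ q p g (1 + c.1 * (τ₁ * τ₂)) =
      strip φ w₁ w₂ q p g (1 + c'.1 * (τ₁ * τ₂)) := by
    rw [ha', ha', hsyl, hsyl, heq]
  have hsc' := hst c'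
  set s₀ := 1 + c.1 * (τ₁ * τ₂) with hs₀
  have hs₁ : 1 + c'.1 * (τ₁ * τ₂) = s₀ + k * (τ₁ * τ₂) := by rw [hk, hs₀]; ring
  rw [hs₁] at hstrip hsc'
  have l1 : lineVal φ w₁ (q - s₀) =
      lineVal φ w₁ τ₁ ^ (k * τ₂) * lineVal φ w₁ (q - (s₀ + k * (τ₁ * τ₂))) := by
    rw [← lineVal_add_mul hw₁]
    congr 1
    rw [show k * τ₂ * τ₁ = k * (τ₁ * τ₂) by ring]; omega
  have l2 : lineVal φ w₂ (p + (s₀ + k * (τ₁ * τ₂))) =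
      lineVal φ w₂ τ₂ ^ (k * τ₁) * lineVal φ w₂ (p + s₀) := by
    rw [← lineVal_add_mul hw₂]
    congr 1; ring
  -- The equal strips differ by `k * τ₂` periods of the first line and `k * τ₁` periods of the
  -- second, which may therefore be inserted together.
  have hper : lineVal φ w₁ τ₁ ^ (k * τ₂) * (lineVal φ w₁ q * of g * (lineVal φ w₂ p)⁻¹) *
      lineVal φ w₂ τ₂ ^ (k * τ₁) = lineVal φ w₁ q * of g * (lineVal φ w₂ p)⁻¹ := by
    rw [strip, strip, l2, l1] at hstrip
    generalize lineVal φ w₁ τ₁ ^ (k * τ₂) = C₁ at *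
    generalize lineVal φ w₂ τ₂ ^ (k * τ₁) = C₂ at *
    generalize lineVal φ w₁ (q - (s₀ + k * (τ₁ * τ₂))) = X at *
    generalize lineVal φ w₂ (p + s₀) = Y at *
    generalize lineVal φ w₁ q = U at *
    generalize (lineVal φ w₂ p)⁻¹ = V at *
    have := congrArg (fun z => C₁ * X * z * Y⁻¹) hstrip
    simp only [mul_inv_rev, mul_assoc, mul_inv_cancel_left, mul_inv_cancel, mul_one] at this ⊢
    exact this.symm
  have hM : 0 < k * (τ₁ * τ₂) := Nat.mul_pos hk0 hT
  have hMΓ : k * (τ₁ * τ₂) ≤ Γ * (τ₁ * τ₂) := Nat.mul_le_mul_right _ hkΓ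
  -- The strip is `N` repeating blocks plus a remainder shorter than one block. The remainder gives
  -- the base entries, the block the period.
  set r := s % (k * (τ₁ * τ₂)) with hr
  set N := s / (k * (τ₁ * τ₂)) with hN
  have hrs : s = r + N * (k * (τ₁ * τ₂)) := by
    rw [hr, hN]; exact (Nat.mod_add_div' _ _).symm
  have hrlt : r < k * (τ₁ * τ₂) := Nat.mod_lt _ hM
  have d1 : (q - r) / τ₁ = (q - s) / τ₁ + N * (k * τ₂) := by
    rw [← Nat.add_mul_div_right _ _ hτ₁]
    congr 1
    rw [show N * (k * τ₂) * τ₁ = N * (k * (τ₁ * τ₂)) by ring]; omega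
  have d2 : (p + s) / τ₂ = (p + r) / τ₂ + N * (k * τ₁) := by
    rw [← Nat.add_mul_div_right _ _ hτ₂]
    congr 1
    rw [show N * (k * τ₁) * τ₂ = N * (k * (τ₁ * τ₂)) by ring]; omega
  have e1 := add_div_le_div_add (q - r) r hτ₁
  have e2 := add_div_le_div_add p r hτ₂
  have e3 : (q - r) / τ₁ ≤ q / τ₁ := Nat.div_le_div_right (by omega)
  have e4 : p / τ₂ ≤ (p + r) / τ₂ := Nat.div_le_div_right (by omega)
  rw [Nat.sub_add_cancel (by omega : r ≤ q)] at e1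
  refine ⟨q / τ₁ - (q - r) / τ₁, (p + r) / τ₂ - p / τ₂, k * τ₂, k * τ₁, N, by omega, by omega,
    hper, by omega, by omega, ?_, ?_, ?_⟩
  · exact (Nat.mul_le_mul_left k (Nat.le_mul_of_pos_left τ₂ hτ₁)).trans hMΓ
  · exact (Nat.mul_le_mul_left k (Nat.le_mul_of_pos_right τ₁ hτ₂)).trans hMΓ
  -- Here `s` exceeds both periods, so strips inside a single period, as for constants, never reach
  -- this case.
  · have h1 : τ₁ ≤ τ₁ * τ₂ := Nat.le_mul_of_pos_right τ₁ hτ₂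
    have h2 : τ₂ ≤ τ₁ * τ₂ := Nat.le_mul_of_pos_left τ₂ hτ₁
    omega

/-- The value of the segment `[p, q)` of a line of period `τ`, deformed to the exponent `y`; the
segment itself has the exponent `q / τ - p / τ`. -/
def segVal (φ : A ≃* B) (w : ℕ → ℤˣ × G) (τ p q y : ℕ) : HNNExtension G A B φ :=
  (lineVal φ w p)⁻¹ * lineVal φ w τ ^ ((y : ℤ) - ((q / τ : ℕ) - (p / τ : ℕ) : ℤ)) * lineVal φ w q

theorem segVal_self (w : ℕ → ℤˣ × G) {τ p q y : ℕ} (h : q / τ = p / τ + y) :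
    segVal φ w τ p q y = (lineVal φ w p)⁻¹ * lineVal φ w q := by
  rw [segVal, h]; simp

theorem segVal_empty (w : ℕ → ℤˣ × G) (τ p : ℕ) : segVal φ w τ p p 0 = 1 := by
  simp [segVal]

/-- The hypothesis says that `h` conjugates `d ^ l` to the inverse of `c ^ k`, a relation that
passes to all integral powers. -/
theorem zpow_mul_mul_zpow {H : Type*} [Group H] {c d h : H} {k l : ℕ}
    (hp : c ^ k * h * d ^ l = h) (n : ℤ) : c ^ (n * k) * h * d ^ (n * l) = h := by
  have h1 : SemiconjBy h (d ^ l) (c ^ k)⁻¹ := by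
    rw [SemiconjBy, eq_inv_mul_iff_mul_eq, ← mul_assoc]; exact hp
  have h2 := (h1.zpow_right n).eq
  rw [inv_zpow, eq_inv_mul_iff_mul_eq, ← mul_assoc] at h2
  rw [mul_comm n, mul_comm n, zpow_mul, zpow_mul, zpow_natCast, zpow_natCast]
  exact h2

/-- Cutting a strip off two neighbouring segments. -/
theorem segVal_mul_of_mul_segVal {w₁ w₂ : ℕ → ℤˣ × G} {τ₁ τ₂ p₁ q₁ p₂ q₂ s b₁ b₂ k₁ k₂ N : ℕ}
    {g y : G} (h1 : q₁ / τ₁ = (q₁ - s) / τ₁ + (b₁ + N * k₁))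
    (h2 : (p₂ + s) / τ₂ = p₂ / τ₂ + (b₂ + N * k₂))
    (hp : lineVal φ w₁ τ₁ ^ k₁ * (lineVal φ w₁ q₁ * of g * (lineVal φ w₂ p₂)⁻¹) *
      lineVal φ w₂ τ₂ ^ k₂ = lineVal φ w₁ q₁ * of g * (lineVal φ w₂ p₂)⁻¹)
    (hy : strip φ w₁ w₂ q₁ p₂ g s = of y) (n y₁ y₂ : ℕ) :
    segVal φ w₁ τ₁ p₁ q₁ (y₁ + (b₁ + n * k₁)) * of g *
        segVal φ w₂ τ₂ p₂ q₂ (y₂ + (b₂ + n * k₂)) =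
      segVal φ w₁ τ₁ p₁ (q₁ - s) y₁ * of y * segVal φ w₂ τ₂ (p₂ + s) q₂ y₂ := by
  -- The actual strip contains `N` blocks and the deformed one `n`, so the relation is used `n - N`
  -- times, possibly a negative number.
  have hz := zpow_mul_mul_zpow hp ((n : ℤ) - N)
  have e1 : ((y₁ + (b₁ + n * k₁) : ℕ) : ℤ) - ((q₁ / τ₁ : ℕ) - (p₁ / τ₁ : ℕ) : ℤ) =
      ((y₁ : ℤ) - (((q₁ - s) / τ₁ : ℕ) - (p₁ / τ₁ : ℕ) : ℤ)) + ((n : ℤ) - N) * k₁ := by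
    rw [h1]; push_cast; ring
  have e2 : ((y₂ + (b₂ + n * k₂) : ℕ) : ℤ) - ((q₂ / τ₂ : ℕ) - (p₂ / τ₂ : ℕ) : ℤ) =
      ((n : ℤ) - N) * k₂ + ((y₂ : ℤ) - ((q₂ / τ₂ : ℕ) - ((p₂ + s) / τ₂ : ℕ) : ℤ)) := by
    rw [h2]; push_cast; ring
  rw [segVal, segVal, segVal, segVal, e1, e2, zpow_add, zpow_add, ← hy, strip]
  generalize lineVal φ w₁ τ₁ ^ (((n : ℤ) - N) * k₁) = C₁ at *
  generalize lineVal φ w₂ τ₂ ^ (((n : ℤ) - N) * k₂) = C₂ at *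
  generalize lineVal φ w₁ q₁ = U at *
  generalize lineVal φ w₂ p₂ = V at *
  simp only [mul_assoc, mul_inv_cancel_left] at hz ⊢
  congr 2
  have hz' : C₁ * (U * (of g * (V⁻¹ * (C₂ *
      (lineVal φ w₂ τ₂ ^ ((y₂ : ℤ) - ((q₂ / τ₂ : ℕ) - ((p₂ + s) / τ₂ : ℕ) : ℤ)) *
        lineVal φ w₂ q₂))))) = U * (of g * (V⁻¹ *
      (lineVal φ w₂ τ₂ ^ ((y₂ : ℤ) - ((q₂ / τ₂ : ℕ) - ((p₂ + s) / τ₂ : ℕ) : ℤ)) *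
        lineVal φ w₂ q₂))) := by
    have := congrArg (· * (lineVal φ w₂ τ₂ ^
      ((y₂ : ℤ) - ((q₂ / τ₂ : ℕ) - ((p₂ + s) / τ₂ : ℕ) : ℤ)) * lineVal φ w₂ q₂)) hz
    simpa only [mul_assoc] using this
  exact hz'

end Lines

end Knapsack

namespace Knapsack

open scoped Pointwise

/-! ### Linear deformations of a solution -/

section Deformations

variable {ι : Type*}

/-- Around `x` there is a linear set of vectors with the property `Φ` that is supported on the
positions with `V l ≠ 0`. The positions with `L l` have base entries at most `c` and period entries
at most `β`, which vanish if `C l`; at the other positions all entries are at most `κ`. -/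
def Deform (L C : ι → Prop) (κ β : ℕ) (V : ι → ℕ) (c : ℕ) (x : ι → ℕ) (Φ : (ι → ℕ) → Prop) :
    Prop :=
  ∃ (b : ι → ℕ) (P : List (ι → ℕ)), x ∈ lset b P ∧ (∀ y ∈ lset b P, Φ y) ∧
    (∀ l, L l → b l ≤ c ∧ ∀ p ∈ P, p l ≤ β ∧ (C l → p l = 0)) ∧
    (∀ l, ¬ L l → b l ≤ κ ∧ ∀ p ∈ P, p l ≤ κ) ∧
    (∀ l, V l = 0 → b l = 0 ∧ ∀ p ∈ P, p l = 0)

variable {L C : ι → Prop} {κ β : ℕ} {V V' : ι → ℕ} {c c' : ℕ} {x x' : ι → ℕ}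
  {Φ Φ' : (ι → ℕ) → Prop}

/-- The comparison of `Φ'` with `Φ` may use that `y` vanishes off the smaller support. This is what
makes a used-up segment trivial in every deformation. -/
theorem Deform.mono (h : Deform L C κ β V' c' x Φ') (hV : ∀ l, V l = 0 → V' l = 0) (hc : c' ≤ c)
    (hΦ : ∀ y, (∀ l, V' l = 0 → y l = 0) → Φ' y → Φ y) : Deform L C κ β V c x Φ := by
  obtain ⟨b, P, h1, h2, h3, h4, h5⟩ := h
  refine ⟨b, P, h1, fun y hy => hΦ y (fun l hl => ?_) (h2 y hy),
    fun l hl => ⟨(h3 l hl).1.trans hc, (h3 l hl).2⟩, h4, fun l hl => h5 l (hV l hl)⟩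
  rw [lset_apply_eq hy (h5 l hl).2, (h5 l hl).1]

/-- Combination of deformations of disjoint parts along a strip between the positions `i`, `j`. -/
theorem Deform.combine [DecidableEq ι] {U : ι → ℕ} {x₁ : ι → ℕ} {Φ₁ : (ι → ℕ) → Prop}
    (h₁ : Deform L C κ β U 0 x₁ Φ₁) (h' : Deform L C κ β V' c' x' Φ')
    {i j : ι} (hij : i ≠ j) (hi : L i) (hj : L j) {b₁ b₂ k₁ k₂ : ℕ} (N : ℕ)
    (hb₁ : b₁ ≤ β) (hb₂ : b₂ ≤ β) (hk₁ : k₁ ≤ β) (hk₂ : k₂ ≤ β)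
    (hC : C i ∨ C j → k₁ = 0 ∧ k₂ = 0)
    (hx : x = x₁ + ((Pi.single i b₁ + Pi.single j b₂) + N • (Pi.single i k₁ + Pi.single j k₂)) + x')
    (hUL : ∀ l, U l ≠ 0 → ¬ L l ∧ V' l = 0)
    (hV : ∀ l, V l = 0 → U l = 0 ∧ V' l = 0 ∧ l ≠ i ∧ l ≠ j)
    (hΦ : ∀ (y₁ y' : ι → ℕ) (n : ℕ), (∀ l, U l = 0 → y₁ l = 0) → (∀ l, V' l = 0 → y' l = 0) →
      Φ₁ y₁ → Φ' y' →
      Φ (y₁ + ((Pi.single i b₁ + Pi.single j b₂ : ι → ℕ) +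
        n • (Pi.single i k₁ + Pi.single j k₂ : ι → ℕ)) + y')) :
    Deform L C κ β V (c' + β) x Φ := by
  obtain ⟨b, P, f1, f2, f3, f4, f5⟩ := h₁
  obtain ⟨b', P', g1, g2, g3, g4, g5⟩ := h'
  have hs : ∀ (u v : ℕ) (l : ι), ¬ L l → (Pi.single i u + Pi.single j v : ι → ℕ) l = 0 := by
    intro u v l hl
    have h1 : l ≠ i := by rintro rfl; exact hl hi
    have h2 : l ≠ j := by rintro rfl; exact hl hj
    simp [h1, h2]
  have hs' : ∀ (u v : ℕ) (l : ι), u ≤ β → v ≤ β →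
      (Pi.single i u + Pi.single j v : ι → ℕ) l ≤ β := by
    intro u v l hu hv
    by_cases h1 : l = i
    · subst h1; simpa [hij] using hu
    · by_cases h2 : l = j
      · subst h2; simpa [h1] using hv
      · simp [h1, h2]
  -- The two lines of a strip grow only together, hence one new column with the entries `k₁` at `i`
  -- and `k₂` at `j`.
  refine ⟨b + (Pi.single i b₁ + Pi.single j b₂) + b',
    (P ++ [Pi.single i k₁ + Pi.single j k₂]) ++ P', ?_, ?_, ?_, ?_, ?_⟩
  · refine mem_lset_append.2 ⟨_, mem_lset_append.2 ⟨x₁, f1, _, ?_, rfl⟩, x', g1, hx⟩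
    exact mem_lset_singleton.2 ⟨N, rfl⟩
  · intro y hy
    obtain ⟨z, hz, y', hy', rfl⟩ := mem_lset_append.1 hy
    obtain ⟨y₁, hy₁, z', hz', rfl⟩ := mem_lset_append.1 hz
    obtain ⟨n, rfl⟩ := mem_lset_singleton.1 hz'
    refine hΦ y₁ y' n (fun l hl => ?_) (fun l hl => ?_) (f2 _ hy₁) (g2 _ hy')
    · rw [lset_apply_eq hy₁ (f5 l hl).2, (f5 l hl).1]
    · rw [lset_apply_eq hy' (g5 l hl).2, (g5 l hl).1]
  · intro l hl
    have hU : U l = 0 := by by_contra h; exact (hUL l h).1 hl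
    refine ⟨?_, ?_⟩
    · have := hs' b₁ b₂ l hb₁ hb₂
      have := (g3 l hl).1
      have := (f5 l hU).1
      simp only [Pi.add_apply] at *; omega
    · simp only [List.mem_append, List.mem_singleton]
      rintro p ((hp | rfl) | hp)
      · simp [(f5 l hU).2 p hp]
      · refine ⟨hs' k₁ k₂ l hk₁ hk₂, fun hc => ?_⟩
        by_cases h1 : l = i
        · obtain ⟨rfl, rfl⟩ := hC (Or.inl (h1 ▸ hc)); simp
        · by_cases h2 : l = j
          · obtain ⟨rfl, rfl⟩ := hC (Or.inr (h2 ▸ hc)); simp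
          · simp [h1, h2]
      · exact (g3 l hl).2 p hp
  · intro l hl
    by_cases hU : U l = 0
    · refine ⟨?_, ?_⟩
      · have := hs b₁ b₂ l hl
        have := (g4 l hl).1
        have := (f5 l hU).1
        simp only [Pi.add_apply] at *; omega
      · simp only [List.mem_append, List.mem_singleton]
        rintro p ((hp | rfl) | hp)
        · simp [(f5 l hU).2 p hp]
        · simp [hs k₁ k₂ l hl]
        · exact (g4 l hl).2 p hp
    · have hV' := (hUL l hU).2
      refine ⟨?_, ?_⟩
      · have := hs b₁ b₂ l hl
        have := (f4 l hl).1
        have := (g5 l hV').1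
        simp only [Pi.add_apply] at *; omega
      · simp only [List.mem_append, List.mem_singleton]
        rintro p ((hp | rfl) | hp)
        · exact (f4 l hl).2 p hp
        · simp [hs k₁ k₂ l hl]
        · simp [(g5 l hV').2 p hp]
  · intro l hl
    obtain ⟨hU, hV', h1, h2⟩ := hV l hl
    refine ⟨by simp [(f5 l hU).1, (g5 l hV').1, h1, h2], ?_⟩
    simp only [List.mem_append, List.mem_singleton]
    rintro p ((hp | rfl) | hp)
    · exact (f5 l hU).2 p hp
    · simp [h1, h2]
    · exact (g5 l hV').2 p hp

end Deformations

/-! ### Configurations -/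

section Configurations

open HNNExtension

variable {G ι : Type*}

/-- The segment `[p, q)` of the line `i`. -/
structure Seg (ι : Type*) where
  /-- the line -/
  i : ι
  /-- the first position -/
  p : ℕ
  /-- the end position -/
  q : ℕ

/-- An item is a constant or a power in the base group, or a segment of a line. -/
abbrev Item (G ι : Type*) := (G × Option ι) ⊕ Seg ι

/-- The number of occurrences of the variable `l` in a product in the base group. -/
def gOcc [DecidableEq ι] (l : ι) (γ : List (G × Option ι)) : ℕ := (gvars γ).count l

/-- The number of occurrences of `l` in a list of items. -/
def inpOcc [DecidableEq ι] (l : ι) : List (Item G ι) → ℕ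
  | [] => 0
  | Sum.inl a :: r => gOcc l [a] + inpOcc l r
  | Sum.inr s :: r => (if l = s.i then 1 else 0) + inpOcc l r

/-- The number of occurrences of `l` in a stack. -/
def stOcc [DecidableEq ι] (l : ι) : List (Seg ι × List (G × Option ι)) → ℕ
  | [] => 0
  | (s, γ) :: r => (if l = s.i then 1 else 0) + gOcc l γ + stOcc l r

/-- The total length of the group elements in a list of items. -/
def inpCost (ℓ : G → ℕ) : List (Item G ι) → ℕ
  | [] => 0
  | Sum.inl a :: r => gcost ℓ [a] + inpCost ℓ r
  | Sum.inr _ :: r => inpCost ℓ r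

/-- The total length of the group elements in a stack. -/
def stCost (ℓ : G → ℕ) : List (Seg ι × List (G × Option ι)) → ℕ
  | [] => 0
  | (_, γ) :: r => gcost ℓ γ + stCost ℓ r

/-- The number of segments in a list of items. -/
def segCount : List (Item G ι) → ℕ
  | [] => 0
  | Sum.inl _ :: r => segCount r
  | Sum.inr _ :: r => segCount r + 1

theorem gOcc_cons [DecidableEq ι] (l : ι) (a : G × Option ι) (γ : List (G × Option ι)) :
    gOcc l (a :: γ) = gOcc l [a] + gOcc l γ := by
  obtain ⟨g, _ | i⟩ := a
  · simp [gOcc]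
  · simp [gOcc, List.count_cons, add_comm]

theorem gOcc_nil [DecidableEq ι] (l : ι) : gOcc l ([] : List (G × Option ι)) = 0 := rfl

theorem gOcc_none [DecidableEq ι] (l : ι) (g : G) : gOcc l [(g, none)] = 0 := rfl

variable [Group G] {A B : Subgroup G} (φ : A ≃* B) (τ : ι → ℕ) (w : ι → ℕ → ℤˣ × G)

/-- The value of a segment under the valuation `y`. -/
def sVal (y : ι → ℕ) (s : Seg ι) : HNNExtension G A B φ :=
  segVal φ (w s.i) (τ s.i) s.p s.q (y s.i)

/-- The value of a reversed list of items. -/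
def inpVal (y : ι → ℕ) : List (Item G ι) → HNNExtension G A B φ
  | [] => 1
  | Sum.inl a :: r => inpVal y r * of (itemVal y a)
  | Sum.inr s :: r => inpVal y r * sVal φ τ w y s

/-- The value of a stack. -/
def stVal (y : ι → ℕ) : List (Seg ι × List (G × Option ι)) → HNNExtension G A B φ
  | [] => 1
  | (s, γ) :: r => sVal φ τ w y s * of (gval y γ) * stVal y r

variable (A B) (L C : ι → Prop)

/-- A reduced segment with current exponent `x s.i`. -/
def SegOK (x : ι → ℕ) (s : Seg ι) : Prop :=
  s.p < s.q ∧ RedSeg A B (w s.i) s.p s.q ∧ s.q / τ s.i = s.p / τ s.i + x s.i ∧ L s.i ∧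
    (C s.i → s.q ≤ τ s.i)

/-- The powers have non-trivial bases and variables outside of `L`. -/
def GOK (γ : List (G × Option ι)) : Prop := ∀ a ∈ γ, ∀ i, a.2 = some i → a.1 ≠ 1 ∧ ¬ L i

/-- A list of well-formed items. -/
def InpOK (x : ι → ℕ) : List (Item G ι) → Prop
  | [] => True
  | Sum.inl a :: r => GOK L [a] ∧ InpOK x r
  | Sum.inr s :: r => SegOK A B τ w L C x s ∧ InpOK x r

/-- A stack of well-formed segments without pinches between them. -/
def StOK (x : ι → ℕ) : List (Seg ι × List (G × Option ι)) → Prop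
  | [] => True
  | (s, γ) :: r => SegOK A B τ w L C x s ∧ GOK L γ ∧ StOK x r ∧
      ∀ s' ∈ r.head?, Irred A B (w s.i (s.q - 1)) (gval x γ) (w s'.1.i s'.1.p).1

variable {A B φ τ w L C}

theorem GOK.not_of_mem {γ : List (G × Option ι)} (h : GOK L γ) {i : ι} (hi : i ∈ gvars γ) :
    ¬ L i := by
  obtain ⟨a, ha, hai⟩ := List.mem_filterMap.1 hi
  exact (h a ha i hai).2

/-- The segments are reduced and so are the corners between them, so the whole stack is one reduced
word, to which Britton's lemma applies. -/
theorem redFrom_stVal {x : ι → ℕ} {s : Seg ι} {γ : List (G × Option ι)}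
    {r : List (Seg ι × List (G × Option ι))} (h : StOK A B τ w L C x ((s, γ) :: r)) :
    RedFrom φ (w s.i s.p).1 (stVal φ τ w x ((s, γ) :: r)) := by
  induction r generalizing s γ with
  | nil =>
    obtain ⟨⟨h1, h2, h3, -⟩, -⟩ := h
    rw [stVal, sVal, segVal_self _ h3]
    exact redFrom_seg h1 h2 (Or.inl rfl)
  | cons s' r ih =>
    obtain ⟨⟨h1, h2, h3, -⟩, -, h4, h5⟩ := h
    rw [stVal, sVal, segVal_self _ h3]
    exact redFrom_seg h1 h2 (Or.inr ⟨_, ih h4, h5 s' rfl⟩)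

variable [DecidableEq ι]

variable {x y : ι → ℕ}

theorem gval_congr_occ {γ : List (G × Option ι)} (h : ∀ l, gOcc l γ ≠ 0 → x l = y l) :
    gval x γ = gval y γ :=
  gval_congr fun l hl => h l (List.count_pos_iff.2 hl).ne'

theorem inpVal_congr {r : List (Item G ι)} (h : ∀ l, inpOcc l r ≠ 0 → x l = y l) :
    inpVal φ τ w x r = inpVal φ τ w y r := by
  induction r with
  | nil => rfl
  | cons it r ih =>
    obtain a | s := it
    · rw [inpVal, inpVal, ih fun l hl => h l (by simp only [inpOcc]; omega)]
      have := gval_congr_occ (γ := [a]) (x := x) (y := y)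
        fun l hl => h l (by simp only [inpOcc]; omega)
      simp only [gval_cons, gval_nil, mul_one] at this
      rw [this]
    · rw [inpVal, inpVal, ih fun l hl => h l (by simp only [inpOcc]; omega), sVal, sVal,
        h s.i (by simp [inpOcc])]

theorem stVal_congr {r : List (Seg ι × List (G × Option ι))}
    (h : ∀ l, stOcc l r ≠ 0 → x l = y l) : stVal φ τ w x r = stVal φ τ w y r := by
  induction r with
  | nil => rfl
  | cons it r ih =>
    obtain ⟨s, γ⟩ := it
    rw [stVal, stVal, ih fun l hl => h l (by simp only [stOcc]; omega), sVal, sVal,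
      h s.i (by simp [stOcc]), gval_congr_occ fun l hl => h l (by simp only [stOcc]; omega)]

theorem InpOK.congr {r : List (Item G ι)} (h : ∀ l, inpOcc l r ≠ 0 → x l = y l)
    (hr : InpOK A B τ w L C x r) : InpOK A B τ w L C y r := by
  induction r with
  | nil => trivial
  | cons it r ih =>
    obtain a | s := it
    · exact ⟨hr.1, ih (fun l hl => h l (by simp only [inpOcc]; omega)) hr.2⟩
    · refine ⟨?_, ih (fun l hl => h l (by simp only [inpOcc]; omega)) hr.2⟩
      have := hr.1
      rwa [SegOK, h s.i (by simp [inpOcc])] at this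

theorem StOK.congr {r : List (Seg ι × List (G × Option ι))}
    (h : ∀ l, stOcc l r ≠ 0 → x l = y l) (hr : StOK A B τ w L C x r) :
    StOK A B τ w L C y r := by
  induction r with
  | nil => trivial
  | cons it r ih =>
    obtain ⟨s, γ⟩ := it
    obtain ⟨h1, h2, h3, h4⟩ := hr
    refine ⟨?_, h2, ih (fun l hl => h l (by simp only [stOcc]; omega)) h3, ?_⟩
    · rwa [SegOK, h s.i (by simp [stOcc])] at h1
    · rwa [gval_congr_occ fun l hl => h l (by simp only [stOcc]; omega)] at h4

end Configurations

end Knapsack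

namespace Knapsack

open scoped Pointwise

/-! ### Right-to-left reduction of a configuration -/

section Reduction

open HNNExtension

variable {G ι : Type*} [Group G] {A B : Subgroup G} {φ : A ≃* B} [DecidableEq ι]
  {τ : ι → ℕ} {w : ι → ℕ → ℤˣ × G} {L C : ι → Prop} {κ β : ℕ}

/-- The vector `x` after cutting off a strip of `s` letters between the segments `s₁` and `s₂`,
with the exponent expression `γ` between them. -/
def cutVec (τ : ι → ℕ) (x : ι → ℕ) (s₁ s₂ : Seg ι) (γ : List (G × Option ι)) (s : ℕ) : ι → ℕ :=
  fun l => if l = s₁.i then (s₁.q - s) / τ s₁.i - s₁.p / τ s₁.i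
    else if l = s₂.i then s₂.q / τ s₂.i - (s₂.p + s) / τ s₂.i
    else if gOcc l γ = 0 then x l else 0

/-- A deformation of the configuration after cutting off a strip yields a deformation of the
configuration before. -/
theorem Deform.of_cut {s₁ s₂ : Seg ι} {r : List (Item G ι)} {γ γ₂ : List (G × Option ι)}
    {st : List (Seg ι × List (G × Option ι))} {x : ι → ℕ} {s c b₁ b₂ k₁ k₂ N : ℕ} {v : G}
    (hocc : ∀ l, inpOcc l r + (if l = s₁.i then 1 else 0) + gOcc l γ +
      (if l = s₂.i then 1 else 0) + gOcc l γ₂ + stOcc l st ≤ 1)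
    (hs₁ : SegOK A B τ w L C x s₁) (hs₂ : SegOK A B τ w L C x s₂)
    (hγ : GOK L γ)
    (hsq₁ : s ≤ s₁.q - s₁.p) (hsq₂ : s ≤ s₂.q - s₂.p)
    (h1 : s₁.q / τ s₁.i = (s₁.q - s) / τ s₁.i + (b₁ + N * k₁))
    (h2 : (s₂.p + s) / τ s₂.i = s₂.p / τ s₂.i + (b₂ + N * k₂))
    (hp : lineVal φ (w s₁.i) (τ s₁.i) ^ k₁ *
        (lineVal φ (w s₁.i) s₁.q * of (gval x γ) * (lineVal φ (w s₂.i) s₂.p)⁻¹) *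
      lineVal φ (w s₂.i) (τ s₂.i) ^ k₂ =
        lineVal φ (w s₁.i) s₁.q * of (gval x γ) * (lineVal φ (w s₂.i) s₂.p)⁻¹)
    (hb₁ : b₁ ≤ β) (hb₂ : b₂ ≤ β) (hk₁ : k₁ ≤ β) (hk₂ : k₂ ≤ β)
    (hC : C s₁.i ∨ C s₂.i → k₁ = 0 ∧ k₂ = 0)
    (hv : strip φ (w s₁.i) (w s₂.i) s₁.q s₂.p (gval x γ) s = of v)
    (hface : Deform L C κ β (fun l => gOcc l γ) 0 (fun l => if gOcc l γ = 0 then 0 else x l)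
      fun y => gval y γ = gval x γ)
    (hcut : Deform L C κ β (fun l => inpOcc l r + (if l = s₁.i then 1 else 0) +
        (if l = s₂.i then 1 else 0) + gOcc l γ₂ + stOcc l st) c (cutVec τ x s₁ s₂ γ s)
      fun y => inpVal φ τ w y r * sVal φ τ w y ⟨s₁.i, s₁.p, s₁.q - s⟩ * of v *
        (sVal φ τ w y ⟨s₂.i, s₂.p + s, s₂.q⟩ * of (gval y γ₂) * stVal φ τ w y st) = 1) :
    Deform L C κ β (fun l => inpOcc l (Sum.inr s₁ :: r) + gOcc l γ + stOcc l ((s₂, γ₂) :: st))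
      (c + β) x
      fun y => inpVal φ τ w y (Sum.inr s₁ :: r) * of (gval y γ) * stVal φ τ w y ((s₂, γ₂) :: st) =
        1 := by
  have hij : s₁.i ≠ s₂.i := by
    intro h
    have := hocc s₁.i
    rw [if_pos rfl, if_pos h] at this
    omega
  have hγL : ∀ l, gOcc l γ ≠ 0 → ¬ L l := fun l hl =>
    hγ.not_of_mem (List.count_pos_iff.1 (Nat.pos_of_ne_zero hl))
  obtain ⟨p1, -, e1, L1, -⟩ := hs₁
  obtain ⟨p2, -, e2, L2, -⟩ := hs₂
  have hγ1 : gOcc s₁.i γ = 0 := by by_contra h; exact hγL _ h L1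
  have hγ2 : gOcc s₂.i γ = 0 := by by_contra h; exact hγL _ h L2
  have d1 : s₁.p / τ s₁.i ≤ (s₁.q - s) / τ s₁.i := Nat.div_le_div_right (by omega)
  have d2 : (s₂.p + s) / τ s₂.i ≤ s₂.q / τ s₂.i := Nat.div_le_div_right (by omega)
  refine hface.combine hcut hij L1 L2 N hb₁ hb₂ hk₁ hk₂ hC ?_ ?_ ?_ ?_
  · funext l
    simp only [Pi.add_apply, Pi.smul_apply, smul_eq_mul, cutVec]
    by_cases hl1 : l = s₁.i
    · subst hl1; simp only [if_true, hγ1, Pi.single_eq_same, Pi.single_eq_of_ne hij, add_zero]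
      omega
    · by_cases hl2 : l = s₂.i
      · subst hl2
        simp only [if_true, hl1, if_false, hγ2, Pi.single_eq_same, Pi.single_eq_of_ne hij.symm,
          zero_add]
        omega
      · simp only [hl1, hl2, if_false, Pi.single_eq_of_ne hl1, Pi.single_eq_of_ne hl2]
        split_ifs <;> omega
  · intro l hl
    refine ⟨hγL l hl, ?_⟩
    have := hocc l
    omega
  · intro l hl
    simp only [inpOcc, stOcc] at hl
    refine ⟨by omega, by omega, ?_, ?_⟩
    · rintro rfl; simp at hl
    · rintro rfl; simp at hl
  · intro y₁ y' n hy₁ hy' hΦ₁ hΦ'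
    set y := y₁ + ((Pi.single s₁.i b₁ + Pi.single s₂.i b₂ : ι → ℕ) +
      n • (Pi.single s₁.i k₁ + Pi.single s₂.i k₂ : ι → ℕ)) + y' with hy
    have hyl : ∀ l, l ≠ s₁.i → l ≠ s₂.i → y l = y₁ l + y' l := by
      intro l hl1 hl2
      simp [hy, hl1, hl2]
    have hy1 : y s₁.i = y' s₁.i + (b₁ + n * k₁) := by
      simp [hy, hij, hy₁ s₁.i hγ1, add_comm]
    have hy2 : y s₂.i = y' s₂.i + (b₂ + n * k₂) := by
      simp [hy, hij.symm, hy₁ s₂.i hγ2, add_comm]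
    have hsame : ∀ l, gOcc l γ = 0 → l ≠ s₁.i → l ≠ s₂.i → y l = y' l := by
      intro l hl hl1 hl2
      rw [hyl l hl1 hl2, hy₁ l hl, zero_add]
    have hne1 : ∀ l, inpOcc l r + gOcc l γ₂ + stOcc l st ≠ 0 → y l = y' l := by
      intro l hl
      have := hocc l
      refine hsame l (by omega) ?_ ?_
      · rintro rfl; rw [if_pos rfl] at this; omega
      · rintro rfl; rw [if_pos rfl] at this; omega
    have c1 : inpVal φ τ w y r = inpVal φ τ w y' r :=
      inpVal_congr fun l hl => hne1 l (by omega)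
    have c2 : gval y γ₂ = gval y' γ₂ := gval_congr_occ fun l hl => hne1 l (by omega)
    have c3 : stVal φ τ w y st = stVal φ τ w y' st := stVal_congr fun l hl => hne1 l (by omega)
    -- On the variables of `γ` the vector `y'` vanishes, so only `y₁` matters here.
    have c4 : gval y γ = gval x γ := by
      rw [← hΦ₁]
      refine gval_congr_occ fun l hl => ?_
      have hl0 := hocc l
      rw [hyl l (fun h => hl (h ▸ hγ1)) (fun h => hl (h ▸ hγ2)), hy' l (by omega),
        add_zero]
    -- Cutting the strip is an identity in the extension for every number `n` of blocks, not only
    -- for the number occurring in `x`.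
    have key := segVal_mul_of_mul_segVal (p₁ := s₁.p) (q₂ := s₂.q) h1 h2 hp hv n (y' s₁.i) (y' s₂.i)
    simp only [inpVal, stVal, sVal, c1, c2, c3, c4, hy1, hy2] at hΦ' ⊢
    rw [← hΦ']
    simp only [mul_assoc] at key ⊢
    congr 1
    have := congrArg (· * (of (gval y' γ₂) * stVal φ τ w y' st)) key
    simpa only [mul_assoc] using this

/-- Every solution of a well-formed configuration lies in a linear set of solutions of bounded
norm. -/
theorem exists_deform {ℓ : G → ℕ} (hℓ : IsLength A B ℓ) {D T Γ Λ : ℕ}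
    (hτ : ∀ i, L i → 0 < τ i) (hw : ∀ i, L i → ∀ m, w i (m + τ i) = w i m)
    (hD : ∀ i, L i → ∀ m, ℓ (w i m).2 + 1 ≤ D) (hT : ∀ i, L i → τ i ≤ T)
    {F : Finset G} (hF : ∀ a, a ∈ A ∨ a ∈ B → a ∈ F) (hΓ : F.card ≤ Γ) (hβ : Γ * (T * T) ≤ β)
    (hface : ∀ (γ : List (G × Option ι)) (x : ι → ℕ), GOK L γ → (gvars γ).Nodup →
      gcost ℓ γ + ℓ (gval x γ) ≤ Λ →
      Deform L C κ β (fun l => gOcc l γ) 0 (fun l => if gOcc l γ = 0 then 0 else x l)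
        fun y => gval y γ = gval x γ) (ν : ℕ) :
    ∀ (inp : List (Item G ι)) (γ : List (G × Option ι)) (st : List (Seg ι × List (G × Option ι)))
      (x : ι → ℕ), 2 * inp.length + st.length ≤ ν →
      (∀ l, inpOcc l inp + gOcc l γ + stOcc l st ≤ 1) →
      InpOK A B τ w L C x inp → GOK L γ → StOK A B τ w L C x st →
      (∀ l, inpOcc l inp + gOcc l γ + stOcc l st = 0 → x l = 0) →
      inpCost ℓ inp + gcost ℓ γ + stCost ℓ st + (2 * segCount inp + st.length) * D + D ≤ Λ →
      inpVal φ τ w x inp * of (gval x γ) * stVal φ τ w x st = 1 →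
      Deform L C κ β (fun l => inpOcc l inp + gOcc l γ + stOcc l st)
        ((2 * segCount inp + st.length) * β) x
        fun y => inpVal φ τ w y inp * of (gval y γ) * stVal φ τ w y st = 1 := by
  -- Unread items count twice. A push then lowers the measure by one, and so does a strip whose two
  -- remainders are both pushed: one item and one stack segment become two stack segments.
  induction ν with
  | zero =>
    intro inp γ st x hν hocc hinp hγ hst hx hbud hval
    obtain rfl : inp = [] := List.length_eq_zero_iff.1 (by omega)
    obtain rfl : st = [] := List.length_eq_zero_iff.1 (by omega)
    simp only [inpVal, stVal, one_mul, mul_one] at hval ⊢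
    -- Everything has been reduced to the base group; what is left is one knapsack instance over `G`
    -- with value 1.
    have hg : gval x γ = 1 := of_injective φ (by rw [hval, map_one])
    have hnd : (gvars γ).Nodup := List.nodup_iff_count_le_one.2 fun l => by
      have := hocc l; simp only [inpOcc, stOcc] at this; unfold gOcc at this; omega
    have h := hface γ x hγ hnd (by
      rw [hg, hℓ.one]; simp only [inpCost, stCost] at hbud; omega)
    have hxx : (fun l => if gOcc l γ = 0 then 0 else x l) = x := by
      funext l
      split_ifs with h0
      · exact (hx l (by simp [inpOcc, stOcc, h0])).symm
      · rfl
    rw [hxx] at h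
    refine h.mono (fun l hl => by simpa [inpOcc, stOcc] using hl) (Nat.zero_le _)
      fun y _ hy => by rw [hy, hg, map_one]
  | succ ν ih =>
    intro inp γ st x hν hocc hinp hγ hst hx hbud hval
    match inp, st with
    | [], [] => exact ih [] γ [] x (by simp) hocc hinp hγ hst hx hbud hval
    | [], (s, γ') :: r =>
      -- All input is read but the stack is not empty: excluded by Britton's lemma.
      exfalso
      simp only [inpVal, one_mul] at hval
      exact (redFrom_stVal (φ := φ) hst).of_mul_ne_one _ hval
    | Sum.inl a :: r, st =>
      have hg : ∀ l, gOcc l (a :: γ) = gOcc l [a] + gOcc l γ := fun l => gOcc_cons l a γ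
      have h := ih r (a :: γ) st x (by simp only [List.length_cons] at hν; omega)
        (fun l => by have := hocc l; simp only [inpOcc] at this; rw [hg]; omega) hinp.2
        (fun a' ha' => by
          rcases List.mem_cons.1 ha' with rfl | ha'
          · exact hinp.1 a' (by simp)
          · exact hγ a' ha') hst
        (fun l hl => hx l (by simp only [inpOcc]; rw [hg] at hl; omega))
        (by simp only [inpCost, segCount, gcost_cons, gcost_nil] at hbud ⊢; omega)
        (by simpa [inpVal, mul_assoc] using hval)
      refine h.mono (fun l hl => by simp only [inpOcc] at hl; rw [hg]; omega) le_rfl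
        fun y _ hy => by simpa [inpVal, mul_assoc] using hy
    | Sum.inr s₁ :: r, st =>
      have hpush : (∀ s' ∈ st.head?,
          Irred A B (w s₁.i (s₁.q - 1)) (gval x γ) (w s'.1.i s'.1.p).1) →
          Deform L C κ β (fun l => inpOcc l (Sum.inr s₁ :: r) + gOcc l γ + stOcc l st)
            ((2 * segCount (Sum.inr s₁ :: r) + st.length) * β) x
            fun y => inpVal φ τ w y (Sum.inr s₁ :: r) * of (gval y γ) * stVal φ τ w y st = 1 := by
        intro hirr
        have h := ih r [] ((s₁, γ) :: st) x (by simp only [List.length_cons] at hν ⊢; omega)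
          (fun l => by
            have := hocc l; simp only [inpOcc, stOcc, gOcc_nil] at this ⊢; omega)
          hinp.2 (by simp [GOK]) ⟨hinp.1, hγ, hst, hirr⟩
          (fun l hl => hx l (by simp only [inpOcc, stOcc, gOcc_nil] at hl ⊢; omega))
          (by
            have := Nat.mul_le_mul_right D
              (show 2 * segCount r + ((s₁, γ) :: st).length ≤
                2 * segCount (Sum.inr s₁ :: r) + st.length by
                  simp only [segCount, List.length_cons]; omega)
            simp only [inpCost, stCost, gcost_nil] at hbud ⊢; omega)
          (by simpa [inpVal, stVal, mul_assoc] using hval)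
        refine h.mono (fun l hl => by simp only [inpOcc, stOcc, gOcc_nil] at hl ⊢; omega)
          (Nat.mul_le_mul_right _ (by simp only [segCount, List.length_cons]; omega))
          fun y _ hy => by simpa [inpVal, stVal, mul_assoc] using hy
      match st with
      | [] => exact hpush (by simp)
      | (s₂, γ₂) :: st =>
      by_cases hirr : Irred A B (w s₁.i (s₁.q - 1)) (gval x γ) (w s₂.i s₂.p).1
      · exact hpush (by simpa using hirr)
      clear hpush
      obtain ⟨hs₁, hr⟩ := hinp
      obtain ⟨hs₂, hγ₂, hst', hcor⟩ := hst
      obtain ⟨p1, R1, e1, L1, C1⟩ := hs₁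
      obtain ⟨p2, R2, e2, L2, C2⟩ := hs₂
      obtain ⟨s, hs1, hsn₁, hsn₂, hstrip, hmax⟩ := exists_max_strip (φ := φ) (n₁ := s₁.q - s₁.p)
        (n₂ := s₂.q - s₂.p) (by omega) (by omega) (by omega) hirr
      obtain ⟨b₁, b₂, k₁, k₂, N, h1, h2, hp, hb₁, hb₂, hk₁, hk₂, hC⟩ :=
        exists_strip_period (hτ _ L1) (hτ _ L2) (hw _ L1) (hw _ L2) (by omega) hF hΓ hstrip
      have hβ' : Γ * (τ s₁.i * τ s₂.i) ≤ β :=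
        le_trans (Nat.mul_le_mul_left _ (Nat.mul_le_mul (hT _ L1) (hT _ L2))) hβ
      obtain ⟨a, ha, hav⟩ := hstrip s hs1 le_rfl
      set v := a * (w s₂.i (s₂.p + s - 1)).2 with hv
      -- The `+ 1` in `hD` pays for the associated element `a`.
      have hvD : ℓ v ≤ D := by
        have h1 := hℓ.mul a (w s₂.i (s₂.p + s - 1)).2
        have h2 := hℓ.assoc a ha
        have h3 := hD _ L2 (s₂.p + s - 1)
        rw [hv]; omega
      -- Because of the pinch, the value of `γ` times the last syllable on its left lies in `A` or
      -- `B`. So the value is short, however large the exponents in `γ` are.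
      have hgD : ℓ (gval x γ) ≤ D := by
        obtain ⟨hmem, -⟩ := exists_pinch (φ := φ) hirr
        have h1 := hℓ.mul (w s₁.i (s₁.q - 1)).2⁻¹ ((w s₁.i (s₁.q - 1)).2 * gval x γ)
        rw [inv_mul_cancel_left] at h1
        have h2 := hℓ.assoc _ hmem
        have h3 := hD _ L1 (s₁.q - 1)
        have h4 := hℓ.inv (w s₁.i (s₁.q - 1)).2
        omega
      have hocc' : ∀ l, inpOcc l r + (if l = s₁.i then 1 else 0) + gOcc l γ +
          (if l = s₂.i then 1 else 0) + gOcc l γ₂ + stOcc l st ≤ 1 := by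
        intro l; have := hocc l; simp only [inpOcc, stOcc] at this; omega
      have hγL : ∀ l, gOcc l γ ≠ 0 → ¬ L l := fun l hl =>
        hγ.not_of_mem (List.count_pos_iff.1 (Nat.pos_of_ne_zero hl))
      have hij : s₁.i ≠ s₂.i := by
        intro h
        have := hocc' s₁.i
        rw [if_pos rfl, if_pos h] at this
        omega
      have hnd : (gvars γ).Nodup := List.nodup_iff_count_le_one.2 fun l => by
        have := hocc' l; unfold gOcc at this; omega
      have hfaceγ := hface γ x hγ hnd (by
        have : 1 * D ≤ (2 * segCount (Sum.inr s₁ :: r) + ((s₂, γ₂) :: st).length) * D :=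
          Nat.mul_le_mul_right _ (by simp only [List.length_cons]; omega)
        omega)
      set x' := cutVec τ x s₁ s₂ γ s with hx'
      have hx1 : x' s₁.i = (s₁.q - s) / τ s₁.i - s₁.p / τ s₁.i := by simp [hx', cutVec]
      have hx2 : x' s₂.i = s₂.q / τ s₂.i - (s₂.p + s) / τ s₂.i := by
        simp [hx', cutVec, hij.symm]
      have hxr : ∀ l, inpOcc l r + gOcc l γ₂ + stOcc l st ≠ 0 → x l = x' l := by
        intro l hl
        have := hocc' l
        have h1 : l ≠ s₁.i := by rintro rfl; rw [if_pos rfl] at this; omega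
        have h2 : l ≠ s₂.i := by rintro rfl; rw [if_pos rfl] at this; omega
        have h3 : gOcc l γ = 0 := by omega
        simp [hx', cutVec, h1, h2, h3]
      have hx0 : ∀ l, inpOcc l r + (if l = s₁.i then 1 else 0) + (if l = s₂.i then 1 else 0) +
          gOcc l γ₂ + stOcc l st = 0 → x' l = 0 := by
        intro l hl
        have h1 : l ≠ s₁.i := by rintro rfl; rw [if_pos rfl] at hl; omega
        have h2 : l ≠ s₂.i := by rintro rfl; rw [if_pos rfl] at hl; omega
        simp only [hx', cutVec, h1, h2, if_false]
        split_ifs with h3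
        · exact hx l (by simp only [inpOcc, stOcc, h1, h2, if_false] at hl ⊢; omega)
        · rfl
      have d1 : s₁.p / τ s₁.i ≤ (s₁.q - s) / τ s₁.i := Nat.div_le_div_right (by omega)
      have d2 : (s₂.p + s) / τ s₂.i ≤ s₂.q / τ s₂.i := Nat.div_le_div_right (by omega)
      have hr' : InpOK A B τ w L C x' r := hr.congr fun l hl => hxr l (by omega)
      have hstx' : StOK A B τ w L C x' st := hst'.congr fun l hl => hxr l (by omega)
      have hγ₂x : gval x γ₂ = gval x' γ₂ := gval_congr_occ fun l hl => hxr l (by omega)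
      have hs₁' : s < s₁.q - s₁.p → SegOK A B τ w L C x' ⟨s₁.i, s₁.p, s₁.q - s⟩ := fun h =>
        ⟨by dsimp only; omega, R1.mono le_rfl (Nat.sub_le _ _), by dsimp only; omega, L1,
          fun hc => (Nat.sub_le _ _).trans (C1 hc)⟩
      have hs₂' : s < s₂.q - s₂.p → SegOK A B τ w L C x' ⟨s₂.i, s₂.p + s, s₂.q⟩ := fun h =>
        ⟨by dsimp only; omega, R2.mono (Nat.le_add_right _ _) le_rfl, by dsimp only; omega, L2, C2⟩
      have hval' : inpVal φ τ w x' r * sVal φ τ w x' ⟨s₁.i, s₁.p, s₁.q - s⟩ * of v *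
          (sVal φ τ w x' ⟨s₂.i, s₂.p + s, s₂.q⟩ * of (gval x' γ₂) * stVal φ τ w x' st) = 1 := by
        rw [← hγ₂x, ← inpVal_congr (φ := φ) fun l hl => hxr l (by omega),
          ← stVal_congr (φ := φ) fun l hl => hxr l (by omega)]
        have key := segVal_mul_of_mul_segVal (p₁ := s₁.p) (q₂ := s₂.q) h1 h2 hp hav N
          (x' s₁.i) (x' s₂.i)
        have f1 : x s₁.i = x' s₁.i + (b₁ + N * k₁) := by omega
        have f2 : x s₂.i = x' s₂.i + (b₂ + N * k₂) := by omega
        rw [← hval, inpVal, stVal]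
        simp only [sVal] at key ⊢
        rw [f1, f2]
        have := congrArg (inpVal φ τ w x r * · * (of (gval x γ₂) * stVal φ τ w x st)) key
        simpa only [mul_assoc] using this.symm
      -- The new constant `v` costs at most `D`. This is paid for by the number of strips still
      -- possible, which drops by one.
      have hbud' : ∀ μ c, c ≤ inpCost ℓ r + ℓ v + gcost ℓ γ₂ + stCost ℓ st →
          μ + 1 ≤ 2 * segCount (Sum.inr s₁ :: r) + ((s₂, γ₂) :: st).length →
          c + μ * D + D ≤ Λ := by
        intro μ c hc hμ
        have := Nat.mul_le_mul_right D hμ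
        rw [add_mul, one_mul] at this
        simp only [inpCost, stCost] at hbud
        omega
      -- It remains to deform the configuration after the cut. Four cases arise, according to which
      -- of the two segments is used up.
      suffices hcut : Deform L C κ β (fun l => inpOcc l r + (if l = s₁.i then 1 else 0) +
            (if l = s₂.i then 1 else 0) + gOcc l γ₂ + stOcc l st)
          ((2 * segCount r + st.length + 2) * β) x'
          fun y => inpVal φ τ w y r * sVal φ τ w y ⟨s₁.i, s₁.p, s₁.q - s⟩ * of v *
            (sVal φ τ w y ⟨s₂.i, s₂.p + s, s₂.q⟩ * of (gval y γ₂) * stVal φ τ w y st) = 1 by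
        have := Deform.of_cut hocc' ⟨p1, R1, e1, L1, C1⟩ ⟨p2, R2, e2, L2, C2⟩ hγ hsn₁ hsn₂ h1 h2 hp
          (hb₁.trans hβ') (hb₂.trans hβ') (hk₁.trans hβ') (hk₂.trans hβ') (fun hc => hC (by
            rcases hc with hc | hc
            · have := C1 hc; omega
            · have := C2 hc; omega)) hav hfaceγ hcut
        refine this.mono (fun _ h => h) (le_of_eq ?_) fun _ _ h => h
        simp only [segCount, List.length_cons]; ring
      -- The index of a used-up segment no longer occurs, so its exponent is zero in all
      -- deformations and the segment has value 1.
      have hempty₁ : s = s₁.q - s₁.p → ∀ y : ι → ℕ, y s₁.i = 0 →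
          sVal φ τ w y ⟨s₁.i, s₁.p, s₁.q - s⟩ = 1 := by
        intro h y hy
        have : s₁.q - s = s₁.p := by omega
        rw [sVal, this]; dsimp only; rw [hy, segVal_empty]
      have hempty₂ : s = s₂.q - s₂.p → ∀ y : ι → ℕ, y s₂.i = 0 →
          sVal φ τ w y ⟨s₂.i, s₂.p + s, s₂.q⟩ = 1 := by
        intro h y hy
        have : s₂.p + s = s₂.q := by omega
        rw [sVal, this]; dsimp only; rw [hy, segVal_empty]
      have hx1e : s = s₁.q - s₁.p → x' s₁.i = 0 := by
        intro h
        have : s₁.q - s = s₁.p := by omega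
        rw [hx1, this, Nat.sub_self]
      have hx2e : s = s₂.q - s₂.p → x' s₂.i = 0 := by
        intro h
        have : s₂.p + s = s₂.q := by omega
        rw [hx2, this, Nat.sub_self]
      have hGv : GOK L [(v, (none : Option ι))] := by simp [GOK]
      have hGvγ₂ : GOK L ((v, (none : Option ι)) :: γ₂) := by
        intro b hb
        rcases List.mem_cons.1 hb with rfl | hb
        · simp
        · exact hγ₂ b hb
      have hov : ∀ l, gOcc l ((v, (none : Option ι)) :: γ₂) = gOcc l γ₂ := fun l => by
        rw [gOcc_cons, gOcc_none, zero_add]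
      have hocc1 : inpOcc s₁.i r = 0 ∧ gOcc s₁.i γ₂ = 0 ∧ stOcc s₁.i st = 0 := by
        have := hocc' s₁.i; rw [if_pos rfl] at this; omega
      have hocc2 : inpOcc s₂.i r = 0 ∧ gOcc s₂.i γ₂ = 0 ∧ stOcc s₂.i st = 0 := by
        have := hocc' s₂.i; rw [if_pos rfl] at this; omega
      simp only [List.length_cons] at hν
      rcases hsn₁.lt_or_eq with hn₁ | hn₁ <;> rcases hsn₂.lt_or_eq with hn₂ | hn₂
      -- Maximality of the strip gives the corner condition at `v`, so both remainders can go on the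
      -- stack.
      · have h := ih r [] ((⟨s₁.i, s₁.p, s₁.q - s⟩, [(v, none)]) ::
            (⟨s₂.i, s₂.p + s, s₂.q⟩, γ₂) :: st) x'
          (by simp only [List.length_cons]; omega)
          (fun l => by have := hocc' l; simp only [stOcc, gOcc_nil, gOcc_none]; omega)
          hr' (by simp [GOK])
          ⟨hs₁' hn₁, hGv, ⟨hs₂' hn₂, hγ₂, hstx', by rwa [← hγ₂x]⟩, by
            simpa using hmax v hav hn₁ hn₂⟩
          (fun l hl => hx0 l (by simp only [stOcc, gOcc_nil, gOcc_none] at hl; omega))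
          (hbud' _ _ (by simp only [stCost, gcost_cons, gcost_nil]; omega)
            (by simp only [segCount, List.length_cons]; omega))
          (by simpa [stVal, mul_assoc] using hval')
        refine h.mono (fun l hl => by simp only [stOcc, gOcc_nil, gOcc_none]; omega)
          (Nat.mul_le_mul_right _ (by simp only [List.length_cons]; omega)) fun y _ hy => ?_
        simpa [stVal, mul_assoc] using hy
      -- The remainder of the first segment returns to the input, as it may pinch with the next
      -- segment of the stack.
      · have h := ih (Sum.inr ⟨s₁.i, s₁.p, s₁.q - s⟩ :: r) ((v, none) :: γ₂) st x'
          (by simp only [List.length_cons]; omega)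
          (fun l => by have := hocc' l; simp only [inpOcc, hov]; omega)
          ⟨hs₁' hn₁, hr'⟩ hGvγ₂ hstx'
          (fun l hl => by
            by_cases hl2 : l = s₂.i
            · rw [hl2]; exact hx2e hn₂
            · exact hx0 l (by simp only [inpOcc, hov] at hl; rw [if_neg hl2]; omega))
          (hbud' _ _ (by simp only [inpCost, gcost_cons]; omega)
            (by simp only [segCount, List.length_cons]; omega))
          (by
            rw [hempty₂ hn₂ _ (hx2e hn₂)] at hval'
            simpa [inpVal, mul_assoc] using hval')
        refine h.mono (fun l hl => by simp only [inpOcc, hov]; omega)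
          (Nat.mul_le_mul_right _ (by simp only [segCount]; omega)) fun y hy0 hy => ?_
        rw [hempty₂ hn₂ y (hy0 _ (by simp [inpOcc, hov, hij.symm, hocc2]))]
        simpa [inpVal, mul_assoc] using hy
      · have h := ih r [(v, none)] ((⟨s₂.i, s₂.p + s, s₂.q⟩, γ₂) :: st) x'
          (by simp only [List.length_cons]; omega)
          (fun l => by have := hocc' l; simp only [stOcc, gOcc_none]; omega)
          hr' hGv ⟨hs₂' hn₂, hγ₂, hstx', by rwa [← hγ₂x]⟩
          (fun l hl => by
            by_cases hl1 : l = s₁.i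
            · rw [hl1]; exact hx1e hn₁
            · exact hx0 l (by simp only [stOcc, gOcc_none] at hl; rw [if_neg hl1]; omega))
          (hbud' _ _ (by simp only [stCost, gcost_cons, gcost_nil]; omega)
            (by simp only [segCount, List.length_cons]; omega))
          (by
            rw [hempty₁ hn₁ _ (hx1e hn₁)] at hval'
            simpa [stVal, mul_assoc] using hval')
        refine h.mono (fun l hl => by simp only [stOcc, gOcc_none]; omega)
          (Nat.mul_le_mul_right _ (by simp only [List.length_cons]; omega)) fun y hy0 hy => ?_
        rw [hempty₁ hn₁ y (hy0 _ (by simp [stOcc, gOcc_none, hij, hocc1]))]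
        simpa [stVal, mul_assoc] using hy
      · have h := ih r ((v, none) :: γ₂) st x' (by omega)
          (fun l => by have := hocc' l; simp only [hov]; omega)
          hr' hGvγ₂ hstx'
          (fun l hl => by
            by_cases hl1 : l = s₁.i
            · rw [hl1]; exact hx1e hn₁
            · by_cases hl2 : l = s₂.i
              · rw [hl2]; exact hx2e hn₂
              · exact hx0 l (by simp only [hov] at hl; rw [if_neg hl1, if_neg hl2]; omega))
          (hbud' _ _ (by simp only [gcost_cons]; omega)
            (by simp only [segCount, List.length_cons]; omega))
          (by
            rw [hempty₁ hn₁ _ (hx1e hn₁), hempty₂ hn₂ _ (hx2e hn₂)] at hval'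
            simpa [mul_assoc] using hval')
        refine h.mono (fun l hl => by simp only [hov]; omega)
          (Nat.mul_le_mul_right _ (by omega)) fun y hy0 hy => ?_
        rw [hempty₁ hn₁ y (hy0 _ (by simp [hov, hocc1])),
          hempty₂ hn₂ y (hy0 _ (by simp [hov, hocc2]))]
        simpa [mul_assoc] using hy

end Reduction

end Knapsack

namespace Knapsack

open scoped Pointwise

/-! ### Reduced and cyclically reduced words -/

section Words

open HNNExtension

variable {G : Type*}

/-- The cost of a list of syllables. -/
def sylCost (ℓ : G → ℕ) (C : List (ℤˣ × G)) : ℕ := (C.map fun s => 1 + ℓ s.2).sum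

@[simp] theorem sylCost_nil (ℓ : G → ℕ) : sylCost ℓ [] = 0 := rfl

@[simp] theorem sylCost_cons (ℓ : G → ℕ) (s : ℤˣ × G) (C : List (ℤˣ × G)) :
    sylCost ℓ (s :: C) = 1 + ℓ s.2 + sylCost ℓ C := by simp [sylCost]

@[simp] theorem sylCost_append (ℓ : G → ℕ) (C C' : List (ℤˣ × G)) :
    sylCost ℓ (C ++ C') = sylCost ℓ C + sylCost ℓ C' := by simp [sylCost]

theorem length_le_sylCost (ℓ : G → ℕ) (C : List (ℤˣ × G)) : C.length ≤ sylCost ℓ C := by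
  induction C with
  | nil => simp
  | cons s C ih => simp only [sylCost_cons, List.length_cons]; omega

theorem le_sylCost (ℓ : G → ℕ) {C : List (ℤˣ × G)} {s : ℤˣ × G} (hs : s ∈ C) :
    ℓ s.2 + 1 ≤ sylCost ℓ C := by
  induction C with
  | nil => simp at hs
  | cons a C ih =>
    rcases List.mem_cons.1 hs with rfl | hs
    · simp only [sylCost_cons]; omega
    · have := ih hs; simp only [sylCost_cons]; omega

variable [Group G] {A B : Subgroup G} {ψ : A ≃* B} {Λ : Type*} {σ : Λ → G}

/-- The generators of the group `HNNExtension G A B ψ`. -/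
def letterVal (ψ : A ≃* B) (σ : Λ → G) : Λ ⊕ Bool → HNNExtension G A B ψ
  | Sum.inl a => of (σ a)
  | Sum.inr true => t
  | Sum.inr false => t⁻¹

theorem hnnGen_eq_letterVal (ψ : A ≃* B) (σ : Λ → G) : hnnGen ψ σ = letterVal ψ.symm σ := by
  funext a
  rcases a with a | (_ | _) <;> rfl

/-- The list of syllables contains no pinch. -/
def Red (A B : Subgroup G) (C : List (ℤˣ × G)) : Prop :=
  C.IsChain fun a b => a.2 ∈ toSubgroup A B a.1 → a.1 = b.1

/-- The product of a list of syllables. -/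
def sylProd (ψ : A ≃* B) (C : List (ℤˣ × G)) : HNNExtension G A B ψ := (C.map (sylVal ψ)).prod

@[simp] theorem sylProd_nil : sylProd ψ [] = 1 := rfl

@[simp] theorem sylProd_cons (s : ℤˣ × G) (C : List (ℤˣ × G)) :
    sylProd ψ (s :: C) = sylVal ψ s * sylProd ψ C := by simp [sylProd]

@[simp] theorem sylProd_append (C C' : List (ℤˣ × G)) :
    sylProd ψ (C ++ C') = sylProd ψ C * sylProd ψ C' := by simp [sylProd]

theorem Red.cons {s : ℤˣ × G} {C : List (ℤˣ × G)} (hC : Red A B C)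
    (h : ∀ s' ∈ C.head?, Irred A B s 1 s'.1) : Red A B (s :: C) := by
  cases C with
  | nil => exact List.isChain_singleton _
  | cons s' C => exact List.isChain_cons_cons.2 ⟨by simpa [Irred] using h s' rfl, hC⟩

theorem Red.of_cons {s : ℤˣ × G} {C : List (ℤˣ × G)} (hC : Red A B (s :: C)) : Red A B C :=
  List.IsChain.tail hC

/-- No corner follows the last syllable, so its group element is arbitrary. -/
theorem Red.append_replace {M : List (ℤˣ × G)} {u : ℤˣ} {g g' : G} (h : Red A B (M ++ [(u, g)])) :
    Red A B (M ++ [(u, g')]) := by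
  unfold Red at *
  rw [List.isChain_append] at h ⊢
  refine ⟨h.1, List.isChain_singleton _, fun a ha b hb => ?_⟩
  obtain rfl : b = (u, g') := by simpa using hb.symm
  exact h.2.2 a ha (u, g) (by simp)

/-- Every word represents the value of a reduced word of at most the same cost. -/
theorem exists_red {ℓ : G → ℕ} (hℓ : IsLength A B ℓ) (hσ : ∀ i, ℓ (σ i) ≤ 1)
    (W : List (Λ ⊕ Bool)) :
    ∃ (g : G) (C : List (ℤˣ × G)), Red A B C ∧
      wordVal (letterVal ψ σ) W = of g * sylProd ψ C ∧ ℓ g + sylCost ℓ C ≤ W.length := by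
  induction W with
  | nil => exact ⟨1, [], List.isChain_nil, by simp [wordVal_nil], by simp [hℓ.one]⟩
  | cons a W ih =>
    obtain ⟨g, C, h1, h2, h3⟩ := ih
    rw [wordVal_cons, h2]
    have hcase : ∀ u : ℤˣ, ∃ (g' : G) (C' : List (ℤˣ × G)), Red A B C' ∧
        t ^ (u : ℤ) * (of g * sylProd ψ C) = of g' * sylProd ψ C' ∧
        ℓ g' + sylCost ℓ C' ≤ (a :: W).length := by
      intro u
      by_cases hi : ∀ s' ∈ C.head?, Irred A B (u, g) 1 s'.1
      · refine ⟨1, (u, g) :: C, h1.cons hi, by simp [sylVal, mul_assoc], ?_⟩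
        simp only [sylCost_cons, hℓ.one, List.length_cons]; omega
      · push Not at hi
        obtain ⟨s', hs', hi⟩ := hi
        obtain ⟨C', rfl⟩ : ∃ C', C = s' :: C' := by
          cases C with
          | nil => simp at hs'
          | cons b C' => exact ⟨C', by simpa using hs'⟩
        -- The associated element has length at most 1, which the unit charged for the removed
        -- syllable covers.
        obtain ⟨-, a', ha', hv⟩ := exists_pinch (φ := ψ) hi
        refine ⟨a' * s'.2, C', h1.of_cons, ?_, ?_⟩
        · rw [sylProd_cons, ← hv]; simp [sylVal, mul_assoc]
        · have h4 := hℓ.mul a' s'.2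
          have h5 := hℓ.assoc a' ha'
          simp only [sylCost_cons, List.length_cons] at h3 ⊢; omega
    rcases a with a | (_ | _)
    · refine ⟨σ a * g, C, h1, by simp [letterVal, mul_assoc], ?_⟩
      have h4 := hℓ.mul (σ a) g
      have h5 := hσ a
      simp only [List.length_cons]; omega
    · simpa [letterVal] using hcase (-1)
    · simpa [letterVal] using hcase 1

/-- Multiplication of a reduced word by an element of the base group on the right. -/
theorem exists_red_mul_of {ℓ : G → ℕ} (hℓ : IsLength A B ℓ) (g : G) {C : List (ℤˣ × G)}
    (hC : Red A B C) (a : G) :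
    ∃ (g' : G) (C' : List (ℤˣ × G)), Red A B C' ∧ C'.length = C.length ∧
      of g * sylProd ψ C * of a = of g' * sylProd ψ C' ∧
      ℓ g' + sylCost ℓ C' ≤ ℓ g + sylCost ℓ C + ℓ a := by
  rcases C.eq_nil_or_concat' with rfl | ⟨M, ⟨u, g₁⟩, rfl⟩
  · refine ⟨g * a, [], hC, rfl, by simp, ?_⟩
    have := hℓ.mul g a
    simp only [sylCost_nil]; omega
  · refine ⟨g, M ++ [(u, g₁ * a)], hC.append_replace, by simp, by simp [sylVal, mul_assoc], ?_⟩
    have := hℓ.mul g₁ a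
    simp only [sylCost_append, sylCost_cons, sylCost_nil]; omega

/-- Every element of the HNN-extension is conjugate to an element of the base group or to a
cyclically reduced word, without increasing the cost. -/
theorem exists_cyclicallyReduced {ℓ : G → ℕ} (hℓ : IsLength A B ℓ)
    (hword : ∀ g : G, ∃ W : List Λ, W.length = ℓ g ∧ wordVal σ W = g) (N : ℕ) :
    ∀ (g : G) (C : List (ℤˣ × G)), C.length ≤ N → Red A B C →
    ∃ (W : List (Λ ⊕ Bool)) (g' : G) (C' : List (ℤˣ × G)), Red A B (C' ++ C') ∧
      (C' ≠ [] → g' = 1) ∧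
      of g * sylProd ψ C = wordVal (letterVal ψ σ) W * (of g' * sylProd ψ C') *
        (wordVal (letterVal ψ σ) W)⁻¹ ∧
      W.length ≤ ℓ g + sylCost ℓ C ∧ ℓ g' + sylCost ℓ C' ≤ ℓ g + sylCost ℓ C := by
  have hofword : ∀ g : G, ∃ W : List (Λ ⊕ Bool), W.length = ℓ g ∧
      wordVal (letterVal ψ σ) W = of g := by
    intro g
    obtain ⟨W, h1, rfl⟩ := hword g
    refine ⟨W.map Sum.inl, by simpa using h1, ?_⟩
    simp only [wordVal, List.map_map, map_list_prod]
    rfl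
  induction N with
  | zero =>
    intro g C hC hred
    obtain rfl : C = [] := List.length_eq_zero_iff.1 (by omega)
    exact ⟨[], g, [], List.isChain_nil, by simp, by simp [wordVal_nil], by simp, le_rfl⟩
  | succ N ih =>
    intro g C hC hred
    rcases C.eq_nil_or_concat' with rfl | ⟨M, ⟨u, g₁⟩, rfl⟩
    · exact ih g [] (by simp) hred
    obtain ⟨Wg, hWg, hWgv⟩ := hofword g
    have hg₁ := hℓ.mul g₁ g
    -- Conjugation by `g` moves the leading element into the last syllable.
    have hred' : Red A B (M ++ [(u, g₁ * g)]) := hred.append_replace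
    by_cases hcyc : Red A B ((M ++ [(u, g₁ * g)]) ++ (M ++ [(u, g₁ * g)]))
    · refine ⟨Wg, 1, M ++ [(u, g₁ * g)], hcyc, fun _ => rfl, ?_, ?_, ?_⟩
      · simp [hWgv, sylVal, mul_assoc]
      · omega
      · simp only [sylCost_append, sylCost_cons, sylCost_nil, hℓ.one]; omega
    -- Only the corner between the last and the first syllable can pinch, and these are different
    -- syllables, since a single one has equal exponents on both sides of the corner.
    · obtain ⟨u₁, g₂, M', rfl, hi⟩ : ∃ u₁ g₂ M', M = (u₁, g₂) :: M' ∧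
          ¬ Irred A B (u, g₁ * g) 1 u₁ := by
        by_contra! hc
        refine hcyc (List.isChain_append.2 ⟨hred', hred', fun a ha b hb => ?_⟩)
        obtain rfl : a = (u, g₁ * g) := by simpa using ha.symm
        cases M with
        | nil =>
          obtain rfl : b = (u, g₁ * g) := by simpa using hb.symm
          exact fun _ => rfl
        | cons s M' =>
          obtain rfl : b = s := by simpa using hb.symm
          simpa [Irred] using hc b.1 b.2 M' rfl
      obtain ⟨-, a, ha, hv⟩ := exists_pinch (φ := ψ) (s' := (u₁, (1 : G))) hi
      have hM' : Red A B M' := by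
        have : Red A B ((u₁, g₂) :: M') := List.IsChain.left_of_append hred'
        exact this.of_cons
      obtain ⟨g₃, C₃, r1, r2, r3, r4⟩ := exists_red_mul_of (ψ := ψ) hℓ g₂ hM' a
      obtain ⟨W, g', C', s1, s2, s3, s4, s5⟩ := ih g₃ C₃ (by
        simp only [List.cons_append, List.length_cons, List.length_append, List.length_nil] at hC
        omega) r1
      have haℓ := hℓ.assoc a ha
      obtain ⟨b, hb⟩ : ∃ b : Bool, letterVal ψ σ (Sum.inr b) = t ^ (u₁ : ℤ) := by
        rcases Int.units_eq_one_or u₁ with rfl | rfl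
        · exact ⟨true, by simp [letterVal]⟩
        · exact ⟨false, by simp [letterVal]⟩
      refine ⟨Wg ++ Sum.inr b :: W, g', C', s1, s2, ?_, ?_, ?_⟩
      · rw [wordVal_append, wordVal_cons, hWgv, hb]
        -- Conjugation by `g * t ^ u₁` collapses the outer two syllables into `a`, on the right of a
        -- shorter word.
        have e : of g * sylProd ψ ((u₁, g₂) :: M' ++ [(u, g₁)]) =
            of g * t ^ (u₁ : ℤ) * (of g₂ * sylProd ψ M' * of a) * (t ^ (u₁ : ℤ))⁻¹ * (of g)⁻¹ := by
          have : of a = sylVal ψ (u, g₁) * of g * t ^ (u₁ : ℤ) := by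
            rw [mul_one] at hv
            rw [← hv]; simp [sylVal, mul_assoc]
          rw [this]
          simp [sylVal, mul_assoc]
        rw [e, r3, s3]
        simp [mul_assoc]
      · simp only [List.cons_append, sylCost_append, sylCost_cons, sylCost_nil, List.length_append,
          List.length_cons]
        omega
      · simp only [List.cons_append, sylCost_append, sylCost_cons, sylCost_nil]
        omega

/-- The periodic line with the period `C`. -/
def lineOf (C : List (ℤˣ × G)) (m : ℕ) : ℤˣ × G := C.getD (m % C.length) (1, 1)

theorem lineOf_of_lt {C : List (ℤˣ × G)} {m : ℕ} (hm : m < C.length) : lineOf C m = C[m] := by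
  simp [lineOf, Nat.mod_eq_of_lt hm, hm]

theorem lineVal_lineOf (C : List (ℤˣ × G)) :
    lineVal ψ (lineOf C) C.length = sylProd ψ C := by
  have : ∀ n ≤ C.length, lineVal ψ (lineOf C) n = sylProd ψ (C.take n) := by
    intro n hn
    induction n with
    | zero => simp [lineVal]
    | succ n ih =>
      rw [lineVal, ih (by omega), lineOf_of_lt (by omega),
        List.take_succ_eq_append_getElem (by omega), sylProd_append, sylProd_cons, sylProd_nil,
        mul_one]
  rw [this _ le_rfl, List.take_length]

theorem redSeg_lineOf {C : List (ℤˣ × G)} (hC : Red A B C) :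
    RedSeg A B (lineOf C) 0 C.length := by
  intro m _ hm
  rw [lineOf_of_lt hm, lineOf_of_lt (by omega), Irred, mul_one]
  exact List.isChain_iff_getElem.1 hC m hm

/-- Any two adjacent letters of the line already occur side by side in `C ++ C`. -/
theorem redSeg_lineOf_cyclic {C : List (ℤˣ × G)} (hC : Red A B (C ++ C)) (p q : ℕ) :
    RedSeg A B (lineOf C) p q := by
  intro m _ _
  rcases eq_or_ne C [] with rfl | hne
  · simp [lineOf, Irred]
  have hpos : 0 < C.length := List.length_pos_iff.2 hne
  have hlt : m % C.length < C.length := Nat.mod_lt _ hpos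
  have h1 : lineOf C m = (C ++ C)[m % C.length]'(by simp; omega) := by
    rw [List.getElem_append_left hlt, lineOf, List.getD_eq_getElem _ _ hlt]
  have h2 : lineOf C (m + 1) = (C ++ C)[m % C.length + 1]'(by simp; omega) := by
    have hmod : (m + 1) % C.length = (m % C.length + 1) % C.length := by simp
    rw [lineOf, hmod]
    rcases Nat.lt_or_ge (m % C.length + 1) C.length with h | h
    · rw [Nat.mod_eq_of_lt h, List.getElem_append_left h, List.getD_eq_getElem _ _ h]
    · have he : m % C.length + 1 = C.length := by omega
      rw [List.getElem_append_right h]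
      simp only [he, Nat.mod_self, Nat.sub_self]
      rw [List.getD_eq_getElem _ _ hpos]
  rw [h1, h2, Irred, mul_one]
  exact List.isChain_iff_getElem.1 hC _ _

/-- The maximum with 1 keeps the period positive when `C` is empty. -/
theorem lineOf_add (C : List (ℤˣ × G)) (m : ℕ) : lineOf C (m + max C.length 1) = lineOf C m := by
  rcases eq_or_ne C [] with rfl | hne
  · simp [lineOf]
  · have hpos : 0 < C.length := List.length_pos_iff.2 hne
    rw [max_eq_left hpos, lineOf, lineOf, Nat.add_mod_right]

theorem lineOf_cost {ℓ : G → ℕ} (h1 : ℓ 1 = 0) (C : List (ℤˣ × G)) {D : ℕ} (hD : 1 ≤ D)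
    (hC : sylCost ℓ C ≤ D) (m : ℕ) : ℓ (lineOf C m).2 + 1 ≤ D := by
  rcases eq_or_ne C [] with rfl | hne
  · simp [lineOf, h1, hD]
  · have hlt : m % C.length < C.length := Nat.mod_lt _ (List.length_pos_iff.2 hne)
    rw [lineOf, List.getD_eq_getElem _ _ hlt]
    exact (le_sylCost ℓ (List.getElem_mem hlt)).trans hC

end Words

end Knapsack

namespace Knapsack

open scoped Pointwise

/-! ### Solution sets over the HNN-extension -/

section Lists

open HNNExtension

variable {G ι : Type*}

theorem inpOcc_append [DecidableEq ι] (l : ι) (I J : List (Item G ι)) :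
    inpOcc l (I ++ J) = inpOcc l I + inpOcc l J := by
  induction I with
  | nil => simp [inpOcc]
  | cons a I ih => rcases a with a | a <;> simp only [List.cons_append, inpOcc, ih] <;> omega

theorem inpCost_append (ℓ : G → ℕ) (I J : List (Item G ι)) :
    inpCost ℓ (I ++ J) = inpCost ℓ I + inpCost ℓ J := by
  induction I with
  | nil => simp [inpCost]
  | cons a I ih =>
    rcases a with a | a
    · simp only [List.cons_append, inpCost, ih]
      omega
    · simp only [List.cons_append, inpCost, ih]

theorem segCount_append (I J : List (Item G ι)) : segCount (I ++ J) = segCount I + segCount J := by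
  induction I with
  | nil => simp [segCount]
  | cons a I ih => rcases a with a | a <;> (simp only [List.cons_append, segCount, ih]; try omega)

variable [Group G] {A B : Subgroup G} {φ : A ≃* B} {τ : ι → ℕ} {w : ι → ℕ → ℤˣ × G}
  {L C : ι → Prop} {x y : ι → ℕ}

theorem inpVal_append (I J : List (Item G ι)) :
    inpVal φ τ w y (I ++ J) = inpVal φ τ w y J * inpVal φ τ w y I := by
  induction I with
  | nil => simp [inpVal]
  | cons a I ih => rcases a with a | a <;> simp only [List.cons_append, inpVal, ih, mul_assoc]

theorem InpOK.append {I J : List (Item G ι)} (hI : InpOK A B τ w L C x I)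
    (hJ : InpOK A B τ w L C x J) : InpOK A B τ w L C x (I ++ J) := by
  induction I with
  | nil => exact hJ
  | cons a I ih => rcases a with a | a <;> exact ⟨hI.1, ih hI.2⟩

end Lists

/-! ### Items for the constants and powers of an expression -/

section Blocks

open HNNExtension

variable {G ι : Type*}

/-- The items for the element `g * C` with the index `l`, in reverse order. -/
def constItems (l : ι) (g : G) (C : List (ℤˣ × G)) : List (Item G ι) :=
  (if C = [] then [] else [Sum.inr ⟨l, 0, C.length⟩]) ++ [Sum.inl (g, none)]

variable {l : ι} {g : G} {D : List (ℤˣ × G)}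

theorem constItems_cost (ℓ : G → ℕ) : inpCost ℓ (constItems l g D) = ℓ g := by
  unfold constItems
  split_ifs <;> simp [inpCost]

theorem constItems_segCount : segCount (constItems l g D) ≤ 1 := by
  unfold constItems
  split_ifs <;> simp [segCount]

theorem constItems_occ [DecidableEq ι] (l' : ι) :
    inpOcc l' (constItems l g D) = if D ≠ [] ∧ l' = l then 1 else 0 := by
  unfold constItems
  by_cases h : D = [] <;> simp [inpOcc, gOcc_none, h]

variable [Group G] {A B : Subgroup G} {φ : A ≃* B} {L C : ι → Prop}

open Classical in
/-- The items for the power `c ^ x`, where `c` is `g` or the cyclically reduced word `C`. -/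
noncomputable def powItems (l : ι) (g : G) (C : List (ℤˣ × G)) (x : ℕ) : List (Item G ι) :=
  if C = [] then if g = 1 then [] else [Sum.inl (g, some l)]
  else if x = 0 then [] else [Sum.inr ⟨l, 0, C.length * x⟩]

variable {x : ι → ℕ} {τ : ι → ℕ} {w : ι → ℕ → ℤˣ × G}

/-- A constant with syllables is exactly one period of its own line, with exponent 1. The end
position equals the period, which is the restriction put on indices in `C`. -/
theorem constItems_ok (hτ : τ l = max D.length 1) (hw : w l = lineOf D) (hL : L l)
    (hD : Red A B D) (hx : x l = if D = [] then 0 else 1) :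
    InpOK A B τ w L C x (constItems l g D) := by
  unfold constItems
  split_ifs with h
  · simp [InpOK, GOK]
  · have hpos : 0 < D.length := List.length_pos_iff.2 h
    have hτ' : τ l = D.length := by rw [hτ, max_eq_left hpos]
    simp only [List.cons_append, List.nil_append, InpOK, SegOK]
    refine ⟨⟨hpos, hw ▸ redSeg_lineOf hD, ?_, hL, fun _ => hτ'.ge⟩, by simp [GOK], trivial⟩
    rw [hτ', hx, if_neg h, Nat.div_self hpos, Nat.zero_div]

theorem constItems_val (hτ : τ l = max D.length 1) (hw : w l = lineOf D) {y : ι → ℕ}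
    (hy : y l = if D = [] then 0 else 1) :
    inpVal φ τ w y (constItems l g D) = of g * sylProd φ D := by
  unfold constItems
  split_ifs at hy ⊢ with h
  · subst h; simp [inpVal]
  · have hpos : 0 < D.length := List.length_pos_iff.2 h
    have hτ' : τ l = D.length := by rw [hτ, max_eq_left hpos]
    simp only [List.cons_append, List.nil_append, inpVal, sVal, itemVal_none, one_mul]
    rw [segVal_self _ (by rw [hτ', hy, Nat.div_self hpos, Nat.zero_div]), hw, lineVal_lineOf]
    simp [lineVal]

theorem powItems_ok (hτ : τ l = max D.length 1) (hw : w l = lineOf D) (hL : L l ↔ D ≠ [])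
    (hC : ¬ C l) (hD : Red A B (D ++ D)) :
    InpOK A B τ w L C x (powItems l g D (x l)) := by
  unfold powItems
  split_ifs with h h' h'
  · trivial
  · simp only [InpOK, GOK, List.mem_singleton]
    refine ⟨?_, trivial⟩
    rintro a rfl i hi
    obtain rfl : l = i := by simpa using hi
    exact ⟨h', fun hl => hL.1 hl h⟩
  · trivial
  · have hpos : 0 < D.length := List.length_pos_iff.2 h
    have hτ' : τ l = D.length := by rw [hτ, max_eq_left hpos]
    simp only [InpOK, SegOK]
    refine ⟨⟨Nat.mul_pos hpos (Nat.pos_of_ne_zero h'), hw ▸ redSeg_lineOf_cyclic hD _ _, ?_,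
      hL.2 h, fun hc => absurd hc hC⟩, trivial⟩
    rw [hτ', Nat.mul_div_cancel_left _ hpos, Nat.zero_div, zero_add]

/-- The items are chosen for the solution exponent `x`, while `y l` varies. For `x = 0` a line has
no item at all, so `y l` has to vanish as well. -/
theorem powItems_val (hτ : τ l = max D.length 1) (hw : w l = lineOf D) (hg : D ≠ [] → g = 1)
    {x : ℕ} {y : ι → ℕ} (hy : D ≠ [] → x = 0 → y l = 0) :
    inpVal φ τ w y (powItems l g D x) = (of g * sylProd φ D) ^ y l := by
  unfold powItems
  split_ifs with h h' h'
  · subst h h'; simp [inpVal]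
  · subst h; simp [inpVal]
  · simp [inpVal, hy h h']
  · have hpos : 0 < D.length := List.length_pos_iff.2 h
    have hτ' : τ l = D.length := by rw [hτ, max_eq_left hpos]
    have hper : ∀ m, lineOf D (m + D.length) = lineOf D m := by
      intro m; have := lineOf_add D m; rwa [max_eq_left hpos] at this
    have hv := lineVal_add_mul (φ := φ) hper 0 x
    rw [zero_add, lineVal_lineOf, mul_comm x] at hv
    simp only [inpVal, sVal, one_mul, segVal, hτ', hw, hv, hg h, lineVal_lineOf, map_one,
      Nat.mul_div_cancel_left _ hpos, Nat.zero_div, lineVal]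
    rw [inv_one, one_mul, mul_one, ← zpow_natCast (sylProd φ D) x, ← zpow_add, ← zpow_natCast]
    congr 1
    simp

theorem powItems_cost (ℓ : G → ℕ) (x : ℕ) : inpCost ℓ (powItems l g D x) ≤ ℓ g := by
  unfold powItems
  split_ifs <;> simp [inpCost]

theorem powItems_segCount (x : ℕ) : segCount (powItems l g D x) ≤ 1 := by
  unfold powItems
  split_ifs <;> simp [segCount]

variable [DecidableEq ι]

open Classical in
theorem powItems_occ (x : ℕ) (l' : ι) :
    inpOcc l' (powItems l g D x) =
      if (D = [] ∧ g ≠ 1 ∨ D ≠ [] ∧ x ≠ 0) ∧ l' = l then 1 else 0 := by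
  unfold powItems
  by_cases h : D = []
  · by_cases h' : g = 1
    · simp [inpOcc, h, h']
    · by_cases hl : l' = l
      · simp [inpOcc, h, h', gOcc, hl]
      · simp [inpOcc, h, h', gOcc, hl, Ne.symm hl]
  · by_cases h' : x = 0 <;> simp [inpOcc, h, h']

end Blocks

end Knapsack

namespace Knapsack

open scoped Pointwise

/-! ### From one solution to a linear set of solutions -/

section Assembly

open HNNExtension

variable {G : Type*} [Group G] {A B : Subgroup G} {ψ : A ≃* B} {Λ : Type*} {σ : Λ → G}

theorem letterVal_symm (ψ : A ≃* B) (hsym : ∀ i, ∃ j, σ j = (σ i)⁻¹) (i : Λ ⊕ Bool) :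
    ∃ j, letterVal ψ σ j = (letterVal ψ σ i)⁻¹ := by
  rcases i with i | (_ | _)
  · obtain ⟨j, hj⟩ := hsym i
    exact ⟨Sum.inl j, by simp [letterVal, hj]⟩
  · exact ⟨Sum.inr true, by simp [letterVal]⟩
  · exact ⟨Sum.inr false, by simp [letterVal]⟩

/-- The powers of a word, in terms of its cyclically reduced conjugate. -/
theorem exists_factor (hgen : Subgroup.closure (Set.range σ) = ⊤)
    (hsym : ∀ i, ∃ j, σ j = (σ i)⁻¹) (hℓ : IsLength A B (glen σ)) (u v : List (Λ ⊕ Bool)) :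
    ∃ (g₀ : G) (C₀ : List (ℤˣ × G)) (g₁ : G) (C₁ : List (ℤˣ × G)) (g₂ : G) (C₂ : List (ℤˣ × G)),
      Red A B C₀ ∧ Red A B (C₁ ++ C₁) ∧ Red A B C₂ ∧ (C₁ ≠ [] → g₁ = 1) ∧
      (∀ n : ℕ, wordVal (letterVal ψ σ) u ^ n * wordVal (letterVal ψ σ) v =
        (of g₀ * sylProd ψ C₀) * (of g₁ * sylProd ψ C₁) ^ n * (of g₂ * sylProd ψ C₂)) ∧
      glen σ g₀ + sylCost (glen σ) C₀ ≤ u.length ∧ glen σ g₁ + sylCost (glen σ) C₁ ≤ u.length ∧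
      glen σ g₂ + sylCost (glen σ) C₂ ≤ u.length + v.length := by
  obtain ⟨g, C, h1, h2, h3⟩ := exists_red (ψ := ψ) hℓ (fun i => glen_gen (σ := σ) i) u
  obtain ⟨W, g₁, C₁, k1, k2, k3, k4, k5⟩ := exists_cyclicallyReduced (ψ := ψ) hℓ
    (exists_word_glen hgen hsym) C.length g C le_rfl h1
  -- The conjugator cancels between consecutive powers; its inverse remains once and is merged with
  -- `v`.
  obtain ⟨W', hW', hWv⟩ := exists_word_inv (letterVal_symm ψ hsym) W
  obtain ⟨g₀, C₀, l1, l2, l3⟩ := exists_red (ψ := ψ) hℓ (fun i => glen_gen (σ := σ) i) W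
  obtain ⟨g₂, C₂, m1, m2, m3⟩ := exists_red (ψ := ψ) hℓ (fun i => glen_gen (σ := σ) i) (W' ++ v)
  refine ⟨g₀, C₀, g₁, C₁, g₂, C₂, l1, k1, m1, k2, fun n => ?_, by omega, by omega, ?_⟩
  · rw [← l2, ← m2, h2, k3, conj_pow, wordVal_append, hWv, mul_assoc _ _ (wordVal _ v)]
  · rw [List.length_append] at m3; omega

theorem isSolution_iff {e : Expr Λ} {x : Fin e.length → ℕ} : x ∈ sol σ e ↔
    ((List.finRange e.length).map fun i =>
      wordVal σ (e.get i).1 ^ x i * wordVal σ (e.get i).2).prod = 1 := by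
  rw [sol, Set.mem_ofPred_eq, List.ofFn_eq_map]

theorem Expr.norm_eq (e : Expr Λ) : e.norm =
    ((List.finRange e.length).map fun i => (e.get i).1.length + (e.get i).2.length).sum := by
  conv_lhs => rw [Expr.norm, ← List.map_get_finRange e, List.map_map]
  rfl

/-- Every solution of a knapsack expression over an HNN-extension lies in a linear set of solutions
of bounded norm. -/
theorem exists_lset_sol [Finite Λ] (hgen : Subgroup.closure (Set.range σ) = ⊤)
    (hsym : ∀ i, ∃ j, σ j = (σ i)⁻¹)
    (hAB : ∀ g : G, g ∈ A ∨ g ∈ B → g ≠ 1 → g ∈ Set.range σ) (hsl : HasSemilinearSolutions σ)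
    {F : Finset G} (hF : ∀ a, a ∈ A ∨ a ∈ B → a ∈ F) (e : Expr (Λ ⊕ Bool)) (he : e.IsKnapsack)
    {x : Fin e.length → ℕ} (hx : x ∈ sol (letterVal ψ σ) e) :
    ∃ b P, x ∈ lset b P ∧ lset b P ⊆ sol (letterVal ψ σ) e ∧
      (∀ i, b i ≤ max (K σ (24 * e.length * e.norm) e.length)
        (6 * e.length * (F.card * (e.norm * e.norm)))) ∧
      ∀ p ∈ P, ∀ i, p i ≤ max (K σ (24 * e.length * e.norm) e.length)
        (6 * e.length * (F.card * (e.norm * e.norm))) := by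
  classical
  have hℓ := isLength_glen hgen hsym hAB
  set n := e.norm with hn
  have hk1 : 1 ≤ e.length := List.length_pos_iff.2 he.1
  have hlen : ∀ i : Fin e.length, (e.get i).1.length + (e.get i).2.length ≤ n := by
    intro i
    exact List.single_le_sum (l := e.map fun q => q.1.length + q.2.length) (by simp) _
      (List.mem_map_of_mem (List.get_mem e i))
  have hn1 : 1 ≤ n := by
    have h1 : 0 < (e.get ⟨0, hk1⟩).1.length :=
      List.length_pos_iff.2 (he.2 _ (List.get_mem e ⟨0, hk1⟩))
    have := hlen ⟨0, hk1⟩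
    omega
  have hF1 : 1 ≤ F.card := Finset.card_pos.2 ⟨1, hF 1 (Or.inl A.one_mem)⟩
  choose g₀ C₀ g₁ C₁ g₂ C₂ hr₀ hr₁ hr₂ hg₁ hfac hc₀ hc₁ hc₂ using
    fun i : Fin e.length => exists_factor (ψ := ψ) hgen hsym hℓ (e.get i).1 (e.get i).2
  -- The index `(i, 1)` carries the `i`-th power; `(i, 0)` and `(i, 2)` carry the constants around
  -- it.
  let Cs : Fin e.length × Fin 3 → List (ℤˣ × G) := fun l => ![C₀ l.1, C₁ l.1, C₂ l.1] l.2
  let τ : Fin e.length × Fin 3 → ℕ := fun l => max (Cs l).length 1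
  let w : Fin e.length × Fin 3 → ℕ → ℤˣ × G := fun l => lineOf (Cs l)
  -- Constants count as lines even without syllables, so every index outside of `L` is of the form
  -- `(i, 1)`.
  let L : Fin e.length × Fin 3 → Prop := fun l => Cs l ≠ [] ∨ l.2 ≠ 1
  let C : Fin e.length × Fin 3 → Prop := fun l => l.2 ≠ 1
  -- Exponents are zero where there is no item. In particular, variables with trivial base are
  -- dropped here and restored at the end.
  let X : Fin e.length × Fin 3 → ℕ := fun l =>
    if l.2 = 1 then if Cs l = [] ∧ g₁ l.1 = 1 then 0 else x l.1 else if Cs l = [] then 0 else 1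
  have hCn : ∀ l, sylCost (glen σ) (Cs l) ≤ n := by
    rintro ⟨i, j⟩
    have := hlen i
    have h0 := hc₀ i
    have h1 := hc₁ i
    have h2 := hc₂ i
    fin_cases j <;> simp only [Cs] <;> simp <;> omega
  let block : Fin e.length → List (Item G (Fin e.length × Fin 3)) := fun i =>
    constItems (i, 2) (g₂ i) (C₂ i) ++ (powItems (i, 1) (g₁ i) (C₁ i) (x i) ++
      constItems (i, 0) (g₀ i) (C₀ i))
  have hblock_ok : ∀ i, InpOK A B τ w L C X (block i) := by
    intro i
    refine InpOK.append (constItems_ok rfl rfl (Or.inr (by simp)) (hr₂ i) ?_)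
      (InpOK.append ?_ (constItems_ok rfl rfl (Or.inr (by simp)) (hr₀ i) ?_))
    · by_cases h : C₂ i = [] <;> simp [X, Cs, h]
    · by_cases hfree : C₁ i = [] ∧ g₁ i = 1
      · simp [powItems, hfree, InpOK]
      · have hXi : x i = X (i, 1) := by simp [X, Cs, hfree]
        rw [hXi]
        exact powItems_ok rfl rfl (by simp [L, Cs]) (by simp [C]) (hr₁ i)
    · by_cases h : C₀ i = [] <;> simp [X, Cs, h]
  have hblock_occ : ∀ i l, inpOcc l (block i) ≤ if l.1 = i then 1 else 0 := by
    rintro i ⟨i', j⟩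
    simp only [block, inpOcc_append, constItems_occ, powItems_occ, Prod.mk.injEq]
    by_cases hi : i' = i
    · subst hi
      fin_cases j <;> simp <;> split_ifs <;> omega
    · simp [hi]
  have hblock_zero : ∀ i l, l.1 = i → inpOcc l (block i) = 0 → X l = 0 := by
    rintro i ⟨i', j⟩ rfl
    simp only [block, inpOcc_append, constItems_occ, powItems_occ, Prod.mk.injEq, true_and]
    fin_cases j
    · by_cases h : C₀ i' = [] <;> simp [X, Cs, h]
    · by_cases h : C₁ i' = [] <;> by_cases h' : g₁ i' = 1 <;> simp [X, Cs, h, h']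
    · by_cases h : C₂ i' = [] <;> simp [X, Cs, h]
  have hblock_cost : ∀ i, inpCost (glen σ) (block i) ≤
      3 * ((e.get i).1.length + (e.get i).2.length) := by
    intro i
    simp only [block, inpCost_append, constItems_cost]
    have := powItems_cost (l := (i, (1 : Fin 3))) (g := g₁ i) (D := C₁ i) (glen σ) (x i)
    have h0 := hc₀ i
    have h1 := hc₁ i
    have h2 := hc₂ i
    omega
  have hblock_seg : ∀ i, segCount (block i) ≤ 3 := by
    intro i
    simp only [block, segCount_append]
    have := powItems_segCount (l := (i, (1 : Fin 3))) (g := g₁ i) (D := C₁ i) (x i)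
    have h0 := constItems_segCount (l := (i, (0 : Fin 3))) (g := g₀ i) (D := C₀ i)
    have h2 := constItems_segCount (l := (i, (2 : Fin 3))) (g := g₂ i) (D := C₂ i)
    omega
  have hblock_val : ∀ (y : Fin e.length × Fin 3 → ℕ) i, (∀ l, l.2 ≠ 1 → y l = X l) →
      (∀ l, inpOcc l (block l.1) = 0 → y l = 0) →
      inpVal ψ τ w y (block i) = (of (g₀ i) * sylProd ψ (C₀ i)) *
        (of (g₁ i) * sylProd ψ (C₁ i)) ^ y (i, 1) * (of (g₂ i) * sylProd ψ (C₂ i)) := by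
    intro y i hy hy0
    simp only [block, inpVal_append]
    have h0 : y (i, 0) = if C₀ i = [] then 0 else 1 := by
      rw [hy _ (by simp)]; by_cases h : C₀ i = [] <;> simp [X, Cs, h]
    have h2 : y (i, 2) = if C₂ i = [] then 0 else 1 := by
      rw [hy _ (by simp)]; by_cases h : C₂ i = [] <;> simp [X, Cs, h]
    rw [constItems_val (l := (i, (0 : Fin 3))) rfl rfl h0,
      constItems_val (l := (i, (2 : Fin 3))) rfl rfl h2,
      powItems_val (l := (i, (1 : Fin 3))) rfl rfl (hg₁ i)]
    intro hne hx0
    apply hy0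
    simp [block, inpOcc_append, constItems_occ, powItems_occ, hne, hx0]
  -- Lists of items have the rightmost item as their head, hence the reversal.
  let inp := fun l : List (Fin e.length) => l.reverse.flatMap block
  have hinp : ∀ l : List (Fin e.length), InpOK A B τ w L C X (inp l) ∧
      (∀ l', inpOcc l' (inp l) = (l.map fun i => inpOcc l' (block i)).sum) ∧
      inpCost (glen σ) (inp l) ≤
        3 * (l.map fun i => (e.get i).1.length + (e.get i).2.length).sum ∧
      segCount (inp l) ≤ 3 * l.length ∧
      ∀ y, inpVal ψ τ w y (inp l) = (l.map fun i => inpVal ψ τ w y (block i)).prod := by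
    intro l
    induction l with
    | nil => simp [inp, InpOK, inpOcc, inpCost, segCount, inpVal]
    | cons i l ih =>
      obtain ⟨h1, h2, h3, h4, h5⟩ := ih
      have hc : inp (i :: l) = inp l ++ block i := by simp [inp]
      rw [hc]
      refine ⟨h1.append (hblock_ok i), fun l' => ?_, ?_, ?_, fun y => ?_⟩
      · rw [inpOcc_append, h2]; simp [add_comm]
      · have := hblock_cost i
        rw [inpCost_append]; simp only [List.map_cons, List.sum_cons]; omega
      · have := hblock_seg i
        rw [segCount_append, List.length_cons]; omega
      · rw [inpVal_append, h5]; simp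
  obtain ⟨i1, i2, i3, i4, i5⟩ := hinp (List.finRange e.length)
  set I := inp (List.finRange e.length) with hI
  rw [← Expr.norm_eq, ← hn] at i3
  rw [List.length_finRange] at i4
  have hocc_block : ∀ l, inpOcc l I = inpOcc l (block l.1) := by
    intro l
    rw [i2, ← List.ofFn_eq_map, List.sum_ofFn, Finset.sum_eq_single l.1]
    · intro i _ hi
      have := hblock_occ i l
      rw [if_neg (Ne.symm hi)] at this
      omega
    · simp
  have hocc1 : ∀ l, inpOcc l I ≤ 1 := fun l => by
    have := hblock_occ l.1 l
    rw [if_pos rfl] at this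
    rw [hocc_block]; exact this
  have hXval : inpVal ψ τ w X I = 1 := by
    rw [i5, ← isSolution_iff.1 hx]
    congr 1
    refine List.map_congr_left fun i _ => ?_
    rw [hblock_val X i (fun _ _ => rfl) (fun l hl => hblock_zero _ l rfl hl), hfac]
    by_cases hfree : C₁ i = [] ∧ g₁ i = 1
    · simp [hfree]
    · have hXi : X (i, 1) = x i := by simp [X, Cs, hfree]
      rw [hXi]
  have hface : ∀ (γ : List (G × Option (Fin e.length × Fin 3))) (x : Fin e.length × Fin 3 → ℕ),
      GOK L γ →
      (gvars γ).Nodup → gcost (glen σ) γ + glen σ (gval x γ) ≤ 24 * e.length * n →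
      Deform L C (K σ (24 * e.length * n) e.length) (F.card * (n * n)) (fun l => gOcc l γ) 0
        (fun l => if gOcc l γ = 0 then 0 else x l) fun y => gval y γ = gval x γ := by
    intro γ x hγ hnd hcost
    have hvars : ∀ l ∈ gvars γ, ¬ L l := fun l hl => hγ.not_of_mem hl
    -- Variables outside of `L` are determined by their first component, so the degree over `G` does
    -- not exceed that of `e`.
    have hm : (gvars γ).length ≤ e.length := by
      have h1 : ((gvars γ).map Prod.fst).Nodup := by
        refine hnd.map_on ?_
        rintro ⟨i, j⟩ hl ⟨i', j'⟩ hl' rfl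
        have h1 := hvars _ hl
        have h2 := hvars _ hl'
        simp only [L, not_or, not_not] at h1 h2
        rw [h1.2, h2.2]
      have := h1.length_le_card
      simpa using this
    obtain ⟨b, P, f1, f2, f3, f4, f5⟩ := exists_lset_gval hgen hsym hAB hsl γ (by
      intro a ha ha'
      obtain ⟨i, hi⟩ := Option.ne_none_iff_exists'.1 ha'
      exact (hγ a ha i hi).1) hnd x hcost hm
    have hz : ∀ l, gOcc l γ = 0 ↔ l ∉ gvars γ := fun l => by
      unfold gOcc
      convert List.count_eq_zero (a := l) (l := gvars γ)
    refine ⟨b, P, ?_, f2, fun l hl => ?_, fun l _ => ⟨f3 l, fun p hp => f4 p hp l⟩,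
      fun l hl => f5 l ((hz l).1 hl)⟩
    · convert! f1 using 2 with l
      by_cases h : l ∈ gvars γ <;> simp [hz, h]
    · obtain ⟨h1, h2⟩ := f5 l fun h => hvars l h hl
      exact ⟨h1.le, fun p hp => by simp [h2 p hp]⟩
  have hkn : n ≤ e.length * n := Nat.le_mul_of_pos_left _ hk1
  have hdef := exists_deform (φ := ψ) (τ := τ) (w := w) (L := L) (C := C)
    (κ := K σ (24 * e.length * n) e.length) (β := F.card * (n * n)) (D := n) (T := n)
    (Λ := 24 * e.length * n) hℓ
    (fun l _ => by simp [τ]) (fun l _ m => lineOf_add (Cs l) m)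
    (fun l _ m => lineOf_cost hℓ.one _ hn1 (hCn l) m)
    (fun l _ => max_le ((length_le_sylCost _ _).trans (hCn l)) hn1) hF le_rfl le_rfl hface
    _ I [] [] X le_rfl (fun l => by simpa [gOcc_nil, stOcc] using hocc1 l) i1 (by simp [GOK])
    trivial
    (fun l hl => by
      simp only [gOcc_nil, stOcc, add_zero] at hl
      rw [hocc_block] at hl
      exact hblock_zero _ l rfl hl)
    (by
      -- The budget is `3 * n` for the constants, `n` for each of at most `6 * e.length` strips, and
      -- a further `n`.
      have := Nat.mul_le_mul_right n (show 2 * segCount I + 0 ≤ 6 * e.length by omega)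
      simp only [gcost_nil, stCost, List.length_nil]
      have h6 : 24 * e.length * n = 6 * e.length * n + 18 * (e.length * n) := by ring
      omega)
    (by simpa [stVal] using hXval)
  obtain ⟨b, P, d1, d2, d3, d4, d5⟩ := hdef
  have hM : ∀ l : Fin e.length × Fin 3,
      b l ≤ max (K σ (24 * e.length * n) e.length) (6 * e.length * (F.card * (n * n))) ∧
      ∀ p ∈ P, p l ≤
        max (K σ (24 * e.length * n) e.length) (6 * e.length * (F.card * (n * n))) := by
    intro l
    by_cases hl : L l
    · obtain ⟨h1, h2⟩ := d3 l hl
      refine ⟨h1.trans (le_max_of_le_right (Nat.mul_le_mul_right _ ?_)),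
        fun p hp => (h2 p hp).1.trans (le_max_of_le_right (Nat.le_mul_of_pos_left _ ?_))⟩
      · simp only [List.length_nil]; omega
      · omega
    · obtain ⟨h1, h2⟩ := d4 l hl
      exact ⟨h1.trans (le_max_left _ _), fun p hp => (h2 p hp).trans (le_max_left _ _)⟩
  -- Only the coordinates of the powers are kept. A variable with trivial base is unconstrained and
  -- gets a unit vector as a period.
  let f : (Fin e.length × Fin 3 → ℕ) →+ (Fin e.length → ℕ) :=
    { toFun := fun y i => y (i, 1)
      map_zero' := rfl
      map_add' := fun _ _ => rfl }
  let free : List (Fin e.length) := (List.finRange e.length).filter fun i => C₁ i = [] ∧ g₁ i = 1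
  have hfree : ∀ i, i ∈ free ↔ C₁ i = [] ∧ g₁ i = 1 := by simp [free]
  refine ⟨f b + 0, P.map f ++ free.map fun i => Pi.single i 1, ?_, ?_, ?_, ?_⟩
  · refine mem_lset_append.2 ⟨f X, by rw [← image_lset]; exact ⟨X, d1, rfl⟩,
      fun i => if i ∈ free then x i else 0, ?_, ?_⟩
    · refine mem_lset.2 ⟨_, ?_, zero_add _⟩
      have : (fun i => if i ∈ free then x i else 0) =
          ∑ i, (if i ∈ free then x i else 0) • (Pi.single i 1 : Fin e.length → ℕ) := by
        funext j
        rw [Finset.sum_apply, Finset.sum_eq_single j]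
        · simp
        · intro i _ hi
          simp [Pi.single_eq_of_ne hi.symm]
        · simp
      rw [this]
      refine AddSubmonoid.sum_mem _ fun i _ => ?_
      split_ifs with hi
      · have hm : (Pi.single i 1 : Fin e.length → ℕ) ∈
            {p | p ∈ free.map fun i => (Pi.single i 1 : Fin e.length → ℕ)} :=
          List.mem_map_of_mem (f := fun i => (Pi.single i 1 : Fin e.length → ℕ)) hi
        exact nsmul_mem (AddSubmonoid.subset_closure hm) _
      · rw [zero_smul]; exact AddSubmonoid.zero_mem _
    · funext i
      simp only [Pi.add_apply, hfree, f, X, AddMonoidHom.coe_mk, ZeroHom.coe_mk, Cs]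
      by_cases h : C₁ i = [] ∧ g₁ i = 1 <;> simp [h]
  · intro y hy
    obtain ⟨y₁, hy₁, z, hz, rfl⟩ := mem_lset_append.1 hy
    rw [← image_lset] at hy₁
    obtain ⟨Y, hY, rfl⟩ := hy₁
    have hzi : ∀ i, ¬ (C₁ i = [] ∧ g₁ i = 1) → z i = 0 := by
      intro i hi
      rw [lset_apply_eq hz]
      · rfl
      · intro p hp
        obtain ⟨j, hj, rfl⟩ := List.mem_map.1 hp
        refine Pi.single_eq_of_ne ?_ _
        rintro rfl
        exact hi ((hfree i).1 hj)
    have hYv := d2 Y hY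
    simp only [stVal, gval_nil, map_one, mul_one] at hYv
    rw [i5] at hYv
    rw [isSolution_iff, ← hYv]
    congr 1
    refine List.map_congr_left fun i _ => ?_
    rw [hblock_val Y i, hfac]
    · by_cases h : C₁ i = [] ∧ g₁ i = 1
      · simp [h]
      · have : (f Y + z) i = Y (i, 1) := by simp [hzi i h, f]
        rw [this]
    -- At the indices of constants all periods vanish, so `Y` and `X` both agree with the base
    -- vector there.
    · intro l hl
      have hL : L l := Or.inr hl
      rw [lset_apply_eq hY fun p hp => ((d3 l hL).2 p hp).2 hl,
        lset_apply_eq d1 fun p hp => ((d3 l hL).2 p hp).2 hl]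
    · intro l hl
      have hl' : inpOcc l I + gOcc l ([] : List (G × Option (Fin e.length × Fin 3))) +
          stOcc l ([] : List (Seg (Fin e.length × Fin 3) ×
            List (G × Option (Fin e.length × Fin 3)))) = 0 := by
        rw [hocc_block, hl]; rfl
      rw [lset_apply_eq hY (d5 l hl').2, (d5 l hl').1]
  · intro i
    rw [add_zero]
    exact (hM (i, 1)).1
  · intro p hp i
    rcases List.mem_append.1 hp with hp | hp
    · obtain ⟨q, hq, rfl⟩ := List.mem_map.1 hp
      exact (hM (i, 1)).2 q hq
    · obtain ⟨j, -, rfl⟩ := List.mem_map.1 hp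
      have h1 : (Pi.single j 1 : Fin e.length → ℕ) i ≤ 1 := by
        rw [Pi.single_apply]; split_ifs <;> simp
      have h2 : 0 < 6 * e.length * (F.card * (n * n)) :=
        Nat.mul_pos (Nat.mul_pos (by norm_num) hk1) (Nat.mul_pos hF1 (Nat.mul_pos hn1 hn1))
      exact h1.trans (le_max_of_le_right h2)

end Assembly

end Knapsack

namespace Knapsack

open scoped Pointwise

/-! ### Semilinearity and the magnitude bound for the HNN-extension -/

section PartOne

variable {G : Type*} [Group G] {A B : Subgroup G} {Λ : Type*} {σ : Λ → G}

/-- The bound for the magnitude of the solution set of a knapsack expression over the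
HNN-extension. -/
theorem exists_rep_sol_hnnGen [Finite Λ] [Finite A] (φ : A ≃* B)
    (hgen : Subgroup.closure (Set.range σ) = ⊤) (hsym : ∀ i, ∃ j, σ j = (σ i)⁻¹)
    (hAB : ∀ g : G, g ∈ A ∨ g ∈ B → g ≠ 1 → g ∈ Set.range σ) (hsl : HasSemilinearSolutions σ)
    (e : Expr (Λ ⊕ Bool)) (he : e.IsKnapsack) :
    ∃ R : SemilinearRep e.length, R.toSet = sol (hnnGen φ σ) e ∧
      R.norm ≤ max (K σ (24 * e.length * e.norm) e.length)
        (12 * (Nat.card A ^ 2 * e.length * e.norm ^ 4)) := by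
  classical
  have : Finite B := Finite.of_equiv A φ.toEquiv
  have hA : (A : Set G).Finite := Set.toFinite _
  have hB : (B : Set G).Finite := Set.toFinite _
  set γ := Nat.card A with hγ
  have hγ1 : 1 ≤ γ := Nat.card_pos
  have hcard : (hA.toFinset ∪ hB.toFinset).card ≤ 2 * γ := by
    refine (Finset.card_union_le _ _).trans ?_
    have h1 : hA.toFinset.card = γ := by
      rw [← Set.ncard_eq_toFinset_card _ hA]; rfl
    have h2 : hB.toFinset.card = γ := by
      rw [← Set.ncard_eq_toFinset_card _ hB, hγ, Nat.card_congr φ.toEquiv]; rfl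
    omega
  -- The argument yields `12 * γ * e.length * e.norm ^ 2`, which is relaxed to the stated form.
  have hle : 6 * e.length * ((hA.toFinset ∪ hB.toFinset).card * (e.norm * e.norm)) ≤
      12 * (γ ^ 2 * e.length * e.norm ^ 4) := by
    calc _ ≤ 6 * e.length * (2 * γ * (e.norm * e.norm)) := by gcongr
      _ = 12 * (γ * e.length * e.norm ^ 2) := by ring
      _ ≤ _ := by
        gcongr 12 * (?_ * e.length * ?_)
        · exact Nat.le_self_pow (by norm_num) γ
        · rcases Nat.eq_zero_or_pos e.norm with h | h
          · simp [h]
          · exact Nat.pow_le_pow_right h (by norm_num)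
  refine exists_rep_of_local fun x hx => ?_
  -- The extension is taken along `φ.symm`, so `A` and `B` change places in the hypotheses below.
  rw [hnnGen_eq_letterVal] at hx ⊢
  obtain ⟨b, P, h1, h2, h3, h4⟩ := exists_lset_sol (F := hA.toFinset ∪ hB.toFinset) hgen hsym
    (fun g hg => hAB g hg.symm) hsl (fun a ha => by simpa [or_comm] using ha) e he hx
  have hmax := max_le_max_left (K σ (24 * e.length * e.norm) e.length) hle
  exact ⟨b, P, h1, h2, fun i => (h3 i).trans hmax, fun p hp i => (h4 p hp i).trans hmax⟩

theorem hasSemilinearSolutions_hnnGen [Finite Λ] [Finite A] (φ : A ≃* B)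
    (hgen : Subgroup.closure (Set.range σ) = ⊤) (hsym : ∀ i, ∃ j, σ j = (σ i)⁻¹)
    (hAB : ∀ g : G, g ∈ A ∨ g ∈ B → g ≠ 1 → g ∈ Set.range σ) (hsl : HasSemilinearSolutions σ) :
    HasSemilinearSolutions (hnnGen φ σ) := fun e he =>
  let ⟨R, hR, _⟩ := exists_rep_sol_hnnGen φ hgen hsym hAB hsl e he
  (isSemilinearSet_iff_exists_rep _).2 ⟨R, hR⟩

theorem K_hnnGen_le [Finite Λ] [Finite A] (φ : A ≃* B)
    (hgen : Subgroup.closure (Set.range σ) = ⊤) (hsym : ∀ i, ∃ j, σ j = (σ i)⁻¹)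
    (hAB : ∀ g : G, g ∈ A ∨ g ∈ B → g ≠ 1 → g ∈ Set.range σ) (hsl : HasSemilinearSolutions σ)
    (n m : ℕ) :
    K (hnnGen φ σ) n m ≤
      max (K σ (24 * m * n) m) (12 * (Nat.card A ^ 2 * m * n ^ 4)) := by
  refine K_le fun e ⟨he, _, hn, hm⟩ => ?_
  obtain ⟨R, hR, hle⟩ := exists_rep_sol_hnnGen φ hgen hsym hAB hsl e he
  refine (mag_le_of_rep hR).trans (hle.trans (max_le_max (K_mono ?_ hm) ?_)) <;> gcongr

end PartOne

end Knapsack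

namespace Knapsack

open scoped Pointwise

/-! ### Small witnesses for the difference of semilinear sets -/

section Witness

open Finset

/-- If the sets `W s` can be recognized from the binary digits of their elements by the finite
automaton `δ`, then every nonempty `W s` has a small element. -/
theorem exists_mem_lt_two_pow {d : ℕ} {Q : Type*} [Fintype Q] (W : Q → Set (Fin d → ℕ))
    (δ : Q → (Fin d → ℕ) → Q)
    (hδ : ∀ s ε y, (∀ i, ε i ≤ 1) → ((fun i => 2 * y i + ε i) ∈ W s ↔ y ∈ W (δ s ε)))
    {s : Q} (hs : (W s).Nonempty) : ∃ y ∈ W s, ∀ i, y i < 2 ^ Fintype.card Q := by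
  classical
  let P : Q → ℕ → Prop := fun s n => ∃ y ∈ W s, ∀ i, y i < 2 ^ n
  -- Without its lowest digits, a shortest element for `s` is a shortest element for the next state.
  -- So each digit count up to the minimum is the minimum of some state.
  have key : ∀ n s, P s n → (∀ j < n, ¬ P s j) → ∀ j ≤ n, ∃ s', P s' j ∧ ∀ i < j, ¬ P s' i := by
    intro n
    induction n with
    | zero =>
      intro s h _ j hj
      obtain rfl : j = 0 := by omega
      exact ⟨s, h, by simp⟩
    | succ n ih =>
      rintro s ⟨y, hy, hlt⟩ hmin j hj
      rcases Nat.lt_or_ge n j with hnj | hjn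
      · obtain rfl : j = n + 1 := by omega
        exact ⟨s, ⟨y, hy, hlt⟩, hmin⟩
      · have hbit : (fun i => 2 * (y i / 2) + y i % 2) = y := by
          funext i; exact Nat.div_add_mod _ _
        have hε : ∀ i, y i % 2 ≤ 1 := fun i => by omega
        refine ih (δ s fun i => y i % 2) ⟨fun i => y i / 2, ?_, fun i => ?_⟩ ?_ j hjn
        · rw [← hδ s _ _ hε, hbit]; exact hy
        · have := hlt i
          rw [pow_succ] at this
          change y i / 2 < 2 ^ n
          omega
        · rintro i hi ⟨z, hz, hz'⟩
          refine hmin (i + 1) (by omega) ⟨_, (hδ s _ z hε).2 hz, fun l => ?_⟩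
          have := hz' l
          have := hε l
          rw [pow_succ]
          omega
  obtain ⟨y, hy⟩ := hs
  have hex : ∃ n, P s n := ⟨∑ i, y i, y, hy, fun i =>
    (single_le_sum (fun _ _ => Nat.zero_le _) (mem_univ i)).trans_lt Nat.lt_two_pow_self⟩
  have hall := key (Nat.find hex) s (Nat.find_spec hex) fun j hj => Nat.find_min hex hj
  choose f hf using fun j : Fin (Nat.find hex + 1) => hall j (by omega)
  -- States with different minimal digit counts are different, so the minimum is less than the
  -- number of states.
  have hinj : Function.Injective f := by
    intro j j' h
    by_contra hne
    rcases lt_or_gt_of_ne hne with hlt | hlt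
    · exact (hf j').2 j hlt (h ▸ (hf j).1)
    · exact (hf j).2 j' hlt (h ▸ (hf j').1)
  have hcard := Fintype.card_le_of_injective f hinj
  rw [Fintype.card_fin] at hcard
  obtain ⟨z, hz, hz'⟩ := Nat.find_spec hex
  exact ⟨z, hz, fun i => (hz' i).trans_le (Nat.pow_le_pow_right (by norm_num) (by omega))⟩

/-- A bound for the entries of the base vectors that arise from vectors with entries at most `N`. -/
def baseBound (d N : ℕ) : ℕ := (N + 1) ^ d * N

/-- The pairs of a base vector and a set of periods with bounded entries. -/
abbrev BoundedPair (d N : ℕ) : Type :=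
  (Fin d → Fin (baseBound d N + 1)) × Finset (Fin d → Fin (N + 1))

/-- The linear set given by a bounded pair. -/
def BoundedPair.toSet {d N : ℕ} (q : BoundedPair d N) : Set (Fin d → ℕ) :=
  {y | ∃ n : (Fin d → Fin (N + 1)) → ℕ, ∀ i, y i = q.1 i + ∑ p ∈ q.2, n p * p i}

/-- The pairs for the set of all `y` such that `2 * y + ε` lies in one of the given linear sets. -/
def halve {d N : ℕ} (X : Set (BoundedPair d N)) (ε : Fin d → ℕ) : Set (BoundedPair d N) :=
  {q' | ∃ q ∈ X, q'.2 = q.2 ∧ ∃ ρ ⊆ q.2, ∀ i, 2 * (q'.1 i : ℕ) + ε i = q.1 i + ∑ p ∈ ρ, (p i : ℕ)}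

theorem mem_biUnion_halve {d N : ℕ} (X : Set (BoundedPair d N)) (ε y : Fin d → ℕ)
    (hε : ∀ i, ε i ≤ 1) :
    (fun i => 2 * y i + ε i) ∈ ⋃ q ∈ X, q.toSet ↔ y ∈ ⋃ q ∈ halve X ε, q.toSet := by
  classical
  simp only [Set.mem_iUnion, exists_prop]
  constructor
  · rintro ⟨⟨c, P⟩, hq, n, hn⟩
    simp only at hn
    -- Halving the coefficients leaves over one copy of each period with odd coefficient; these
    -- copies move into the base.
    set ρ := P.filter fun p => n p % 2 = 1 with hρ
    have hsum : ∀ i, ∑ p ∈ P, n p * (p i : ℕ) =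
        2 * ∑ p ∈ P, n p / 2 * (p i : ℕ) + ∑ p ∈ ρ, (p i : ℕ) := by
      intro i
      rw [hρ, sum_filter, mul_sum, ← sum_add_distrib]
      refine sum_congr rfl fun p _ => ?_
      split_ifs with h
      · conv_lhs => rw [← Nat.div_add_mod (n p) 2, h]
        ring
      · have h0 : n p % 2 = 0 := by omega
        conv_lhs => rw [← Nat.div_add_mod (n p) 2, h0]
        ring
    -- There are at most `(N + 1) ^ d` periods with entries up to `N`. Twice the new base is thus at
    -- most twice `baseBound`, and the bound persists.
    have hρle : ∀ i, ∑ p ∈ ρ, (p i : ℕ) ≤ baseBound d N := by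
      intro i
      refine (sum_le_card_nsmul _ _ N fun p _ => Nat.lt_succ_iff.1 (p i).2).trans ?_
      rw [smul_eq_mul, baseBound]
      refine Nat.mul_le_mul_right _ ((card_le_univ _).trans ?_)
      simp
    have hc' : ∀ i, y i - ∑ p ∈ P, n p / 2 * (p i : ℕ) < baseBound d N + 1 := by
      intro i
      have h1 := hn i
      have h2 := hρle i
      have h3 := (c i).2
      rw [hsum] at h1
      omega
    refine ⟨(fun i => ⟨_, hc' i⟩, P), ⟨(c, P), hq, rfl, ρ, filter_subset _ _, fun i => ?_⟩,
      fun p => n p / 2, fun i => ?_⟩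
    · have h1 := hn i
      have h2 := hε i
      rw [hsum] at h1
      simp only
      omega
    · have h1 := hn i
      have h2 := hε i
      rw [hsum] at h1
      simp only
      omega
  · rintro ⟨⟨c', P'⟩, ⟨⟨c, P⟩, hq, hP, ρ, hρ, hc⟩, n, hn⟩
    obtain rfl : P' = P := hP
    refine ⟨(c, P'), hq, fun p => 2 * n p + if p ∈ ρ then 1 else 0, fun i => ?_⟩
    have h1 := hn i
    have h2 := hc i
    simp only at h1 h2 hρ ⊢
    have h3 : ∑ p ∈ P', (2 * n p + if p ∈ ρ then 1 else 0) * (p i : ℕ) =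
        2 * ∑ p ∈ P', n p * (p i : ℕ) + ∑ p ∈ ρ, (p i : ℕ) := by
      rw [← inter_eq_right.2 hρ, ← filter_mem_eq_inter, sum_filter, mul_sum, ← sum_add_distrib]
      refine sum_congr rfl fun p hp => ?_
      simp only [mem_filter, hp, true_and]
      split_ifs <;> ring
    rw [h3, h1, mul_add]
    omega

/-- A bound for a witness of the difference of two semilinear sets of norm at most `N`. -/
def witnessBound (d N : ℕ) : ℕ :=
  2 ^ (2 ^ ((baseBound d N + 1) ^ d * 2 ^ ((N + 1) ^ d)) *
    2 ^ ((baseBound d N + 1) ^ d * 2 ^ ((N + 1) ^ d)))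

theorem exists_boundedPair {d N : ℕ} {b : Fin d → ℕ} {P : List (Fin d → ℕ)} (hb : ∀ i, b i ≤ N)
    (hP : ∀ p ∈ P, ∀ i, p i ≤ N) : ∃ q : BoundedPair d N, q.toSet = lset b P := by
  classical
  have hN : N ≤ baseBound d N := Nat.le_mul_of_pos_left _ (by positivity)
  let f : (Fin d → Fin (N + 1)) → Fin d → ℕ := fun p i => p i
  have hf : Function.Injective f := fun p p' h => by
    funext i; exact Fin.ext (congrFun h i)
  refine ⟨(fun i => ⟨b i, by have := hb i; omega⟩, univ.filter fun p => f p ∈ P), ?_⟩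
  have hset : ({p | p ∈ P} : Set (Fin d → ℕ)) =
      ((univ.filter fun p => f p ∈ P).image f : Finset _) := by
    ext p
    simp only [coe_image, coe_filter, mem_univ, true_and, Set.mem_image, Set.mem_ofPred_eq]
    constructor
    · intro hp
      have : f (fun i => ⟨p i, Nat.lt_succ_of_le (hP p hp i)⟩) = p := rfl
      exact ⟨_, this.symm ▸ hp, this⟩
    · rintro ⟨q, hq, rfl⟩; exact hq
  ext y
  rw [mem_lset, hset]
  simp only [BoundedPair.toSet, Set.mem_ofPred_eq]
  constructor
  · rintro ⟨n, hn⟩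
    refine ⟨fun i => ∑ p ∈ univ.filter fun p => f p ∈ P, n p * p i, ?_, ?_⟩
    · have : (fun i => ∑ p ∈ univ.filter fun p => f p ∈ P, n p * (p i : ℕ)) =
          ∑ p ∈ univ.filter fun p => f p ∈ P, n p • f p := by
        funext i; simp [f, Finset.sum_apply]
      rw [this]
      exact sum_mem fun p hp => nsmul_mem (AddSubmonoid.subset_closure (mem_image_of_mem f hp)) _
    · funext i; exact (hn i).symm
  · rintro ⟨z, hz, rfl⟩
    obtain ⟨n, -, rfl⟩ := AddSubmonoid.mem_closure_finset.1 hz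
    refine ⟨fun p => n (f p), fun i => ?_⟩
    rw [sum_image hf.injOn]
    simp [f, Finset.sum_apply]

/-- A linear set that is not contained in a semilinear set contains a small point outside of it. -/
theorem exists_mem_lt_witnessBound {d N : ℕ} {b : Fin d → ℕ} {P : List (Fin d → ℕ)}
    {R : SemilinearRep d} (hb : ∀ i, b i ≤ N) (hP : ∀ p ∈ P, ∀ i, p i ≤ N) (hR : R.norm ≤ N)
    (h : ¬ lset b P ⊆ R.toSet) : ∃ y ∈ lset b P, y ∉ R.toSet ∧ ∀ i, y i < witnessBound d N := by
  classical
  obtain ⟨q, hq⟩ := exists_boundedPair hb hP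
  have hU : ⋃ q ∈ {q : BoundedPair d N | q.toSet ⊆ R.toSet}, q.toSet = R.toSet := by
    refine Set.Subset.antisymm (Set.iUnion₂_subset fun q hq => hq) fun x hx => ?_
    obtain ⟨⟨b', P'⟩, hmem, hx⟩ := SemilinearRep.mem_toSet.1 hx
    obtain ⟨h1, h2⟩ := SemilinearRep.norm_le_iff.1 hR _ hmem
    obtain ⟨q', hq'⟩ := exists_boundedPair h1 h2
    refine Set.mem_iUnion₂.2 ⟨q', ?_, hq' ▸ hx⟩
    intro z hz
    exact SemilinearRep.mem_toSet.2 ⟨_, hmem, hq' ▸ hz⟩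
  -- A state consists of two sets of bounded pairs, one for each side of the difference. Since
  -- `halve` tracks all choices of `ρ` at once, the automaton is deterministic.
  let W : Set (BoundedPair d N) × Set (BoundedPair d N) → Set (Fin d → ℕ) := fun s =>
    (⋃ q ∈ s.1, q.toSet) \ ⋃ q ∈ s.2, q.toSet
  have hW : W ({q}, {q : BoundedPair d N | q.toSet ⊆ R.toSet}) = lset b P \ R.toSet := by
    simp only [W, hU]
    simp [hq]
  obtain ⟨y, hy, hlt⟩ := exists_mem_lt_two_pow W (fun s ε => (halve s.1 ε, halve s.2 ε))
    (fun s ε y hε => by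
      simp only [W, Set.mem_sdiff, mem_biUnion_halve _ ε y hε])
    (s := ({q}, {q : BoundedPair d N | q.toSet ⊆ R.toSet}))
    (by rw [hW]; exact Set.sdiff_nonempty.2 h)
  rw [hW] at hy
  refine ⟨y, hy.1, hy.2, fun i => ?_⟩
  have hcard : Fintype.card (Set (BoundedPair d N) × Set (BoundedPair d N)) =
      2 ^ ((baseBound d N + 1) ^ d * 2 ^ ((N + 1) ^ d)) *
        2 ^ ((baseBound d N + 1) ^ d * 2 ^ ((N + 1) ^ d)) := by
    simp [Fintype.card_set]
  rw [witnessBound, ← hcard]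
  exact hlt i

end Witness

end Knapsack

namespace Knapsack

open scoped Pointwise

/-! ### Computability of list operations -/

section Computability

variable {α β γ τ : Type*} [Primcodable α] [Primcodable β] [Primcodable γ] [Primcodable τ]

/-- Recursion on `n` computes the fold over the first `n` entries. -/
theorem computable_list_foldl {f : α → List β} {g : α → τ} {h : α → τ × β → τ}
    (hf : Computable f) (hg : Computable g) (hh : Computable₂ h) :
    Computable fun a => (f a).foldl (fun s b => h a (s, b)) (g a) := by
  have hstep : Computable₂ fun (a : α) (p : ℕ × τ) =>
      (Option.casesOn ((f a)[p.1]?) p.2 fun b => h a (p.2, b) : τ) := by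
    refine Computable.option_casesOn
      (Computable.list_getElem?.comp (hf.comp .fst) (Computable.fst.comp .snd))
      (Computable.snd.comp .snd) ?_
    exact hh.comp (Computable.fst.comp .fst)
      (((Computable.snd.comp .snd).comp .fst).pair .snd)
  refine (Computable.nat_rec (Computable.list_length.comp hf) hg hstep).of_eq fun a => ?_
  have key : ∀ n ≤ (f a).length, (Nat.rec (g a) (fun y IH => (Option.casesOn ((f a)[y]?) IH
      fun b => h a (IH, b) : τ)) n : τ) = ((f a).take n).foldl (fun s b => h a (s, b)) (g a) := by
    intro n
    induction n with
    | zero => intro _; simp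
    | succ n ih =>
      intro hn
      have hn' : n < (f a).length := hn
      simp only [ih hn'.le, List.getElem?_eq_getElem hn']
      rw [List.take_succ_eq_append_getElem hn', List.foldl_append]
      rfl
  simpa using key _ le_rfl

theorem computable_list_foldr {f : α → List β} {g : α → τ} {h : α → β × τ → τ}
    (hf : Computable f) (hg : Computable g) (hh : Computable₂ h) :
    Computable fun a => (f a).foldr (fun b s => h a (b, s)) (g a) := by
  refine (computable_list_foldl (h := fun a p => h a (p.2, p.1)) (Computable.list_reverse.comp hf)
    hg (hh.comp .fst ((Computable.snd.comp .snd).pair (Computable.fst.comp .snd)))).of_eq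
    fun a => ?_
  rw [List.foldl_reverse]

theorem computable_list_flatMap {f : α → List β} {g : α → β → List γ} (hf : Computable f)
    (hg : Computable₂ g) : Computable fun a => (f a).flatMap (g a) := by
  refine (computable_list_foldr (h := fun a p => g a p.1 ++ p.2) hf (Computable.const [])
    (Computable.list_append.comp (hg.comp .fst (Computable.fst.comp .snd))
      (Computable.snd.comp .snd))).of_eq fun a => ?_
  induction f a with
  | nil => rfl
  | cons b l ih => rw [List.foldr_cons, ih, List.flatMap_cons]

end Computability

/-! ### Enumerations -/

section Enumeration

open Primrec

/-- All lists of length at most `n` with entries from `L`. -/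
def listsUpTo {α : Type*} (L : List α) : ℕ → List (List α)
  | 0 => [[]]
  | n + 1 => [] :: L.flatMap fun a => (listsUpTo L n).map (a :: ·)

theorem mem_listsUpTo {α : Type*} {L : List α} {n : ℕ} {v : List α} :
    v ∈ listsUpTo L n ↔ v.length ≤ n ∧ ∀ a ∈ v, a ∈ L := by
  induction n generalizing v with
  | zero =>
    simp only [listsUpTo, List.mem_singleton, Nat.le_zero, List.length_eq_zero_iff]
    exact ⟨fun h => ⟨h, by simp [h]⟩, fun h => h.1⟩
  | succ n ih =>
    cases v with
    | nil => simp [listsUpTo]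
    | cons a v => simp [listsUpTo, ih]; tauto

theorem primrec_listsUpTo {α : Type*} [Primcodable α] : Primrec₂ (listsUpTo (α := α)) := by
  have h : Primrec₂ fun (p : List α × ℕ) (q : ℕ × List (List α)) =>
      ([] :: p.1.flatMap fun a => q.2.map (a :: ·) : List (List α)) := by
    refine list_cons.comp (Primrec.const []) (list_flatMap (fst.comp fst) ?_)
    exact list_map (snd.comp (snd.comp fst)) (list_cons.comp (snd.comp fst) snd)
  refine (Primrec.nat_rec' snd (Primrec.const [[]]) h).of_eq fun p => ?_
  obtain ⟨L, n⟩ := p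
  induction n with
  | zero => rfl
  | succ n ih => simp only [listsUpTo, ← ih]

/-- All pairs of a base vector and a list of periods with entries at most `N`, up to repetitions
of periods. -/
def candidates (d N : ℕ) : RepCode :=
  (listsUpTo (List.range (N + 1)) d).flatMap fun b =>
    (listsUpTo (listsUpTo (List.range (N + 1)) d)
      (listsUpTo (List.range (N + 1)) d).length).map fun P => (b, P)

theorem primrec_candidates : Primrec₂ candidates := by
  have hV : Primrec fun p : ℕ × ℕ => listsUpTo (List.range (p.2 + 1)) p.1 :=
    primrec_listsUpTo.comp (list_range.comp (succ.comp snd)) fst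
  refine list_flatMap hV (list_map ?_ ?_)
  · exact (primrec_listsUpTo.comp hV (list_length.comp hV)).comp fst
  · exact (snd.comp fst).pair snd

/-- The vector `v + n p`. -/
def addMul (d n : ℕ) (v p : List ℕ) : List ℕ :=
  (List.range d).map fun i => v.getD i 0 + n * p.getD i 0

theorem decodeVec_addMul (d n : ℕ) (v p : List ℕ) :
    decodeVec d (addMul d n v p) = decodeVec d v + n • decodeVec d p := by
  funext i
  simp [decodeVec, addMul, List.getD_eq_getElem?_getD]

theorem primrec_addMul : Primrec fun p : (ℕ × ℕ) × List ℕ × List ℕ =>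
    addMul p.1.1 p.1.2 p.2.1 p.2.2 := by
  refine list_map (list_range.comp (fst.comp fst)) (nat_add.comp ?_ (nat_mul.comp ?_ ?_))
  · exact (list_getD 0).comp (fst.comp (snd.comp fst)) snd
  · exact snd.comp (fst.comp fst)
  · exact (list_getD 0).comp (snd.comp (snd.comp fst)) snd

/-- The points of a linear set with coefficients at most `M`, starting from a list of base
vectors. -/
def points (d M : ℕ) (S P : List (List ℕ)) : List (List ℕ) :=
  P.foldl (fun S p => S.flatMap fun v => (List.range (M + 1)).map fun n => addMul d n v p) S

theorem primrec_points : Primrec fun p : (ℕ × ℕ) × List (List ℕ) × List (List ℕ) =>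
    points p.1.1 p.1.2 p.2.1 p.2.2 := by
  have h₁ : Primrec fun x : ((((ℕ × ℕ) × List (List ℕ) × List (List ℕ)) ×
      (List (List ℕ) × List ℕ)) × List ℕ) × ℕ =>
      (((x.1.1.1.1.1, x.2), x.1.2, x.1.1.2.2) : (ℕ × ℕ) × List ℕ × List ℕ) :=
    ((fst.comp (fst.comp (fst.comp (fst.comp fst)))).pair snd).pair
      ((snd.comp fst).pair (snd.comp (snd.comp (fst.comp fst))))
  have h₂ : Primrec₂ fun (x : (((ℕ × ℕ) × List (List ℕ) × List (List ℕ)) ×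
      (List (List ℕ) × List ℕ)) × List ℕ) (n : ℕ) => addMul x.1.1.1.1 n x.2 x.1.2.2 :=
    (primrec_addMul.comp h₁).to₂
  have h₃ : Primrec₂ fun (x : ((ℕ × ℕ) × List (List ℕ) × List (List ℕ)) ×
      (List (List ℕ) × List ℕ)) (v : List ℕ) =>
      (List.range (x.1.1.2 + 1)).map fun n => addMul x.1.1.1 n v x.2.2 :=
    (list_map (list_range.comp (succ.comp (snd.comp (fst.comp (fst.comp fst))))) h₂).to₂
  have h₄ : Primrec₂ fun (p : (ℕ × ℕ) × List (List ℕ) × List (List ℕ))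
      (s : List (List ℕ) × List ℕ) => s.1.flatMap fun v => (List.range (p.1.2 + 1)).map
        fun n => addMul p.1.1 n v s.2 := (list_flatMap (fst.comp snd) h₃).to₂
  exact (list_foldl (snd.comp snd) (fst.comp snd) h₄).of_eq fun p => rfl

theorem mem_lset_cons {ι : Type*} {b p y : ι → ℕ} {P : List (ι → ℕ)} :
    y ∈ lset b (p :: P) ↔ ∃ n : ℕ, y ∈ lset (b + n • p) P := by
  have h : y ∈ lset (b + 0) ([p] ++ P) ↔ _ := mem_lset_append
  rw [add_zero] at h
  refine h.trans ⟨?_, ?_⟩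
  · rintro ⟨y₁, h₁, y₂, h₂, rfl⟩
    obtain ⟨n, rfl⟩ := mem_lset_singleton.1 h₁
    obtain ⟨z, hz, rfl⟩ := mem_lset.1 h₂
    exact ⟨n, mem_lset.2 ⟨z, hz, by rw [zero_add]⟩⟩
  · rintro ⟨n, hn⟩
    obtain ⟨z, hz, rfl⟩ := mem_lset.1 hn
    exact ⟨_, mem_lset_singleton.2 ⟨n, rfl⟩, z, mem_lset.2 ⟨z, hz, zero_add z⟩, rfl⟩

theorem le_of_mem_lset {ι : Type*} {b y : ι → ℕ} {P : List (ι → ℕ)} (hy : y ∈ lset b P) :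
    b ≤ y := by
  obtain ⟨z, -, rfl⟩ := mem_lset.1 hy
  exact le_self_add

theorem mem_lset_of_mem_points {d M : ℕ} {S P : List (List ℕ)} {z : List ℕ}
    (hz : z ∈ points d M S P) :
    ∃ v ∈ S, decodeVec d z ∈ lset (decodeVec d v) (P.map (decodeVec d)) := by
  induction P generalizing S with
  | nil => exact ⟨z, hz, self_mem_lset _ _⟩
  | cons p P ih =>
    obtain ⟨v, hv, hmem⟩ := ih hz
    obtain ⟨w, hw, hv⟩ := List.mem_flatMap.1 hv
    obtain ⟨n, -, rfl⟩ := List.mem_map.1 hv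
    rw [decodeVec_addMul] at hmem
    exact ⟨w, hw, mem_lset_cons.2 ⟨n, hmem⟩⟩

/-- A zero period can take the coefficient 0, and a nonzero one with coefficient `n` forces some
entry of `y` to be at least `n`. So coefficients up to `M` reach every point with entries below `M`.
-/
theorem exists_mem_points {d M : ℕ} {S P : List (List ℕ)} {y : Fin d → ℕ} (hy : ∀ i, y i < M)
    {v : List ℕ} (hv : v ∈ S) (hmem : y ∈ lset (decodeVec d v) (P.map (decodeVec d))) :
    ∃ z ∈ points d M S P, decodeVec d z = y := by
  induction P generalizing S v with
  | nil => exact ⟨v, hv, (mem_lset_nil.1 hmem).symm⟩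
  | cons p P ih =>
    have hn : ∃ n ≤ M, y ∈ lset (decodeVec d v + n • decodeVec d p) (P.map (decodeVec d)) := by
      obtain ⟨n, hn⟩ := mem_lset_cons.1 hmem
      by_cases hp : decodeVec d p = 0
      · exact ⟨0, Nat.zero_le _, by simpa [hp] using hn⟩
      · obtain ⟨i, hi⟩ := Function.ne_iff.1 hp
        refine ⟨n, ?_, hn⟩
        have h1 := le_of_mem_lset hn i
        have h2 : n ≤ n * decodeVec d p i := Nat.le_mul_of_pos_right _ (Nat.pos_of_ne_zero hi)
        have h3 := hy i
        simp only [Pi.add_apply, Pi.smul_apply, smul_eq_mul] at h1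
        omega
    obtain ⟨n, hnM, hn⟩ := hn
    rw [← decodeVec_addMul] at hn
    exact ih (List.mem_flatMap.2 ⟨v, hv, List.mem_map.2
      ⟨n, List.mem_range.2 (Nat.lt_succ_of_le hnM), rfl⟩⟩) hn

theorem decodeVec_ofFn {d : ℕ} (b : Fin d → ℕ) : decodeVec d (List.ofFn b) = b := by
  funext i
  simp [decodeVec, List.getD_eq_getElem?_getD]

theorem decodeVec_le {d N : ℕ} {v : List ℕ} (hv : v ∈ listsUpTo (List.range (N + 1)) d)
    (i : Fin d) : decodeVec d v i ≤ N := by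
  rw [decodeVec, List.getD_eq_getElem?_getD]
  rcases lt_or_ge (i : ℕ) v.length with h | h
  · rw [List.getElem?_eq_getElem h]
    have := (mem_listsUpTo.1 hv).2 _ (List.getElem_mem h)
    simpa [Nat.lt_succ_iff] using this
  · simp [List.getElem?_eq_none h]

theorem mem_candidates {d N : ℕ} {q : List ℕ × List (List ℕ)} (hq : q ∈ candidates d N) :
    (∀ i, decodeVec d q.1 i ≤ N) ∧ ∀ p ∈ q.2.map (decodeVec d), ∀ i, p i ≤ N := by
  obtain ⟨b, hb, hq⟩ := List.mem_flatMap.1 hq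
  obtain ⟨P, hP, rfl⟩ := List.mem_map.1 hq
  refine ⟨decodeVec_le hb, fun p' hp' => ?_⟩
  obtain ⟨p, hp, rfl⟩ := List.mem_map.1 hp'
  exact decodeVec_le ((mem_listsUpTo.1 hP).2 p hp)

theorem exists_mem_candidates {d N : ℕ} {b : Fin d → ℕ} {P : List (Fin d → ℕ)}
    (hb : ∀ i, b i ≤ N) (hP : ∀ p ∈ P, ∀ i, p i ≤ N) :
    ∃ q ∈ candidates d N, lset (decodeVec d q.1) (q.2.map (decodeVec d)) = lset b P := by
  classical
  have hV : ∀ v : Fin d → ℕ, (∀ i, v i ≤ N) →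
      List.ofFn v ∈ listsUpTo (List.range (N + 1)) d := by
    intro v hv
    refine mem_listsUpTo.2 ⟨by simp, fun a ha => ?_⟩
    obtain ⟨i, rfl⟩ := (List.mem_ofFn' _ _).1 ha
    exact List.mem_range.2 (Nat.lt_succ_of_le (hv i))
  have hmem : ∀ p ∈ P.dedup.map List.ofFn, p ∈ listsUpTo (List.range (N + 1)) d := by
    intro p' hp'
    obtain ⟨p, hp, rfl⟩ := List.mem_map.1 hp'
    exact hV p (hP p (List.mem_dedup.1 hp))
  refine ⟨(List.ofFn b, P.dedup.map List.ofFn), List.mem_flatMap.2 ⟨_, hV b hb,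
    List.mem_map.2 ⟨_, mem_listsUpTo.2 ⟨?_, hmem⟩, rfl⟩⟩, ?_⟩
  -- Without repetitions there are at most as many periods as bounded vectors.
  · exact ((P.nodup_dedup.map List.ofFn_injective).subperm hmem).length_le
  · have : (P.dedup.map List.ofFn).map (decodeVec d) = P.dedup := by
      rw [List.map_map]
      conv_rhs => rw [← List.map_id P.dedup]
      exact List.map_congr_left fun p _ => decodeVec_ofFn p
    rw [this, decodeVec_ofFn]
    exact Set.Subset.antisymm (fun _ => mem_lset_of_subset fun p => List.mem_dedup.1)
      fun _ => mem_lset_of_subset fun p => List.mem_dedup.2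

end Enumeration

/-! ### A criterion for knapsack-semilinearity -/

section Criterion

open Primrec

variable {Λ : Type*} {G : Type*} [Group G] {σ : Λ → G}

/-- The word obtained from a knapsack expression by substituting numbers for the variables. -/
def instWord (e : Expr Λ) (x : List ℕ) : List Λ :=
  (List.range e.length).flatMap fun i =>
    ((List.range (x.getD i 0)).flatMap fun _ => (e.getD i ([], [])).1) ++ (e.getD i ([], [])).2

theorem primrec_instWord [Primcodable Λ] : Primrec₂ (instWord (Λ := Λ)) := by
  have hget : Primrec fun p : (Expr Λ × List ℕ) × ℕ => p.1.1.getD p.2 ([], []) :=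
    (list_getD ([], [])).comp (fst.comp fst) snd
  refine list_flatMap (list_range.comp (list_length.comp fst)) (list_append.comp
    (list_flatMap ?_ ?_) (snd.comp hget))
  · exact list_range.comp ((list_getD 0).comp (snd.comp fst) snd)
  · exact (fst.comp hget).comp fst

theorem wordVal_instWord (e : Expr Λ) (x : List ℕ) :
    wordVal σ (instWord e x) = 1 ↔ decodeVec e.length x ∈ sol σ e := by
  have hflat : ∀ (l : List ℕ) (f : ℕ → List Λ),
      wordVal σ (l.flatMap f) = (l.map fun i => wordVal σ (f i)).prod := by
    intro l f
    induction l with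
    | nil => simp [wordVal]
    | cons a l ih => rw [List.flatMap_cons, wordVal_append, ih, List.map_cons, List.prod_cons]
  rw [isSolution_iff, instWord, hflat, ← List.map_coe_finRange_eq_range, List.map_map]
  refine Eq.congr_left (congrArg List.prod (List.map_congr_left fun i _ => ?_))
  simp only [Function.comp_apply, wordVal_append, hflat, decodeVec]
  simp [List.getD_eq_getElem?_getD]

/-- A representation of the solution set, computed from a solution of the word problem and a bound
for its norm. -/
def solve (wp : List Λ → Bool) (N : Expr Λ → ℕ) (e : Expr Λ) : RepCode :=
  (candidates e.length (N e)).flatMap fun q =>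
    bif decide (((points e.length (witnessBound e.length (N e)) [q.1] q.2).flatMap fun y =>
      bif wp (instWord e y) then [] else [0]).length = 0) then [q] else []

/-- The points that are not solutions are collected in a list; a candidate is accepted when this
list is empty. -/
theorem mem_solve {wp : List Λ → Bool} {N : Expr Λ → ℕ} {e : Expr Λ}
    {q : List ℕ × List (List ℕ)} : q ∈ solve wp N e ↔ q ∈ candidates e.length (N e) ∧
      ∀ y ∈ points e.length (witnessBound e.length (N e)) [q.1] q.2, wp (instWord e y) = true := by
  have h : ∀ p q : List ℕ × List (List ℕ),
      (q ∈ bif decide (((points e.length (witnessBound e.length (N e)) [p.1] p.2).flatMap fun y =>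
        bif wp (instWord e y) then [] else [0]).length = 0) then [p] else []) ↔
      p = q ∧ ∀ y ∈ points e.length (witnessBound e.length (N e)) [p.1] p.2,
        wp (instWord e y) = true := by
    intro p q
    rw [Bool.cond_decide]
    have h' : ∀ y, ((bif wp (instWord e y) then [] else [0]) = ([] : List ℕ)) ↔
        wp (instWord e y) = true := fun y => by cases wp (instWord e y) <;> simp
    have h'' : (((points e.length (witnessBound e.length (N e)) [p.1] p.2).flatMap fun y =>
        bif wp (instWord e y) then [] else [0]).length = 0) ↔
        ∀ y ∈ points e.length (witnessBound e.length (N e)) [p.1] p.2,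
          wp (instWord e y) = true := by
      rw [List.length_eq_zero_iff, List.flatMap_eq_nil_iff]
      simp only [h']
    by_cases hc : ∀ y ∈ points e.length (witnessBound e.length (N e)) [p.1] p.2,
          wp (instWord e y) = true
    · rw [if_pos (h''.2 hc), List.mem_singleton, and_iff_left hc, eq_comm]
    · rw [if_neg (mt h''.1 hc)]
      exact ⟨fun h => absurd h List.not_mem_nil, fun h => absurd h.2 hc⟩
  simp only [solve, List.mem_flatMap, h]
  exact ⟨fun ⟨p, hp, hpq, hw⟩ => hpq ▸ ⟨hp, hw⟩, fun ⟨hq, hw⟩ => ⟨q, hq, rfl, hw⟩⟩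

theorem primrec_pow : Primrec₂ ((· ^ ·) : ℕ → ℕ → ℕ) :=
  Primrec₂.unpaired'.1 Nat.Primrec.pow

theorem primrec_witnessBound : Primrec₂ witnessBound := by
  have hN : Primrec fun p : ℕ × ℕ => (p.2 + 1) ^ p.1 := primrec_pow.comp (succ.comp snd) fst
  have hb : Primrec fun p : ℕ × ℕ => baseBound p.1 p.2 := nat_mul.comp hN snd
  have he : Primrec fun p : ℕ × ℕ => 2 ^ ((baseBound p.1 p.2 + 1) ^ p.1 * 2 ^ ((p.2 + 1) ^ p.1)) :=
    primrec_pow.comp (Primrec.const 2) (nat_mul.comp (primrec_pow.comp (succ.comp hb) fst)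
      (primrec_pow.comp (Primrec.const 2) hN))
  exact primrec_pow.comp (Primrec.const 2) (nat_mul.comp he he)

theorem computable_solve [Primcodable Λ] {wp : List Λ → Bool} {N : Expr Λ → ℕ}
    (hwp : Computable wp) (hN : Computable N) : Computable (solve wp N) := by
  have hlen : Computable fun e : Expr Λ => e.length := Computable.list_length
  have hW : Computable fun e : Expr Λ => witnessBound e.length (N e) :=
    primrec_witnessBound.to_comp.comp hlen hN
  have hb : Computable fun p : Expr Λ × List ℕ × List (List ℕ) => [p.2.1] :=
    Computable.list_cons.comp (Computable.fst.comp .snd) (Computable.const [])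
  have hM : Computable fun p : Expr Λ × List ℕ × List (List ℕ) =>
      (((p.1.length, witnessBound p.1.length (N p.1)), [p.2.1], p.2.2) :
        (ℕ × ℕ) × List (List ℕ) × List (List ℕ)) :=
    ((hlen.comp .fst).pair (hW.comp .fst)).pair (hb.pair (Computable.snd.comp .snd))
  have hpts : Computable fun p : Expr Λ × List ℕ × List (List ℕ) =>
      points p.1.length (witnessBound p.1.length (N p.1)) [p.2.1] p.2.2 :=
    (Computable.comp primrec_points.to_comp hM).of_eq fun _ => rfl
  have hbad : Computable₂ fun (p : Expr Λ × List ℕ × List (List ℕ)) (y : List ℕ) =>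
      (bif wp (instWord p.1 y) then [] else [0] : List ℕ) :=
    (Computable.cond (hwp.comp (primrec_instWord.to_comp.comp (Computable.fst.comp .fst) .snd))
      (Computable.const []) (Computable.const [0])).to₂
  have hnil : Computable fun l : List ℕ => decide (l.length = 0) :=
    (Primrec.eq.comp list_length (Primrec.const 0)).decide.to_comp
  have hsel : Computable fun p : Expr Λ × List ℕ × List (List ℕ) =>
      (bif decide (((points p.1.length (witnessBound p.1.length (N p.1)) [p.2.1] p.2.2).flatMap
        fun y => bif wp (instWord p.1 y) then [] else [0]).length = 0) then [p.2] else [] :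
          RepCode) :=
    Computable.cond (hnil.comp (computable_list_flatMap hpts hbad))
      (Computable.list_cons.comp .snd (Computable.const [])) (Computable.const [])
  exact (computable_list_flatMap (primrec_candidates.to_comp.comp hlen hN) hsel.to₂).of_eq
    fun e => rfl

/-- A group is knapsack-semilinear if its word problem is decidable and the norm of a
representation of the solution set of every knapsack expression can be bounded effectively. -/
theorem KnapsackSemilinear.of_bound [Primcodable Λ] {wp : List Λ → Bool} (hwp : Computable wp)
    (hwp' : ∀ w, wp w = true ↔ wordVal σ w = 1) {N : Expr Λ → ℕ} (hN : Computable N)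
    (hN' : ∀ e : Expr Λ, e.IsKnapsack →
      ∃ R : SemilinearRep e.length, R.toSet = sol σ e ∧ R.norm ≤ N e) :
    KnapsackSemilinear σ := by
  refine ⟨fun e he => ?_, solve wp N, computable_solve hwp hN, fun e he => ?_⟩
  · obtain ⟨R, hR, -⟩ := hN' e he
    exact (isSemilinearSet_iff_exists_rep _).2 ⟨R, hR⟩
  · obtain ⟨R, hR, hRN⟩ := hN' e he
    ext x
    rw [SemilinearRep.mem_toSet]
    simp only [RepCode.decode, List.mem_map, exists_exists_and_eq_and, mem_solve]
    constructor
    · rintro ⟨q, ⟨hq, hw⟩, hx⟩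
      obtain ⟨h1, h2⟩ := mem_candidates hq
      by_contra hxs
      -- If an accepted linear set contained a non-solution, it would contain a small one, and that
      -- one has been tested.
      obtain ⟨y, hy, hyR, hlt⟩ := exists_mem_lt_witnessBound h1 h2 hRN fun hsub =>
        hxs (hR ▸ hsub hx)
      obtain ⟨z, hz, rfl⟩ := exists_mem_points hlt (List.mem_singleton_self q.1) hy
      refine hyR ?_
      rw [hR, ← wordVal_instWord, ← hwp']
      exact hw z hz
    · intro hx
      rw [← hR] at hx
      obtain ⟨p, hp, hx⟩ := SemilinearRep.mem_toSet.1 hx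
      obtain ⟨h1, h2⟩ := SemilinearRep.norm_le_iff.1 hRN p hp
      obtain ⟨q, hq, hqp⟩ := exists_mem_candidates h1 h2
      refine ⟨q, ⟨hq, fun z hz => ?_⟩, hqp ▸ hx⟩
      obtain ⟨v, hv, hz⟩ := mem_lset_of_mem_points hz
      obtain rfl := List.mem_singleton.1 hv
      rw [hwp', wordVal_instWord, ← hR]
      exact SemilinearRep.mem_toSet.2 ⟨p, hp, hqp ▸ hz⟩

end Criterion

end Knapsack

namespace Knapsack

open scoped Pointwise

/-! ### The word problem and computable bounds for knapsack-semilinear groups -/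

section WordProblem

open Primrec

variable {Λ : Type*} {G : Type*} [Group G] {σ : Λ → G}

theorem zero_mem_lset {ι : Type*} {b : ι → ℕ} {P : List (ι → ℕ)} : 0 ∈ lset b P ↔ b = 0 := by
  refine ⟨fun h => ?_, fun h => h ▸ self_mem_lset _ _⟩
  funext i
  exact Nat.le_zero.1 (le_of_mem_lset h i)

/-- For a letter `a`, the expression `a ^ x * w` has the solution 0 exactly when `w` represents 1,
and a linear set contains 0 exactly when its base is 0. The latter is visible in the code. -/
theorem KnapsackSemilinear.exists_wordProblem [Primcodable Λ] (h : KnapsackSemilinear σ) :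
    ∃ wp : List Λ → Bool, Computable wp ∧ ∀ w, wp w = true ↔ wordVal σ w = 1 := by
  rcases isEmpty_or_nonempty Λ with hΛ | ⟨⟨a⟩⟩
  · refine ⟨fun _ => true, Computable.const _, fun w => ?_⟩
    obtain rfl : w = [] := Subsingleton.elim _ _
    simp [wordVal]
  · obtain ⟨-, f, hf, hfs⟩ := h
    have hq : PrimrecPred fun q : List ℕ × List (List ℕ) => q.1.getD 0 0 = 0 :=
      Primrec.eq.comp ((list_getD 0).comp fst (Primrec.const 0)) (Primrec.const 0)
    have he : Computable fun w : List Λ => ([([a], w)] : Expr Λ) :=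
      Computable.list_cons.comp ((Computable.const [a]).pair Computable.id) (Computable.const [])
    classical
    refine ⟨fun w => decide (∃ q ∈ f [([a], w)], q.1.getD 0 0 = 0),
      hq.exists_mem_list.decide.to_comp.comp (hf.comp he), fun w => ?_⟩
    have hk : Expr.IsKnapsack [([a], w)] := ⟨by simp, by simp⟩
    have h0 : (0 : Fin 1 → ℕ) ∈ sol σ [([a], w)] ↔ wordVal σ w = 1 := by
      change (List.ofFn _).prod = 1 ↔ _
      simp
    rw [decide_eq_true_iff, ← h0, ← hfs _ hk, SemilinearRep.mem_toSet]
    simp only [RepCode.decode, List.mem_map, exists_exists_and_eq_and]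
    refine exists_congr fun q => and_congr_right fun _ => ?_
    refine Iff.trans ?_ zero_mem_lset.symm
    refine ⟨fun h => funext fun i => ?_, fun h => congrFun h ⟨0, by simp⟩⟩
    obtain rfl : i = ⟨0, by simp⟩ := Subsingleton.elim (α := Fin 1) _ _
    exact h

/-- An upper bound for the numbers that occur in a code. -/
def codeSum (c : RepCode) : ℕ := (c.flatMap fun q => q.1 ++ q.2.flatten).foldr (· + ·) 0

theorem primrec_codeSum : Primrec codeSum := by
  have h₁ : Primrec₂ fun (_ : RepCode) (q : List ℕ × List (List ℕ)) => q.1 ++ q.2.flatten :=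
    (list_append.comp (fst.comp snd) (list_flatten.comp (snd.comp snd))).to₂
  have h₂ : Primrec₂ fun (_ : RepCode) (p : ℕ × ℕ) => p.1 + p.2 :=
    (nat_add.comp (fst.comp snd) (snd.comp snd)).to₂
  exact (list_foldr (list_flatMap Primrec.id h₁) (Primrec.const 0) h₂).of_eq fun c => rfl

theorem norm_decode_le_codeSum {c c' : RepCode} (h : ∀ q ∈ c, q ∈ c') (d : ℕ) :
    (c.decode d).norm ≤ codeSum c' := by
  have hle : ∀ l ∈ c'.flatMap (fun q => q.1 ++ q.2.flatten), l ≤ codeSum c' := by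
    intro l hl
    exact List.single_le_sum (by simp) _ hl
  have hdec : ∀ v : List ℕ, (∀ a ∈ v, a ≤ codeSum c') →
      ∀ i : Fin d, decodeVec d v i ≤ codeSum c' := by
    intro v hv i
    rw [decodeVec, List.getD_eq_getElem?_getD]
    rcases lt_or_ge (i : ℕ) v.length with hi | hi
    · rw [List.getElem?_eq_getElem hi]
      exact hv _ (List.getElem_mem hi)
    · simp [List.getElem?_eq_none hi]
  refine SemilinearRep.norm_le_iff.2 fun q' hq' => ?_
  obtain ⟨q, hq, rfl⟩ := List.mem_map.1 hq'
  refine ⟨hdec _ fun a ha => hle a ?_, fun p' hp' => ?_⟩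
  · exact List.mem_flatMap.2 ⟨q, h q hq, List.mem_append_left _ ha⟩
  · obtain ⟨p, hp, rfl⟩ := List.mem_map.1 hp'
    exact hdec _ fun a ha => hle a (List.mem_flatMap.2
      ⟨q, h q hq, List.mem_append_right _ (List.mem_flatten.2 ⟨p, hp, ha⟩)⟩)

/-- The expressions of degree at most `m` with words of length at most `n` over the letters `L`. -/
def exprsUpTo (L : List Λ) (n m : ℕ) : List (Expr Λ) :=
  listsUpTo ((listsUpTo L n).flatMap fun u => (listsUpTo L n).map fun v => (u, v)) m

theorem primrec_exprsUpTo [Primcodable Λ] (L : List Λ) : Primrec₂ (exprsUpTo L) := by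
  have h : Primrec fun n : ℕ => listsUpTo L n := primrec_listsUpTo.comp (Primrec.const L) Primrec.id
  have h₁ : Primrec₂ fun (p : ℕ × List Λ) (v : List Λ) => (p.2, v) :=
    ((snd.comp fst).pair snd).to₂
  have h₂ : Primrec₂ fun (n : ℕ) (u : List Λ) => (listsUpTo L n).map fun v => (u, v) :=
    (list_map (h.comp fst) h₁).to₂
  exact (primrec_listsUpTo.comp ((list_flatMap h h₂).comp fst) snd).to₂

theorem mem_exprsUpTo {L : List Λ} (hL : ∀ a, a ∈ L) {n m : ℕ} {e : Expr Λ} (hn : e.norm ≤ n)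
    (hm : e.length ≤ m) : e ∈ exprsUpTo L n m := by
  refine mem_listsUpTo.2 ⟨hm, fun q hq => ?_⟩
  have h : q.1.length + q.2.length ≤ e.norm :=
    List.single_le_sum (l := e.map fun q => q.1.length + q.2.length) (by simp) _
      (List.mem_map_of_mem hq)
  exact List.mem_flatMap.2 ⟨q.1, mem_listsUpTo.2 ⟨by omega, fun a _ => hL a⟩,
    List.mem_map.2 ⟨q.2, mem_listsUpTo.2 ⟨by omega, fun a _ => hL a⟩, rfl⟩⟩

/-- The sum of all numbers in the codes of all expressions of bounded size dominates the maximum.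
Unsolvable or ill-formed expressions in the list can only enlarge it. -/
theorem KnapsackSemilinear.exists_bound_K [Primcodable Λ] [Finite Λ] (h : KnapsackSemilinear σ) :
    ∃ b : ℕ → ℕ → ℕ, Computable₂ b ∧ ∀ n m, K σ n m ≤ b n m := by
  obtain ⟨L, hL⟩ := (Set.finite_univ (α := Λ)).exists_finset_coe
  obtain ⟨-, f, hf, hfs⟩ := h
  have h₁ : Computable₂ fun n m => (exprsUpTo L.toList n m).flatMap f :=
    (computable_list_flatMap (primrec_exprsUpTo L.toList).to_comp (hf.comp .snd).to₂).to₂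
  refine ⟨fun n m => codeSum ((exprsUpTo L.toList n m).flatMap f),
    (primrec_codeSum.to_comp.comp h₁).to₂, fun n m => K_le fun e he => ?_⟩
  refine (mag_le_of_rep (hfs e he.1)).trans (norm_decode_le_codeSum (fun q hq => ?_) _)
  refine List.mem_flatMap.2 ⟨e, mem_exprsUpTo (fun a => ?_) he.2.2.1 he.2.2.2, hq⟩
  rw [Finset.mem_toList, ← Finset.mem_coe, hL]
  exact Set.mem_univ a

end WordProblem

/-! ### The word problem of an HNN-extension -/

section HNNWordProblem

open HNNExtension

variable {G : Type*} [Group G] {A B : Subgroup G} {ψ : A ≃* B} {Λ : Type*} {σ : Λ → G}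

/-- The exponent given by a truth value. -/
def sgn (b : Bool) : ℤˣ := bif b then 1 else -1

theorem sgn_eq_neg {b c : Bool} (h : c ≠ b) : (sgn c : ℤ) = -(sgn b : ℤ) := by
  revert b c; decide

/-- The first entry of the table of pairs of words whose first component is inverse to `w`. -/
def lookup (wp : List Λ → Bool) : List (List Λ × List Λ) → List Λ → Option (List Λ)
  | [], _ => none
  | p :: T, w => bif wp (w ++ p.1) then some p.2 else lookup wp T w

theorem computable_lookup [Primcodable Λ] {wp : List Λ → Bool} (hwp : Computable wp)
    (T : List (List Λ × List Λ)) : Computable (lookup wp T) := by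
  induction T with
  | nil => exact Computable.const none
  | cons p T ih =>
    exact (Computable.cond (hwp.comp (Computable.list_append.comp .id (Computable.const p.1)))
      (Computable.const (some p.2)) ih).of_eq fun w => rfl

/-- The list of pairs of words describes the isomorphism between the associated subgroups. -/
def IsTable (ψ : A ≃* B) (σ : Λ → G) (u : ℤˣ) (T : List (List Λ × List Λ)) : Prop :=
  (∀ p ∈ T, ∃ a : toSubgroup A B u, wordVal σ p.1 = (a : G)⁻¹ ∧
    wordVal σ p.2 = toSubgroupEquiv ψ u a) ∧
  ∀ a : toSubgroup A B u, ∃ p ∈ T, wordVal σ p.1 = (a : G)⁻¹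

theorem exists_isTable [Finite A] [Finite B] (hgen : Subgroup.closure (Set.range σ) = ⊤)
    (hsym : ∀ i, ∃ j, σ j = (σ i)⁻¹) (u : ℤˣ) : ∃ T, IsTable ψ σ u T := by
  have : Finite (toSubgroup A B u) := by
    rcases Int.units_eq_one_or u with rfl | rfl
    · exact inferInstanceAs (Finite A)
    · exact inferInstanceAs (Finite B)
  obtain ⟨F, hF⟩ := (Set.finite_univ (α := toSubgroup A B u)).exists_finset_coe
  choose W hW using exists_word hgen hsym
  refine ⟨F.toList.map fun a : toSubgroup A B u => (W (a : G)⁻¹, W (toSubgroupEquiv ψ u a)),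
    fun p hp => ?_,
    fun a => ⟨_, List.mem_map_of_mem (a := a) ?_, hW _⟩⟩
  · obtain ⟨a, -, rfl⟩ := List.mem_map.1 hp
    exact ⟨a, hW _, hW _⟩
  · rw [Finset.mem_toList, ← Finset.mem_coe, hF]
    exact Set.mem_univ a

variable {wp : List Λ → Bool}

theorem of_lookup_eq_some (hwp : ∀ w, wp w = true ↔ wordVal σ w = 1) {u : ℤˣ}
    {T : List (List Λ × List Λ)} (hT : ∀ p ∈ T, ∃ a : toSubgroup A B u,
      wordVal σ p.1 = (a : G)⁻¹ ∧ wordVal σ p.2 = toSubgroupEquiv ψ u a) {w v : List Λ}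
    (h : lookup wp T w = some v) : ∃ a : toSubgroup A B u, wordVal σ w = a ∧
      wordVal σ v = toSubgroupEquiv ψ u a := by
  induction T with
  | nil => simp [lookup] at h
  | cons p T ih =>
    rw [List.forall_mem_cons] at hT
    rw [lookup] at h
    cases hc : wp (w ++ p.1) with
    | true =>
      rw [hc, cond_true, Option.some.injEq] at h
      obtain ⟨a, h1, h2⟩ := hT.1
      rw [hwp, wordVal_append, h1, mul_inv_eq_one] at hc
      exact ⟨a, hc, h ▸ h2⟩
    | false =>
      rw [hc, cond_false] at h
      exact ih hT.2 h

theorem of_lookup_eq_none (hwp : ∀ w, wp w = true ↔ wordVal σ w = 1)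
    {T : List (List Λ × List Λ)} {w : List Λ} (h : lookup wp T w = none)
    {p : List Λ × List Λ} (hp : p ∈ T) : wordVal σ w * wordVal σ p.1 ≠ 1 := by
  induction T with
  | nil => simp at hp
  | cons q T ih =>
    rw [lookup] at h
    cases hc : wp (w ++ q.1) with
    | true => simp [hc] at h
    | false =>
      rw [hc, cond_false] at h
      rcases List.mem_cons.1 hp with rfl | hp
      · rw [← wordVal_append, Ne, ← hwp, hc]; simp
      · exact ih h hp

/-- A reduced word, given by a word for its first element and a list of syllables. -/
abbrev Stack (Λ : Type*) := List Λ × List (Bool × List Λ)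

/-- The syllables of a stack. -/
def Stack.syls (σ : Λ → G) (s : Stack Λ) : List (ℤˣ × G) :=
  s.2.map fun p => (sgn p.1, wordVal σ p.2)

/-- The element represented by a stack. -/
def Stack.val (ψ : A ≃* B) (σ : Λ → G) (s : Stack Λ) : HNNExtension G A B ψ :=
  of (wordVal σ s.1) * sylProd ψ (s.syls σ)

/-- The outcome of a pinch of the stable letter with exponent `b` and the first syllable. -/
def pinch (wp : List Λ → Bool) (T : List (List Λ × List Λ)) (b : Bool) (s : Stack Λ) :
    Option (List Λ) :=
  s.2.head?.bind fun c => bif c.1 == b then none else (lookup wp T s.1).map fun w => w ++ c.2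

/-- Multiplication of the element represented by a stack by a power of the stable letter. -/
def push (wp : List Λ → Bool) (T : List (List Λ × List Λ)) (b : Bool) (s : Stack Λ) : Stack Λ :=
  (pinch wp T b s).casesOn ([], (b, s.1) :: s.2) fun w => (w, s.2.tail)

theorem computable_push [Primcodable Λ] (hwp : Computable wp) (T : List (List Λ × List Λ))
    (b : Bool) : Computable (push wp T b) := by
  have h₁ : Computable₂ fun (p : Stack Λ × (Bool × List Λ)) (w : List Λ) => w ++ p.2.2 :=
    (Computable.list_append.comp .snd (Computable.snd.comp (Computable.snd.comp .fst))).to₂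
  have h₂ : Computable fun p : Stack Λ × (Bool × List Λ) =>
      (lookup wp T p.1.1).map fun w => w ++ p.2.2 :=
    Computable.option_map ((computable_lookup hwp T).comp (Computable.fst.comp .fst)) h₁
  have h₃ : Computable₂ fun (s : Stack Λ) (c : Bool × List Λ) =>
      (bif c.1 == b then none else (lookup wp T s.1).map fun w => w ++ c.2 : Option (List Λ)) :=
    (Computable.cond ((Primrec.beq.comp (Primrec.fst.comp Primrec.snd)
      (Primrec.const b)).to_comp) (Computable.const none) h₂).to₂
  have h₄ : Computable (pinch wp T b) :=
    Computable.option_bind (Primrec.list_head?.to_comp.comp .snd) h₃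
  have h₅ : Computable fun s : Stack Λ => (([], (b, s.1) :: s.2) : Stack Λ) :=
    (Computable.const []).pair (Computable.list_cons.comp ((Computable.const b).pair .fst) .snd)
  have h₆ : Computable₂ fun (s : Stack Λ) (w : List Λ) => ((w, s.2.tail) : Stack Λ) :=
    (Computable.snd.pair (Primrec.list_tail.to_comp.comp (Computable.snd.comp .fst))).to₂
  exact (Computable.option_casesOn h₄ h₅ h₆).of_eq fun s => rfl

/-- For opposite exponents a pinch occurs exactly when `w` represents an element of the associated
subgroup, which the table detects; in all other cases the new corner is irreducible. -/
theorem push_spec (hwp : ∀ w, wp w = true ↔ wordVal σ w = 1) {T : List (List Λ × List Λ)}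
    {b : Bool} (hT : IsTable ψ σ (sgn b) T) {s : Stack Λ} (hs : Red A B (s.syls σ)) :
    Red A B ((push wp T b s).syls σ) ∧
      (push wp T b s).val ψ σ = t ^ (sgn b : ℤ) * s.val ψ σ := by
  obtain ⟨w, S⟩ := s
  have hpush : (∀ s' ∈ (Stack.syls σ (w, S)).head?, Irred A B (sgn b, wordVal σ w) 1 s'.1) →
      Red A B (Stack.syls σ ([], (b, w) :: S)) ∧
        Stack.val ψ σ ([], (b, w) :: S) = t ^ (sgn b : ℤ) * Stack.val ψ σ (w, S) := by
    intro h
    refine ⟨Red.cons hs h, ?_⟩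
    simp [Stack.val, Stack.syls, sylVal, wordVal_nil, mul_assoc]
  rcases S with _ | ⟨⟨c, v⟩, S⟩
  · exact hpush (by simp [Stack.syls])
  · by_cases hcb : c = b
    · have : push wp T b (w, (c, v) :: S) = ([], (b, w) :: (c, v) :: S) := by
        simp [push, pinch, hcb]
      rw [this]
      exact hpush (by simp [Stack.syls, Irred, hcb])
    · have hpinch : pinch wp T b (w, (c, v) :: S) = (lookup wp T w).map fun w => w ++ v := by
        simp [pinch, beq_eq_false_iff_ne.2 hcb]
      cases hl : lookup wp T w with
      | none =>
        have : push wp T b (w, (c, v) :: S) = ([], (b, w) :: (c, v) :: S) := by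
          simp [push, hpinch, hl]
        rw [this]
        refine hpush ?_
        intro s' hs' hmem
        rw [mul_one] at hmem
        obtain ⟨p, hp, hpv⟩ := hT.2 ⟨_, hmem⟩
        exact absurd (by rw [hpv, mul_inv_cancel]) (of_lookup_eq_none hwp hl hp)
      | some w' =>
        have : push wp T b (w, (c, v) :: S) = (w' ++ v, S) := by
          simp [push, hpinch, hl]
        rw [this]
        obtain ⟨a, h1, h2⟩ := of_lookup_eq_some hwp hT.1 hl
        refine ⟨hs.of_cons, ?_⟩
        have hcs : (sgn c : ℤ) = -(sgn b : ℤ) := sgn_eq_neg hcb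
        simp only [Stack.val, Stack.syls, List.map_cons, sylProd_cons, sylVal, wordVal_append,
          map_mul, h1, h2, hcs]
        rw [← mul_assoc (t ^ (sgn b : ℤ)), t_zpow_mul_of]
        simp [mul_assoc]

/-- Multiplication of the element represented by a stack by a letter. -/
def step (wp : List Λ → Bool) (T₁ T₂ : List (List Λ × List Λ)) (a : Λ ⊕ Bool) (s : Stack Λ) :
    Stack Λ :=
  a.casesOn (fun a => (a :: s.1, s.2)) fun b => bif b then push wp T₁ true s else push wp T₂ false s

theorem computable_step [Primcodable Λ] (hwp : Computable wp) (T₁ T₂ : List (List Λ × List Λ)) :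
    Computable₂ (step wp T₁ T₂) := by
  have h₁ : Computable₂ fun (p : (Λ ⊕ Bool) × Stack Λ) (a : Λ) => ((a :: p.2.1, p.2.2) : Stack Λ) :=
    ((Computable.list_cons.comp .snd (Computable.fst.comp (Computable.snd.comp .fst))).pair
      (Computable.snd.comp (Computable.snd.comp .fst))).to₂
  have h₂ : Computable₂ fun (p : (Λ ⊕ Bool) × Stack Λ) (b : Bool) =>
      (bif b then push wp T₁ true p.2 else push wp T₂ false p.2 : Stack Λ) :=
    (Computable.cond .snd ((computable_push hwp T₁ true).comp (Computable.snd.comp .fst))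
      ((computable_push hwp T₂ false).comp (Computable.snd.comp .fst))).to₂
  exact ((Computable.sumCasesOn .fst h₁ h₂).of_eq fun p => rfl).to₂

theorem foldr_step_spec (hwp : ∀ w, wp w = true ↔ wordVal σ w = 1)
    {T₁ T₂ : List (List Λ × List Λ)} (hT₁ : IsTable ψ σ 1 T₁) (hT₂ : IsTable ψ σ (-1) T₂)
    (w : List (Λ ⊕ Bool)) :
    Red A B ((w.foldr (step wp T₁ T₂) ([], [])).syls σ) ∧
      (w.foldr (step wp T₁ T₂) ([], [])).val ψ σ = wordVal (letterVal ψ σ) w := by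
  induction w with
  | nil => exact ⟨List.isChain_nil, by simp [Stack.val, Stack.syls, wordVal_nil]⟩
  | cons a w ih =>
    rw [List.foldr_cons, wordVal_cons, ← ih.2]
    rcases a with a | (_ | _)
    · exact ⟨ih.1, by simp [Stack.val, Stack.syls, step, wordVal_cons, letterVal, mul_assoc]⟩
    · have := push_spec (b := false) hwp hT₂ ih.1
      exact ⟨this.1, this.2.trans (by simp [sgn, letterVal])⟩
    · have := push_spec (b := true) hwp hT₁ ih.1
      exact ⟨this.1, this.2.trans (by simp [sgn, letterVal])⟩

theorem exists_wordProblem_letterVal [Primcodable Λ] [Finite A] [Finite B]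
    (hgen : Subgroup.closure (Set.range σ) = ⊤) (hsym : ∀ i, ∃ j, σ j = (σ i)⁻¹)
    (hwpc : Computable wp) (hwp : ∀ w, wp w = true ↔ wordVal σ w = 1) :
    ∃ wp' : List (Λ ⊕ Bool) → Bool, Computable wp' ∧
      ∀ w, wp' w = true ↔ wordVal (letterVal ψ σ) w = 1 := by
  obtain ⟨T₁, hT₁⟩ := exists_isTable (ψ := ψ) hgen hsym 1
  obtain ⟨T₂, hT₂⟩ := exists_isTable (ψ := ψ) hgen hsym (-1)
  have h₁ : Computable fun w : List (Λ ⊕ Bool) => w.foldr (step wp T₁ T₂) ([], []) := by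
    have h : Computable₂ fun (_ : List (Λ ⊕ Bool)) (p : (Λ ⊕ Bool) × Stack Λ) =>
        step wp T₁ T₂ p.1 p.2 :=
      ((computable_step hwpc T₁ T₂).comp (Computable.fst.comp .snd)
        (Computable.snd.comp .snd)).to₂
    exact computable_list_foldr Computable.id (Computable.const ([], [])) h
  have h₂ : Computable fun s : Stack Λ => bif decide (s.2.length = 0) then wp s.1 else false :=
    Computable.cond ((Primrec.eq.comp (Primrec.list_length.comp Primrec.snd)
      (Primrec.const 0)).decide.to_comp) (hwpc.comp .fst) (Computable.const false)
  refine ⟨_, h₂.comp h₁, fun w => ?_⟩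
  obtain ⟨hr, hv⟩ := foldr_step_spec hwp hT₁ hT₂ w
  rw [← hv]
  generalize w.foldr (step wp T₁ T₂) ([], []) = s at hr
  obtain ⟨v, S⟩ := s
  -- An empty list of syllables leaves a word problem in the base group; a nonempty reduced one is
  -- nontrivial by Britton's lemma.
  rcases S with _ | ⟨⟨b, v'⟩, S⟩
  · have : (of (wordVal σ v) : HNNExtension G A B ψ) = 1 ↔ wordVal σ v = 1 :=
      map_eq_one_iff of (of_injective (φ := ψ))
    simp [Stack.val, Stack.syls, hwp, this]
  · have : Stack.val ψ σ (v, (b, v') :: S) ≠ 1 :=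
      RedFrom.of_mul_ne_one (φ := ψ) (u := sgn b) ⟨_, _, hr, rfl⟩ _
    simpa using this

/-- An HNN-extension of a knapsack-semilinear group with finite associated subgroups is
knapsack-semilinear. -/
theorem KnapsackSemilinear.hnnGen [Primcodable Λ] [Finite Λ] [Finite A] (φ : A ≃* B)
    (hgen : Subgroup.closure (Set.range σ) = ⊤) (hsym : ∀ i, ∃ j, σ j = (σ i)⁻¹)
    (hAB : ∀ g : G, g ∈ A ∨ g ∈ B → g ≠ 1 → g ∈ Set.range σ) (h : KnapsackSemilinear σ) :
    KnapsackSemilinear (hnnGen φ σ) := by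
  have : Finite B := Finite.of_equiv A φ.toEquiv
  obtain ⟨wp, hwpc, hwp⟩ := h.exists_wordProblem
  obtain ⟨wp', hwpc', hwp'⟩ := exists_wordProblem_letterVal (ψ := φ.symm) hgen hsym hwpc hwp
  obtain ⟨b, hb, hKb⟩ := h.exists_bound_K
  have hlen : Computable fun e : Expr (Λ ⊕ Bool) => e.length := Computable.list_length
  have hnorm : Primrec fun e : Expr (Λ ⊕ Bool) => e.norm := by
    have h₁ : Primrec₂ fun (_ : Expr (Λ ⊕ Bool)) (p : (List (Λ ⊕ Bool) × List (Λ ⊕ Bool)) × ℕ) =>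
        p.1.1.length + p.1.2.length + p.2 :=
      (Primrec.nat_add.comp (Primrec.nat_add.comp
        (Primrec.list_length.comp (Primrec.fst.comp (Primrec.fst.comp Primrec.snd)))
        (Primrec.list_length.comp (Primrec.snd.comp (Primrec.fst.comp Primrec.snd))))
        (Primrec.snd.comp Primrec.snd)).to₂
    refine (Primrec.list_foldr Primrec.id (Primrec.const 0) h₁).of_eq fun e => ?_
    induction e with
    | nil => rfl
    | cons q e ih =>
      simp only [id_eq] at ih
      simp only [id_eq, List.foldr_cons, ih, Expr.norm, List.map_cons, List.sum_cons]
  -- In the norm bound `K` is replaced by its computable upper bound `b`.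
  have hKc : Computable fun e : Expr (Λ ⊕ Bool) => b (24 * e.length * e.norm) e.length :=
    hb.comp (Primrec.nat_mul.to_comp.comp (Primrec.nat_mul.to_comp.comp (Computable.const 24) hlen)
      hnorm.to_comp) hlen
  have hCc : Primrec fun e : Expr (Λ ⊕ Bool) =>
      12 * (Nat.card A ^ 2 * e.length * e.norm ^ 4) :=
    Primrec.nat_mul.comp (Primrec.const 12) (Primrec.nat_mul.comp
      (Primrec.nat_mul.comp (Primrec.const _) Primrec.list_length)
      (primrec_pow.comp hnorm (Primrec.const 4)))
  rw [hnnGen_eq_letterVal]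
  refine KnapsackSemilinear.of_bound hwpc' hwp' (Primrec.nat_max.to_comp.comp hKc hCc.to_comp)
    fun e he => ?_
  obtain ⟨R, hR, hle⟩ := exists_rep_sol_hnnGen φ hgen hsym hAB h.1 e he
  rw [hnnGen_eq_letterVal] at hR
  exact ⟨R, hR, hle.trans (max_le_max (hKb _ _) le_rfl)⟩

end HNNWordProblem

end Knapsack

/-! ### The main theorem -/

theorem mainTheorem2 :
    ∃ C : ℕ, ∀ (G : Type*) [Group G] (r : ℕ) (σ : Fin r → G) (A B : Subgroup G) (φ : A ≃* B)
      [Finite A],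
      Subgroup.closure (Set.range σ) = ⊤ →
      (∀ i, ∃ j, σ j = (σ i)⁻¹) →
      (∀ g : G, g ∈ A ∨ g ∈ B → g ≠ 1 → g ∈ Set.range σ) →
      (Knapsack.HasSemilinearSolutions σ →
        Knapsack.HasSemilinearSolutions (Knapsack.hnnGen φ σ) ∧
        ∀ n m : ℕ, m ≤ n →
          Knapsack.K (Knapsack.hnnGen φ σ) n m ≤
            max (Knapsack.K σ (24 * m * n) m) (C * (Nat.card A ^ 2 * m * n ^ 4))) ∧
      (Knapsack.KnapsackSemilinear σ →
        Knapsack.KnapsackSemilinear (Knapsack.hnnGen φ σ)) :=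
  ⟨12, fun _ _ _ _ _ _ φ _ hgen hsym hAB =>
    ⟨fun hsl => ⟨Knapsack.hasSemilinearSolutions_hnnGen φ hgen hsym hAB hsl,
      fun n m _ => Knapsack.K_hnnGen_le φ hgen hsym hAB hsl n m⟩,
    Knapsack.KnapsackSemilinear.hnnGen φ hgen hsym hAB⟩⟩
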